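/- Let $a>0$ and consider walks in the quadrant $\mathbb{Z}_{\ge 0}^2$ starting at $(0,0)$, with steps N, E, S, W of weight $1$ and NE of weight $a$, so that the step polynomial is $S(x,y)=x+y+\frac1x+\frac1y+axy$ and the kernel is $K(x,y)=xy\,(1-tS(x,y))$. Let $Q(0,0)=\sum_{n\ge0}q_n t^n$, where $q_n$ is the weighted number of such walks of length $n$ ending at $(0,0)$, and let $t_c$ be the smallest positive singularity of $Q(0,0)$. For $\Im\tau>0$ let $$\vartheta(z|\tau)=\sum_{n=0}^{\infty}(-1)^n e^{i\pi\tau(n+\frac12)^2}\left(e^{(2n+1)iz}-e^{-(2n+1)iz}\right),$$ and let $\vartheta'$ be its derivative in $z$. A theta parametrisation at $t$ is a triple $(c,\gamma,\tau)\in\mathbb{C}^3$ with $\gamma,\tau\in i\mathbb{R}$ and $0<\Im(2\gamma)<\Im(\pi\tau)$ such that $$ac^3=-\frac{\vartheta(4\gamma|\tau)}{\vartheta(2\gamma|\tau)},\qquad c^2=\frac{\vartheta(3\gamma|\tau)}{\vartheta(\gamma|\tau)},\qquad \frac ct=4\frac{\vartheta'(\gamma|\tau)\vartheta(2\gamma|\tau)}{\vartheta'(0|\tau)\vartheta(\gamma|\tau)}-2\frac{\vartheta'(2\gamma|\tau)}{\vartheta'(0|\tau)},$$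 and such that the functions $$X(z)=c\,\frac{\vartheta(z|\tau)\vartheta(z+\gamma|\tau)}{\vartheta(z-\gamma|\tau)\vartheta(z+2\gamma|\tau)},\qquad Y(z)=c\,\frac{\vartheta(z|\tau)\vartheta(z-\gamma|\tau)}{\vartheta(z+\gamma|\tau)\vartheta(z-2\gamma|\tau)}=X(-z)$$ satisfy $K(X(z),Y(z))=0$ wherever both are finite. Then $t_c>0$; for every $t\in(0,t_c)$ a theta parametrisation exists, and the nome $q=e^{i\pi\tau}$ is the same for all theta parametrisations at $t$. So $q=q(t)$ is a function of $t\in(0,t_c)$, and moreover: 1. $q(t)$ is real with $0<q(t)<1$ for $0<t<t_c$; 2. $q(t)$ is continuous on $(0,t_c)$; 3. $\lim_{t\to0^+}q(t)=0$; 4. $\lim_{t\to t_c^-}q(t)=1$. -/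

import Mathlib

open Set Filter Topology

noncomputable section

/-- The Jacobi theta function
`ϑ(z|τ) = ∑_{n ≥ 0} (-1)^n e^{iπτ(n+1/2)²} (e^{(2n+1)iz} - e^{-(2n+1)iz})`. -/
def jacobiTh (z τ : ℂ) : ℂ :=
  ∑' n : ℕ, (-1 : ℂ) ^ n * Complex.exp (Complex.I * Real.pi * τ * ((n : ℂ) + 1 / 2) ^ 2) *
    (Complex.exp ((2 * (n : ℂ) + 1) * Complex.I * z)
      - Complex.exp (-((2 * (n : ℂ) + 1) * Complex.I * z)))

/-- The derivative `ϑ'(z|τ)` with respect to the first variable. -/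
def jacobiThDeriv (z τ : ℂ) : ℂ := deriv (fun w : ℂ => jacobiTh w τ) z

/-- The kernel `K(x,y) = xy(1 - t S(x,y))`, as a polynomial, for the step polynomial
`S(x,y) = x + y + 1/x + 1/y + a x y`. -/
def walkKernel (a t : ℝ) (x y : ℂ) : ℂ :=
  x * y - t * (x ^ 2 * y + x * y ^ 2 + y + x + a * x ^ 2 * y ^ 2)

/-- `X(z) = c ϑ(z) ϑ(z+γ) / (ϑ(z-γ) ϑ(z+2γ))`; the second coordinate is `Y(z) = X(-z)`. -/
def thetaX (c γ τ z : ℂ) : ℂ :=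
  c * (jacobiTh z τ * jacobiTh (z + γ) τ) / (jacobiTh (z - γ) τ * jacobiTh (z + 2 * γ) τ)

/-- `Y(z) = c ϑ(z) ϑ(z-γ) / (ϑ(z+γ) ϑ(z-2γ))`. -/
def thetaY (c γ τ z : ℂ) : ℂ :=
  c * (jacobiTh z τ * jacobiTh (z - γ) τ) / (jacobiTh (z + γ) τ * jacobiTh (z - 2 * γ) τ)

/-- `(c, γ, τ)` is a theta parametrisation of the kernel curve of the walk with unit weight on
the steps N, E, S, W and weight `a` on the step NE, at the value `t`. -/
structure IsThetaParametrisation (a t : ℝ) (c γ τ : ℂ) : Prop where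
  gamma_re : γ.re = 0
  tau_re : τ.re = 0
  gamma_pos : 0 < (2 * γ).im
  gamma_lt : (2 * γ).im < ((Real.pi : ℂ) * τ).im
  eq_c3 : (a : ℂ) * c ^ 3 = -(jacobiTh (4 * γ) τ / jacobiTh (2 * γ) τ)
  eq_c2 : c ^ 2 = jacobiTh (3 * γ) τ / jacobiTh γ τ
  eq_t : c / (t : ℂ) =
    4 * (jacobiThDeriv γ τ * jacobiTh (2 * γ) τ / (jacobiThDeriv 0 τ * jacobiTh γ τ))
      - 2 * (jacobiThDeriv (2 * γ) τ / jacobiThDeriv 0 τ)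
  /-- The point `(X(z), Y(z))` lies on the kernel curve, wherever `X` and `Y` are finite. -/
  on_curve : ∀ z : ℂ, jacobiTh (z - γ) τ * jacobiTh (z + 2 * γ) τ ≠ 0 →
    jacobiTh (z + γ) τ * jacobiTh (z - 2 * γ) τ ≠ 0 →
    walkKernel a t (thetaX c γ τ z) (thetaY c γ τ z) = 0

/-- The weighted number of walks of length `n` from `(0,0)` to `(i,j)` that stay in the quadrant
`i, j ≥ 0`, with steps N, E, S, W of weight `1` and NE of weight `a`. -/
def quadrantWalks (a : ℝ) : ℕ → ℤ → ℤ → ℝ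
  | 0, i, j => if i = 0 ∧ j = 0 then 1 else 0
  | n + 1, i, j =>
    if 0 ≤ i ∧ 0 ≤ j then
      quadrantWalks a n (i - 1) j + quadrantWalks a n (i + 1) j
        + quadrantWalks a n i (j - 1) + quadrantWalks a n i (j + 1)
        + a * quadrantWalks a n (i - 1) (j - 1)
    else 0

/-- The generating function `Q(0,0;t)` of quadrant excursions (used for `t` near `0` only). -/
def excursionSeries (a t : ℝ) : ℝ := ∑' n : ℕ, quadrantWalks a n 0 0 * t ^ n

/-- The critical point `t_c`: the smallest positive singularity of `Q(0,0;t)`. There is a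
singularity in `(0, s]` exactly when the germ of the series at `0` has no analytic continuation
along `[0, s]`. -/
def criticalPoint (a : ℝ) : ℝ :=
  sInf {s : ℝ | 0 < s ∧
    ¬ ∃ g : ℝ → ℝ, AnalyticOnNhd ℝ g (Icc 0 s) ∧ g =ᶠ[𝓝 0] excursionSeries a}

end

/-!
The theta functions satisfy Weierstrass' three-term relation, whose differentiated form shows that
the step polynomial is constant along the curve `z ↦ (X z, Y z)`. The three equations of a theta
parametrisation say precisely that this constant is `1 / t`, so that the condition `K(X, Y) = 0`
is automatic.

Jacobi's imaginary transformation turns the imaginary parameters `γ`, `τ` into a real angle `φ` and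
the dual nome `p = exp (-iπ / τ)`. For each `p` exactly one angle and one scale solve the equations
for `a c³` and `c²`, which makes `1 / t` a continuous function of `p`. It is injective: the
branch points of `X` depend on `t` only, they are explicit theta quotients, and a cross-ratio of the
two pairs they form determines the elliptic modulus, hence the nome. As `p → 1` the value of `1 / t`
tends to infinity; at `p = 0` it is `S(x, x)` with `a x³ + x² = 1`, the minimum of the step
polynomial on the diagonal.

This minimum is `1 / t_c`: weighting the walks by `x ^ (i + j)` bounds their number from above, a
paraboloid bump is an almost-subsolution of the transfer operator and bounds it from below, and
Pringsheim's theorem places the singularity at the radius of convergence. So `q` is the inverse of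
a continuous injective function with the right limits at both ends.
-/

open scoped Real

section ThreeTerm

variable {𝕜 : Type*} [NontriviallyNormedField 𝕜] {f g : 𝕜 → 𝕜} {a c φ v u : 𝕜}

/-- Weierstrass' three-term relation for an odd theta function `f`, in which the variable `x` has
been translated: `g` stands for a translate of `f`, up to an exponential factor. -/
structure IsThreeTermPair (f g : 𝕜 → 𝕜) : Prop where
  map_zero : f 0 = 0
  map_neg : ∀ x, f (-x) = -f x
  differentiable_left : Differentiable 𝕜 f
  differentiable_right : Differentiable 𝕜 g
  three_term : ∀ x y z w, g (x + y) * g (x - y) * (f (z + w) * f (z - w))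
    - g (x + z) * g (x - z) * (f (y + w) * f (y - w))
    + g (x + w) * g (x - w) * (f (y + z) * f (y - z)) = 0

/-- The equations of a theta parametrisation for the theta function `f`, cleared of denominators:
`c` is the prefactor, `φ` the angle and `v = 1/t` the value of the step polynomial. -/
structure SolvesThetaEquations (f : 𝕜 → 𝕜) (a c φ v : 𝕜) : Prop where
  cube : a * c ^ 3 * f (2 * φ) = -f (4 * φ)
  sq : c ^ 2 * f φ = f (3 * φ)
  step : c * v * (deriv f 0 * f φ) = 4 * deriv f φ * f (2 * φ) - 2 * deriv f (2 * φ) * f φ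

/-- The first coordinate `X` of the curve parametrised by the theta function `g`. -/
def ratioX (g : 𝕜 → 𝕜) (c φ u : 𝕜) : 𝕜 :=
  c * (g u * g (u + φ)) / (g (u - φ) * g (u + 2 * φ))

/-- The second coordinate `Y` of the curve parametrised by the theta function `g`. -/
def ratioY (g : 𝕜 → 𝕜) (c φ u : 𝕜) : 𝕜 :=
  c * (g u * g (u - φ)) / (g (u + φ) * g (u - 2 * φ))

namespace IsThreeTermPair

lemma comp_add_const (h : IsThreeTermPair f g) (s : 𝕜) :
    IsThreeTermPair f (fun x => g (x + s)) where
  map_zero := h.map_zero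
  map_neg := h.map_neg
  differentiable_left := h.differentiable_left
  differentiable_right := h.differentiable_right.comp (differentiable_id.add_const s)
  three_term x y z w := by
    simpa only [add_right_comm x, sub_add_eq_add_sub] using h.three_term (x + s) y z w

theorem deriv_three_term (h : IsThreeTermPair f g) (x y : 𝕜) :
    deriv g (x - y) * g (x + y) * f y ^ 2 - deriv g (x + y) * g (x - y) * f y ^ 2
      + 2 * deriv f y * f y * (g (x + y) * g (x - y)) = deriv f 0 * f (2 * y) * g x ^ 2 := by
  have hf z : HasDerivAt f (deriv f z) z := (h.differentiable_left z).hasDerivAt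
  have hg z : HasDerivAt g (deriv g z) z := (h.differentiable_right z).hasDerivAt
  have hderiv := ((((hg (x + y)).comp_const_add x y).mul
    ((hg (x - y)).comp_const_sub x y)).mul_const (f (y + 0) * f (y - 0))).sub
    ((((hf (y + 0)).comp_add_const y 0).mul ((hf (y - 0)).comp_sub_const y 0)).const_mul
      (g (x + y) * g (x - y))) |>.add
    ((((hf (y + y)).comp_add_const y y).mul ((hf (y - y)).comp_sub_const y y)).const_mul
      (g (x + 0) * g (x - 0)))
  have hconst : HasDerivAt (fun _ : 𝕜 => (0 : 𝕜)) 0 y := hasDerivAt_const y 0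
  have heq := hderiv.unique (hconst.congr_of_eventuallyEq
    (Eventually.of_forall fun t => h.three_term x t y 0))
  simp only [add_zero, sub_zero, sub_self, h.map_zero, ← two_mul] at heq
  linear_combination -heq

variable (h : IsThreeTermPair f g)
include h

lemma ratio_add_inv (hs : SolvesThetaEquations f a c φ v) (hc : c ≠ 0) (hφ : f φ ≠ 0)
    (h0 : g u ≠ 0) (h1 : g (u + φ) ≠ 0) (h1' : g (u - φ) ≠ 0) (h2 : g (u + 2 * φ) ≠ 0)
    (h2' : g (u - 2 * φ) ≠ 0) :
    ratioX g c φ u + 1 / ratioY g c φ u =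
        f (2 * φ) ^ 2 * g (u + φ) ^ 2 / (f φ ^ 2 * (c * g u * g (u + 2 * φ))) ∧
      ratioY g c φ u + 1 / ratioX g c φ u =
        f (2 * φ) ^ 2 * g (u - φ) ^ 2 / (f φ ^ 2 * (c * g u * g (u - 2 * φ))) := by
  have key : (c ^ 2 * g u ^ 2 + g (u + 2 * φ) * g (u - 2 * φ)) * f φ ^ 2
      = f (2 * φ) ^ 2 * (g (u - φ) * g (u + φ)) := by
    have hW := h.three_term u (2 * φ) φ 0
    rw [show 2 * φ + φ = 3 * φ by ring, show 2 * φ - φ = φ by ring, ← hs.sq] at hW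
    simp only [add_zero, sub_zero] at hW
    linear_combination hW
  constructor
  · rw [ratioX, ratioY, one_div_div, div_add_div _ _ (by positivity) (by positivity),
      div_eq_div_iff (by positivity) (by positivity)]
    linear_combination c * g u * g (u + φ) * g (u - φ) * g (u + 2 * φ) * key
  · rw [ratioX, ratioY, one_div_div, div_add_div _ _ (by positivity) (by positivity),
      div_eq_div_iff (by positivity) (by positivity)]
    linear_combination c * g u * g (u - φ) * g (u + φ) * g (u - 2 * φ) * key

lemma ratio_terms_eq_logDeriv (hs : SolvesThetaEquations f a c φ v) (hc : c ≠ 0)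
    (hd : deriv f 0 ≠ 0) (hφ : f φ ≠ 0) (hφ2 : f (2 * φ) ≠ 0)
    (h0 : g u ≠ 0) (h1 : g (u + φ) ≠ 0) (h1' : g (u - φ) ≠ 0) (h2 : g (u + 2 * φ) ≠ 0)
    (h2' : g (u - 2 * φ) ≠ 0) :
    ratioX g c φ u + 1 / ratioY g c φ u = f (2 * φ) / (c * deriv f 0)
        * (deriv g u / g u - deriv g (u + 2 * φ) / g (u + 2 * φ) + 2 * deriv f φ / f φ) ∧
      ratioY g c φ u + 1 / ratioX g c φ u = f (2 * φ) / (c * deriv f 0)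
        * (deriv g (u - 2 * φ) / g (u - 2 * φ) - deriv g u / g u + 2 * deriv f φ / f φ) ∧
      a * (ratioX g c φ u * ratioY g c φ u) = f (2 * φ) / (c * deriv f 0)
        * (deriv g (u + 2 * φ) / g (u + 2 * φ) - deriv g (u - 2 * φ) / g (u - 2 * φ)
          - 2 * deriv f (2 * φ) / f (2 * φ)) := by
  obtain ⟨hX, hY⟩ := h.ratio_add_inv hs hc hφ h0 h1 h1' h2 h2'
  have hXY : a * (ratioX g c φ u * ratioY g c φ u)
      = -(f (4 * φ) * g u ^ 2) / (c * f (2 * φ) * (g (u + 2 * φ) * g (u - 2 * φ))) := by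
    rw [ratioX, ratioY, div_mul_div_comm, mul_div_assoc',
      div_eq_div_iff (by positivity) (by positivity)]
    linear_combination
      g (u - φ) * g (u + φ) * g (u + 2 * φ) * g (u - 2 * φ) * g u ^ 2 * hs.cube
  have hplus := h.deriv_three_term (u + φ) φ
  have hminus := h.deriv_three_term (u - φ) φ
  have hdouble := h.deriv_three_term u (2 * φ)
  rw [add_sub_cancel_right, add_assoc, ← two_mul] at hplus
  rw [sub_add_cancel, sub_sub, ← two_mul] at hminus
  rw [show 2 * (2 * φ) = 4 * φ by ring] at hdouble
  refine ⟨?_, ?_, ?_⟩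
  · rw [hX]
    field_simp
    linear_combination -hplus
  · rw [hY]
    field_simp
    linear_combination -hminus
  · rw [hXY, div_sub_div _ _ h2 h2', div_sub_div _ _ (by positivity) hφ2, div_mul_div_comm,
      div_eq_div_iff (by positivity) (by positivity)]
    linear_combination c * f (2 * φ) * g (u + 2 * φ) * g (u - 2 * φ) * hdouble

/-- The logarithmic derivatives of `g` cancel in the sum of the terms of the step polynomial. -/
theorem step_ratio (hs : SolvesThetaEquations f a c φ v) (hc : c ≠ 0) (hd : deriv f 0 ≠ 0)
    (hφ : f φ ≠ 0) (hφ2 : f (2 * φ) ≠ 0)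
    (h0 : g u ≠ 0) (h1 : g (u + φ) ≠ 0) (h1' : g (u - φ) ≠ 0) (h2 : g (u + 2 * φ) ≠ 0)
    (h2' : g (u - 2 * φ) ≠ 0) :
    ratioX g c φ u + ratioY g c φ u + 1 / ratioX g c φ u + 1 / ratioY g c φ u
      + a * (ratioX g c φ u * ratioY g c φ u) = v := by
  obtain ⟨hX, hY, hXY⟩ := h.ratio_terms_eq_logDeriv hs hc hd hφ hφ2 h0 h1 h1' h2 h2'
  have hv : v = (4 * deriv f φ * f (2 * φ) - 2 * deriv f (2 * φ) * f φ)
      / (c * (deriv f 0 * f φ)) := by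
    rw [eq_div_iff (by positivity), ← hs.step]
    ring
  have hsum : ratioX g c φ u + ratioY g c φ u + 1 / ratioX g c φ u + 1 / ratioY g c φ u
      = ratioX g c φ u + 1 / ratioY g c φ u + (ratioY g c φ u + 1 / ratioX g c φ u) := by ring
  rw [hsum, hX, hY, hXY, hv]
  field_simp
  ring

theorem one_add_mul_ratioX [CharZero 𝕜] (hs : SolvesThetaEquations f a c φ v) (hc : c ≠ 0)
    (hφ : f φ ≠ 0) (hφ2 : f (2 * φ) ≠ 0) (h1' : g (u - φ) ≠ 0) (h2 : g (u + 2 * φ) ≠ 0) :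
    1 + a * ratioX g c φ u =
      g (u - 2 * φ) * g (u + 3 * φ) / (c ^ 2 * (g (u - φ) * g (u + 2 * φ))) := by
  have hW := h.three_term (u + φ / 2) (3 * φ / 2) (5 * φ / 2) (φ / 2)
  rw [show u + φ / 2 + 3 * φ / 2 = u + 2 * φ by ring, show u + φ / 2 - 3 * φ / 2 = u - φ by ring,
    show 5 * φ / 2 + φ / 2 = 3 * φ by ring, show 5 * φ / 2 - φ / 2 = 2 * φ by ring,
    show u + φ / 2 + 5 * φ / 2 = u + 3 * φ by ring, show u + φ / 2 - 5 * φ / 2 = u - 2 * φ by ring,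
    show 3 * φ / 2 + φ / 2 = 2 * φ by ring, show 3 * φ / 2 - φ / 2 = φ by ring,
    show u + φ / 2 + φ / 2 = u + φ by ring, show u + φ / 2 - φ / 2 = u by ring,
    show 3 * φ / 2 + 5 * φ / 2 = 4 * φ by ring, show 3 * φ / 2 - 5 * φ / 2 = -φ by ring,
    h.map_neg] at hW
  rw [ratioX, eq_div_iff (by positivity), mul_div_assoc', one_add_div (by positivity),
    div_mul_eq_mul_div, div_eq_iff (by positivity)]
  refine mul_right_cancel₀ (mul_ne_zero hφ hφ2) ?_
  linear_combination (g (u - φ) * g (u + 2 * φ)) * (hW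
    + g (u - φ) * g (u + 2 * φ) * f (2 * φ) * hs.sq + f φ * g u * g (u + φ) * hs.cube)

end IsThreeTermPair

end ThreeTerm

section ComplexTheta

open Complex

/-- The theta function with half-integer exponents,
`∑_{n ∈ ℤ} exp(2πi(n+1/2)z + πi(n+1/2)²τ)`. It is the companion of `jacobiTheta₂` in the addition
formulas, and becomes `ϑ` after a shift by `1/2`. -/
noncomputable def halfTheta (z τ : ℂ) : ℂ :=
  exp (π * I * τ / 4 + π * I * z) * jacobiTheta₂ (z + τ / 2) τ

lemma hasSum_halfTheta (z : ℂ) {τ : ℂ} (hτ : 0 < τ.im) :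
    HasSum (fun n : ℤ => exp (2 * π * I * (n + 1 / 2) * z + π * I * (n + 1 / 2) ^ 2 * τ))
      (halfTheta z τ) := by
  refine ((hasSum_jacobiTheta₂_term (z + τ / 2) hτ).mul_left
    (exp (π * I * τ / 4 + π * I * z))).congr_fun fun n => ?_
  rw [jacobiTheta₂_term, ← exp_add]
  ring_nf

lemma differentiable_halfTheta {τ : ℂ} (hτ : 0 < τ.im) :
    Differentiable ℂ (fun z => halfTheta z τ) := by
  have h : Differentiable ℂ (fun z => jacobiTheta₂ z τ) :=
    fun z => differentiableAt_jacobiTheta₂_fst z hτ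
  unfold halfTheta
  exact Differentiable.mul (by fun_prop) (h.comp (by fun_prop))

lemma halfTheta_add_one (z τ : ℂ) : halfTheta (z + 1) τ = -halfTheta z τ := by
  rw [halfTheta, halfTheta, add_right_comm z, jacobiTheta₂_add_left, mul_add_one, ← add_assoc,
    exp_add _ (π * I), exp_pi_mul_I]
  ring

lemma halfTheta_add_half_period (z τ : ℂ) :
    halfTheta (z + τ / 2) τ = exp (-(π * I * τ / 4) - π * I * z) * jacobiTheta₂ z τ := by
  rw [halfTheta, add_assoc, add_halves, jacobiTheta₂_add_left', ← mul_assoc, ← exp_add]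
  ring_nf

/-- Pairs of integers, split by the parity of their sum, in the coordinates half-sum and
half-difference. This reindexes the product of two theta series. -/
noncomputable def sumDiffEquiv : (ℤ × ℤ) ⊕ (ℤ × ℤ) ≃ ℤ × ℤ :=
  Equiv.ofBijective
    (Sum.elim (fun x => (x.1 + x.2, x.1 - x.2)) (fun x => (x.1 + x.2 + 1, x.1 - x.2))) (by
      constructor
      · rintro (⟨a, b⟩ | ⟨a, b⟩) (⟨c, d⟩ | ⟨c, d⟩) h <;>
          simp only [Sum.elim_inl, Sum.elim_inr, Prod.mk.injEq, Sum.inl.injEq, Sum.inr.injEq,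
            reduceCtorEq] at h ⊢ <;>
          omega
      · rintro ⟨m, n⟩
        rcases Int.even_or_odd' (m + n) with ⟨k, hk | hk⟩
        · refine ⟨Sum.inl (k, m - k), ?_⟩
          simp only [Sum.elim_inl, Prod.mk.injEq]
          omega
        · refine ⟨Sum.inr (k, m - k - 1), ?_⟩
          simp only [Sum.elim_inr, Prod.mk.injEq]
          omega)

lemma sumDiffEquiv_inl (n : ℤ × ℤ) : sumDiffEquiv (Sum.inl n) = (n.1 + n.2, n.1 - n.2) := rfl

lemma sumDiffEquiv_inr (n : ℤ × ℤ) :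
    sumDiffEquiv (Sum.inr n) = (n.1 + n.2 + 1, n.1 - n.2) := rfl

theorem jacobiTheta₂_add_mul_sub (x y : ℂ) {τ : ℂ} (hτ : 0 < τ.im) :
    jacobiTheta₂ (x + y) τ * jacobiTheta₂ (x - y) τ =
      jacobiTheta₂ (2 * x) (2 * τ) * jacobiTheta₂ (2 * y) (2 * τ)
        + halfTheta (2 * x) (2 * τ) * halfTheta (2 * y) (2 * τ) := by
  have hτ2 : 0 < (2 * τ).im := by simpa using hτ
  have hasSum_prod {f g : ℤ → ℂ} {a b : ℂ} (hf : HasSum f a) (hg : HasSum g b) :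
      HasSum (fun n : ℤ × ℤ => f n.1 * g n.2) (a * b) :=
    hf.mul hg (summable_mul_of_summable_norm hf.summable.norm hg.summable.norm)
  have hleft := hasSum_prod (hasSum_jacobiTheta₂_term (x + y) hτ)
    (hasSum_jacobiTheta₂_term (x - y) hτ)
  rw [← sumDiffEquiv.hasSum_iff] at hleft
  refine hleft.unique (HasSum.sum ?_ ?_)
  · refine (hasSum_prod (hasSum_jacobiTheta₂_term (2 * x) hτ2)
      (hasSum_jacobiTheta₂_term (2 * y) hτ2)).congr_fun fun n => ?_
    simp only [Function.comp_apply, sumDiffEquiv_inl, jacobiTheta₂_term, ← exp_add]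
    push_cast
    ring_nf
  · refine (hasSum_prod (hasSum_halfTheta (2 * x) hτ2)
      (hasSum_halfTheta (2 * y) hτ2)).congr_fun fun n => ?_
    simp only [Function.comp_apply, sumDiffEquiv_inr, jacobiTheta₂_term, ← exp_add]
    push_cast
    ring_nf

theorem halfTheta_add_mul_sub (x y : ℂ) {τ : ℂ} (hτ : 0 < τ.im) :
    halfTheta (x + y) τ * halfTheta (x - y) τ =
      halfTheta (2 * x) (2 * τ) * jacobiTheta₂ (2 * y) (2 * τ)
        + jacobiTheta₂ (2 * x) (2 * τ) * halfTheta (2 * y) (2 * τ) := by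
  have h := jacobiTheta₂_add_mul_sub (x + τ / 2) y hτ
  rw [add_right_comm x, add_sub_right_comm x, mul_add, mul_div_assoc',
    halfTheta_add_half_period] at h
  have hprod : exp (π * I * τ / 4 + π * I * (x + y)) * exp (π * I * τ / 4 + π * I * (x - y))
      = exp (π * I * (2 * τ) / 4 + π * I * (2 * x)) := by
    rw [← exp_add]
    ring_nf
  have hcancel : exp (π * I * (2 * τ) / 4 + π * I * (2 * x)) *
      exp (-(π * I * (2 * τ) / 4) - π * I * (2 * x)) = 1 := by
    rw [← neg_add', ← exp_add, add_neg_cancel, exp_zero]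
  rw [halfTheta, halfTheta, halfTheta]
  linear_combination exp (π * I * (2 * τ) / 4 + π * I * (2 * x)) * h
    + (jacobiTheta₂ (x + y + τ / 2) τ * jacobiTheta₂ (x - y + τ / 2) τ) * hprod
    + jacobiTheta₂ (2 * x) (2 * τ) * halfTheta (2 * y) (2 * τ) * hcancel

lemma halfTheta_term (z τ : ℂ) (n : ℤ) :
    exp (2 * π * I * (n + 1 / 2) * (z / π + 1 / 2) + π * I * (n + 1 / 2) ^ 2 * τ) =
      I * ((-1) ^ n * exp (I * π * τ * (n + 1 / 2) ^ 2) * exp ((2 * n + 1) * I * z)) := by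
  have hsign : (-1 : ℂ) ^ n = exp (n * (π * I)) := by rw [exp_int_mul, exp_pi_mul_I]
  conv_rhs => arg 1; rw [← exp_pi_div_two_mul_I]
  rw [hsign, ← exp_add, ← exp_add, ← exp_add]
  congr 1
  have : (π : ℂ) ≠ 0 := ofReal_ne_zero.2 Real.pi_ne_zero
  field_simp
  ring

theorem jacobiTh_eq_halfTheta (z : ℂ) {τ : ℂ} (hτ : 0 < τ.im) :
    jacobiTh z τ = -I * halfTheta (z / π + 1 / 2) τ := by
  have h := ((hasSum_halfTheta (z / π + 1 / 2) hτ).mul_left (-I)).nat_add_neg_add_one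
  rw [jacobiTh, ← h.tsum_eq]
  refine tsum_congr fun n => ?_
  have hsign : (-1 : ℂ) ^ (-((n : ℤ) + 1)) = -(-1) ^ n := by
    rw [zpow_neg, ← inv_zpow, inv_neg_one, zpow_add_one₀ (by norm_num), zpow_natCast, mul_neg_one]
  rw [halfTheta_term, halfTheta_term, hsign, zpow_natCast, neg_mul, neg_mul, ← mul_assoc,
    ← mul_assoc I, I_mul_I]
  push_cast
  ring_nf

lemma jacobiTh_neg (z τ : ℂ) : jacobiTh (-z) τ = -jacobiTh z τ := by
  rw [jacobiTh, jacobiTh, ← tsum_neg]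
  refine tsum_congr fun n => ?_
  rw [mul_neg, neg_neg]
  ring

lemma jacobiTh_eq_jacobiTheta₂ (z : ℂ) {τ : ℂ} (hτ : 0 < τ.im) :
    jacobiTh z τ = exp (π * I * τ / 4 + I * z) * jacobiTheta₂ (z / π + 1 / 2 + τ / 2) τ := by
  have hπ : (π : ℂ) ≠ 0 := ofReal_ne_zero.2 Real.pi_ne_zero
  have hexp : π * I * τ / 4 + π * I * (z / π + 1 / 2) = π * I * τ / 4 + I * z + π / 2 * I := by
    field_simp
    ring
  rw [jacobiTh_eq_halfTheta z hτ, halfTheta, hexp, exp_add _ (π / 2 * I), exp_pi_div_two_mul_I]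
  linear_combination -(exp (π * I * τ / 4 + I * z) *
      jacobiTheta₂ (z / π + 1 / 2 + τ / 2) τ) * I_sq

lemma differentiable_jacobiTh {τ : ℂ} (hτ : 0 < τ.im) :
    Differentiable ℂ (fun z => jacobiTh z τ) := by
  simp only [jacobiTh_eq_halfTheta _ hτ]
  exact ((differentiable_halfTheta hτ).comp (by fun_prop)).const_mul _

theorem isThreeTermPair_jacobiTh {τ : ℂ} (hτ : 0 < τ.im) :
    IsThreeTermPair (fun z => jacobiTh z τ) (fun z => jacobiTh z τ) where
  map_zero := by simp [jacobiTh]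
  map_neg z := jacobiTh_neg z τ
  differentiable_left := differentiable_jacobiTh hτ
  differentiable_right := differentiable_jacobiTh hτ
  three_term x y z w := by
    have h x y : jacobiTh (x + y) τ * jacobiTh (x - y) τ =
        halfTheta (2 * (x / π)) (2 * τ) * jacobiTheta₂ (2 * (y / π)) (2 * τ)
        - jacobiTheta₂ (2 * (x / π)) (2 * τ) * halfTheta (2 * (y / π)) (2 * τ) := by
      have h := halfTheta_add_mul_sub (x / π + 1 / 2) (y / π) hτ
      rw [add_right_comm, add_sub_right_comm, ← add_div, ← sub_div, mul_add,
        mul_one_div_cancel two_ne_zero, halfTheta_add_one, jacobiTheta₂_add_left] at h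
      rw [jacobiTh_eq_halfTheta _ hτ, jacobiTh_eq_halfTheta _ hτ]
      linear_combination halfTheta ((x + y) / π + 1 / 2) τ *
        halfTheta ((x - y) / π + 1 / 2) τ * I_sq - h
    simp only [h]
    ring

lemma ne_zero_of_im_pos {τ : ℂ} (hτ : 0 < τ.im) : τ ≠ 0 := by
  rintro rfl
  exact lt_irrefl _ hτ

lemma im_neg_one_div_pos {τ : ℂ} (hτ : 0 < τ.im) : 0 < (-1 / τ).im := by
  rw [neg_div, neg_im, one_div, inv_im, neg_div, neg_neg]
  exact div_pos hτ (normSq_pos.2 (ne_zero_of_im_pos hτ))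

theorem jacobiTh_functional_equation (z : ℂ) {τ : ℂ} (hτ : 0 < τ.im) :
    jacobiTh z τ = I / (-I * τ) ^ (1 / 2 : ℂ) * exp (-(I * z ^ 2 / (π * τ)))
      * jacobiTh (z / τ) (-1 / τ) := by
  have hπ : (π : ℂ) ≠ 0 := ofReal_ne_zero.2 Real.pi_ne_zero
  have hτ0 := ne_zero_of_im_pos hτ
  have hshift := jacobiTheta₂_add_left' ((z / π + 1 / 2 + τ / 2) / τ) (-1 / τ)
  rw [show (z / π + 1 / 2 + τ / 2) / τ + -1 / τ = z / τ / π + 1 / 2 + -1 / τ / 2 by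
    field_simp
    ring] at hshift
  have hexp : exp (π * I * τ / 4 + I * z) * exp (-π * I * (z / π + 1 / 2 + τ / 2) ^ 2 / τ)
      = exp (π / 2 * I) * exp (-(I * z ^ 2 / (π * τ))) *
        exp (π * I * (-1 / τ) / 4 + I * (z / τ)) *
        exp (-π * I * (-1 / τ + 2 * ((z / π + 1 / 2 + τ / 2) / τ))) := by
    simp only [← exp_add]
    congr 1
    field_simp
    ring
  rw [exp_pi_div_two_mul_I] at hexp
  rw [jacobiTh_eq_jacobiTheta₂ z hτ, jacobiTh_eq_jacobiTheta₂ _ (im_neg_one_div_pos hτ),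
    jacobiTheta₂_functional_equation, hshift]
  linear_combination (1 / (-I * τ) ^ (1 / 2 : ℂ)) *
    jacobiTheta₂ ((z / π + 1 / 2 + τ / 2) / τ) (-1 / τ) * hexp

lemma eq_div_mul_of_wronskian_eq_zero {A B : ℂ → ℂ} (hA : Differentiable ℂ A)
    (hB : Differentiable ℂ B) (hwr : ∀ x, A x * deriv B x = deriv A x * B x) {x₀ : ℂ}
    (hx₀ : B x₀ ≠ 0) (x : ℂ) : A x = A x₀ / B x₀ * B x := by
  obtain ⟨r, hr, hball⟩ := Metric.eventually_nhds_iff_ball.1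
    ((hB x₀).continuousAt.eventually_ne hx₀)
  have hconst : ∀ y ∈ Metric.ball x₀ r, A y / B y = A x₀ / B x₀ := by
    intro y hy
    refine Metric.isOpen_ball.is_const_of_deriv_eq_zero (f := A / B)
      (convex_ball x₀ r).isPreconnected
      (fun z hz => ((hA z).div (hB z) (hball z hz)).differentiableWithinAt)
      (fun z hz => ?_) hy (Metric.mem_ball_self hr)
    rw [deriv_div (hA z) (hB z) (hball z hz), ← hwr z, sub_self, zero_div, Pi.zero_apply]
  have heq : A = fun x => A x₀ / B x₀ * B x := by
    refine AnalyticOnNhd.eq_of_eventuallyEq (𝕜 := ℂ) (z₀ := x₀)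
      (fun x _ => hA.analyticAt x) (fun x _ => (hB.const_mul _).analyticAt x) ?_
    filter_upwards [Metric.ball_mem_nhds x₀ hr] with y hy
    rw [← hconst y hy, div_mul_cancel₀ _ (hball y hy)]
  exact congrFun heq x

/-- If `f' 0 = 0`, the differentiated three-term relation says that the Wronskian of
`f (m + v) f (m - v)` and `f v ^ 2` in the variable `v` vanishes, so that these are proportional;
comparing at `v = m` and at `v = 0` gives `f m = 0`. -/
theorem IsThreeTermPair.deriv_zero_ne_zero {f : ℂ → ℂ} (h : IsThreeTermPair f f) {m : ℂ}
    (hm : f m ≠ 0) : deriv f 0 ≠ 0 := by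
  intro h0
  have hf z : HasDerivAt f (deriv f z) z := (h.differentiable_left z).hasDerivAt
  have hF v : HasDerivAt (fun v => f (m + v) * f (m - v))
      (deriv f (m + v) * f (m - v) + f (m + v) * -deriv f (m - v)) v :=
    ((hf (m + v)).comp_const_add m v).mul ((hf (m - v)).comp_const_sub m v)
  have hG v : HasDerivAt (fun v => f v ^ 2) (2 * f v * deriv f v) v := by
    simpa using (hf v).fun_pow 2
  have hprop := eq_div_mul_of_wronskian_eq_zero (fun v => (hF v).differentiableAt)
    (fun v => (hG v).differentiableAt) (fun v => by
      rw [(hF v).deriv, (hG v).deriv]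
      have := h.deriv_three_term m v
      rw [h0] at this
      linear_combination this) (pow_ne_zero 2 hm) 0
  rw [add_zero, sub_zero, sub_self, h.map_zero] at hprop
  exact hm (by simpa using hprop)

end ComplexTheta

section RealTheta

open Real

/-- The theta function `ϑ₁` of a real nome `p`, without its prefactor `p ^ (1/4)`:
`2 ∑ (-1)ⁿ p^{n(n+1)} sin((2n+1)x)`. -/
noncomputable def theta₁ (p x : ℝ) : ℝ :=
  ∑' n : ℕ, 2 * ((-1) ^ n * p ^ (n * (n + 1)) * sin ((2 * n + 1) * x))

/-- The theta function `ϑ₂` of a real nome, without its prefactor: `ϑ₁` translated by `π/2`. -/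
noncomputable def theta₂ (p x : ℝ) : ℝ := theta₁ p (x + π / 2)

/-- The theta function `ϑ₃` of a real nome `p`: `1 + 2 ∑ p^{n²} cos(2nx)`. -/
noncomputable def theta₃ (p x : ℝ) : ℝ :=
  1 + ∑' n : ℕ, 2 * (p ^ ((n + 1) ^ 2) * cos (2 * (n + 1) * x))

/-- The theta function `ϑ₄` of a real nome: `ϑ₃` translated by `π/2`. -/
noncomputable def theta₄ (p x : ℝ) : ℝ := theta₃ p (x + π / 2)

lemma norm_theta₁_term_le {p r : ℝ} (hp : 0 ≤ p) (hpr : p ≤ r) (hr : r < 1) (x : ℝ) (n : ℕ) :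
    ‖2 * ((-1) ^ n * p ^ (n * (n + 1)) * sin ((2 * n + 1) * x))‖ ≤ 2 * r ^ n := by
  have hpow : p ^ (n * (n + 1)) ≤ r ^ n :=
    (pow_le_pow_of_le_one hp (hpr.trans hr.le) (Nat.le_mul_of_pos_right n n.succ_pos)).trans
      (pow_le_pow_left₀ hp hpr n)
  rw [norm_mul, norm_mul, norm_mul, norm_pow, norm_pow, norm_neg, norm_one, one_pow, one_mul,
    norm_of_nonneg hp, norm_of_nonneg zero_le_two]
  exact mul_le_mul_of_nonneg_left
    ((mul_le_of_le_one_right (by positivity) (abs_sin_le_one _)).trans hpow) zero_le_two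

lemma norm_theta₃_term_le {p r : ℝ} (hp : 0 ≤ p) (hpr : p ≤ r) (hr : r < 1) (x : ℝ) (n : ℕ) :
    ‖2 * (p ^ ((n + 1) ^ 2) * cos (2 * (n + 1) * x))‖ ≤ 2 * r ^ n := by
  have hpow : p ^ ((n + 1) ^ 2) ≤ r ^ n :=
    (pow_le_pow_of_le_one hp (hpr.trans hr.le) (by nlinarith)).trans (pow_le_pow_left₀ hp hpr n)
  rw [norm_mul, norm_mul, norm_pow, norm_of_nonneg hp, norm_of_nonneg zero_le_two]
  exact mul_le_mul_of_nonneg_left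
    ((mul_le_of_le_one_right (by positivity) (abs_cos_le_one _)).trans hpow) zero_le_two

lemma summable_two_mul_geometric {r : ℝ} (h0 : 0 ≤ r) (h1 : r < 1) :
    Summable fun n : ℕ => 2 * r ^ n :=
  (summable_geometric_of_lt_one h0 h1).mul_left 2

lemma hasSum_theta₁ {p : ℝ} (hp : p ∈ Ico (0 : ℝ) 1) (x : ℝ) :
    HasSum (fun n : ℕ => 2 * ((-1) ^ n * p ^ (n * (n + 1)) * sin ((2 * n + 1) * x)))
      (theta₁ p x) :=
  (Summable.of_norm_bounded (summable_two_mul_geometric hp.1 hp.2)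
    (norm_theta₁_term_le hp.1 le_rfl hp.2 x)).hasSum

lemma hasSum_theta₃ {p : ℝ} (hp : p ∈ Ico (0 : ℝ) 1) (x : ℝ) :
    HasSum (fun n : ℕ => 2 * (p ^ ((n + 1) ^ 2) * cos (2 * (n + 1) * x))) (theta₃ p x - 1) := by
  rw [theta₃, add_sub_cancel_left]
  exact (Summable.of_norm_bounded (summable_two_mul_geometric hp.1 hp.2)
    (norm_theta₃_term_le hp.1 le_rfl hp.2 x)).hasSum

lemma continuousOn_Ico_prod_univ {f : ℝ × ℝ → ℝ}
    (h : ∀ r : ℝ, 0 < r → r < 1 → ContinuousOn f (Icc 0 r ×ˢ univ)) :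
    ContinuousOn f (Ico 0 1 ×ˢ univ) := by
  rintro ⟨p, x⟩ ⟨⟨hp0, hp1⟩, -⟩
  obtain ⟨r, hpr, hr1⟩ := exists_between hp1
  refine (h r (hp0.trans_lt hpr) hr1 (p, x) ⟨⟨hp0, hpr.le⟩, mem_univ _⟩).mono_of_mem_nhdsWithin ?_
  have : Iio r ×ˢ (univ : Set ℝ) ∈ 𝓝 (p, x) :=
    (isOpen_Iio.prod isOpen_univ).mem_nhds ⟨hpr, mem_univ _⟩
  filter_upwards [mem_nhdsWithin_of_mem_nhds this, self_mem_nhdsWithin] with y hy hy'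
  exact ⟨⟨hy'.1.1, (mem_Iio.1 hy.1).le⟩, mem_univ _⟩

lemma continuousOn_theta₁ : ContinuousOn (fun y : ℝ × ℝ => theta₁ y.1 y.2) (Ico 0 1 ×ˢ univ) :=
  continuousOn_Ico_prod_univ fun _ hr0 hr1 =>
    continuousOn_tsum (fun _ => Continuous.continuousOn (by fun_prop))
      (summable_two_mul_geometric hr0.le hr1)
      (fun n y hy => norm_theta₁_term_le hy.1.1 hy.1.2 hr1 y.2 n)

lemma continuousOn_theta₃ : ContinuousOn (fun y : ℝ × ℝ => theta₃ y.1 y.2) (Ico 0 1 ×ˢ univ) :=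
  continuousOn_Ico_prod_univ fun _ hr0 hr1 => continuousOn_const.add
    (continuousOn_tsum (fun _ => Continuous.continuousOn (by fun_prop))
      (summable_two_mul_geometric hr0.le hr1)
      (fun n y hy => norm_theta₃_term_le hy.1.1 hy.1.2 hr1 y.2 n))

lemma continuous_theta₁ {p : ℝ} (hp : p ∈ Ico (0 : ℝ) 1) : Continuous (theta₁ p) :=
  continuousOn_univ.1 (continuousOn_theta₁.comp (f := fun x : ℝ => (p, x)) (s := univ)
    (by fun_prop) fun _ _ => ⟨hp, mem_univ _⟩)

lemma continuous_theta₃ {p : ℝ} (hp : p ∈ Ico (0 : ℝ) 1) : Continuous (theta₃ p) :=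
  continuousOn_univ.1 (continuousOn_theta₃.comp (f := fun x : ℝ => (p, x)) (s := univ)
    (by fun_prop) fun _ _ => ⟨hp, mem_univ _⟩)

lemma theta₁_zero (p : ℝ) : theta₁ p 0 = 0 := by simp [theta₁]

lemma theta₁_neg (p x : ℝ) : theta₁ p (-x) = -theta₁ p x := by
  rw [theta₁, theta₁, ← tsum_neg]
  refine tsum_congr fun n => ?_
  rw [mul_neg, sin_neg]
  ring

lemma theta₁_add_pi (p x : ℝ) : theta₁ p (x + π) = -theta₁ p x := by
  rw [theta₁, theta₁, ← tsum_neg]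
  refine tsum_congr fun n => ?_
  rw [show (2 * (n : ℝ) + 1) * (x + π) = ((2 * n + 1) * x + π) + n * (2 * π) by ring,
    sin_add_nat_mul_two_pi, sin_add_pi]
  ring

lemma theta₁_pi_sub (p x : ℝ) : theta₁ p (π - x) = theta₁ p x := by
  rw [sub_eq_neg_add, theta₁_add_pi, theta₁_neg, neg_neg]

lemma theta₁_pi (p : ℝ) : theta₁ p π = 0 := by
  rw [← zero_add π, theta₁_add_pi, theta₁_zero, neg_zero]

lemma theta₁_sub_pi (p x : ℝ) : theta₁ p (x - π) = -theta₁ p x := by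
  rw [← neg_eq_iff_eq_neg, ← theta₁_add_pi, sub_add_cancel]

lemma theta₃_neg (p x : ℝ) : theta₃ p (-x) = theta₃ p x := by
  simp only [theta₃, mul_neg, cos_neg]

lemma theta₃_add_pi (p x : ℝ) : theta₃ p (x + π) = theta₃ p x := by
  rw [theta₃, theta₃]
  refine congrArg (1 + ·) (tsum_congr fun n => ?_)
  rw [show 2 * ((n : ℝ) + 1) * (x + π) = 2 * (n + 1) * x + (n + 1 : ℕ) * (2 * π) by
    push_cast
    ring, cos_add_nat_mul_two_pi]

lemma theta₂_neg (p x : ℝ) : theta₂ p (-x) = theta₂ p x := by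
  rw [theta₂, theta₂, ← theta₁_pi_sub]
  ring_nf

lemma theta₂_add_pi (p x : ℝ) : theta₂ p (x + π) = -theta₂ p x := by
  rw [theta₂, theta₂, add_right_comm, theta₁_add_pi]

lemma theta₂_add_pi_div_two (p x : ℝ) : theta₂ p (x + π / 2) = -theta₁ p x := by
  rw [theta₂, add_assoc, add_halves, theta₁_add_pi]

lemma theta₂_pi_div_two (p : ℝ) : theta₂ p (π / 2) = 0 := by
  rw [← zero_add (π / 2), theta₂_add_pi_div_two, theta₁_zero, neg_zero]

lemma theta₄_neg (p x : ℝ) : theta₄ p (-x) = theta₄ p x := by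
  rw [theta₄, theta₄, ← theta₃_neg, ← theta₃_add_pi]
  ring_nf

lemma theta₄_add_pi (p x : ℝ) : theta₄ p (x + π) = theta₄ p x := by
  rw [theta₄, theta₄, add_right_comm, theta₃_add_pi]

lemma theta₁_nome_zero (x : ℝ) : theta₁ 0 x = 2 * sin x := by
  rw [theta₁, tsum_eq_single 0]
  · simp
  · intro n hn
    have : n * (n + 1) ≠ 0 := by positivity
    simp [this]

lemma theta₂_nome_zero (x : ℝ) : theta₂ 0 x = 2 * cos x := by
  rw [theta₂, theta₁_nome_zero, sin_add_pi_div_two]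

lemma theta₃_nome_zero (x : ℝ) : theta₃ 0 x = 1 := by simp [theta₃]

lemma theta₄_nome_zero (x : ℝ) : theta₄ 0 x = 1 := theta₃_nome_zero _

open Complex (I ofReal_injective)

lemma exp_neg_pi_mul_mem {σ : ℝ} (hσ : 0 < σ) : exp (-(π * σ)) ∈ Ioo (0 : ℝ) 1 :=
  ⟨exp_pos _, exp_lt_one_iff.2 (neg_lt_zero.2 (mul_pos pi_pos hσ))⟩

lemma exists_eq_exp_neg_pi_mul {p : ℝ} (hp : p ∈ Ioo (0 : ℝ) 1) :
    ∃ σ : ℝ, 0 < σ ∧ exp (-(π * σ)) = p := by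
  refine ⟨-log p / π, div_pos (neg_pos.2 (log_neg hp.1 hp.2)) pi_pos, ?_⟩
  rw [mul_div_cancel₀ _ pi_ne_zero, neg_neg, exp_log hp.1]

lemma jacobiTh_ofReal (σ x : ℝ) :
    jacobiTh x (I * σ) = I * exp (-(π * σ / 4)) * theta₁ (exp (-(π * σ))) x := by
  rw [jacobiTh, theta₁, Complex.ofReal_tsum, ← tsum_mul_left]
  refine tsum_congr fun n => ?_
  have hnome : Complex.exp (I * π * (I * σ) * (n + 1 / 2) ^ 2) =
      exp (-(π * σ / 4)) * exp (-(π * σ)) ^ (n * (n + 1)) := by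
    rw [← Complex.ofReal_pow, ← Complex.ofReal_mul, ← exp_nat_mul, ← exp_add, Complex.ofReal_exp]
    congr 1
    push_cast
    linear_combination (π * σ * ((n : ℂ) + 1 / 2) ^ 2) * Complex.I_sq
  have hsin : Complex.exp ((2 * n + 1) * I * x) - Complex.exp (-((2 * n + 1) * I * x))
      = 2 * I * sin ((2 * n + 1) * x) := by
    rw [Complex.ofReal_sin, mul_right_comm, ← neg_mul, Complex.sin]
    push_cast
    linear_combination (Complex.exp ((2 * n + 1) * x * I) -
      Complex.exp (-((2 * n + 1) * x) * I)) * Complex.I_sq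
  rw [hnome, hsin]
  push_cast
  ring

lemma jacobiTheta₂_ofReal {σ : ℝ} (hσ : 0 < σ) (x : ℝ) :
    jacobiTheta₂ (x / π) (I * σ) = theta₃ (exp (-(π * σ))) x := by
  have hτ : 0 < (I * (σ : ℂ)).im := by simpa using hσ
  have hx : (π : ℂ) * (x / π) = x := mul_div_cancel₀ _ (Complex.ofReal_ne_zero.2 pi_ne_zero)
  have hleft := (hasSum_jacobiTheta₂_term ((x : ℂ) / π) hτ).nat_add_neg
  rw [← hasSum_nat_add_iff' 1] at hleft
  have hright := Complex.hasSum_ofReal.2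
    (hasSum_theta₃ (Ioo_subset_Ico_self (exp_neg_pi_mul_mem hσ)) x)
  have hsum := hright.unique (hleft.congr_fun fun n => ?_)
  · have hzero : jacobiTheta₂_term 0 (x / π) (I * σ) = 1 := by simp [jacobiTheta₂_term]
    simp only [Finset.sum_range_one, Nat.cast_zero, neg_zero, hzero,
      Complex.ofReal_sub, Complex.ofReal_one] at hsum
    linear_combination -hsum
  · have hterm (ε : ℂ) (hε : ε ^ 2 = 1) :
        2 * π * I * (ε * (n + 1)) * (x / π) + π * I * (ε * (n + 1)) ^ 2 * (I * σ)
          = (n + 1) ^ 2 * -(π * σ) + ε * (2 * (n + 1) * x) * I := by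
      linear_combination (σ * ((n : ℂ) + 1) ^ 2 * π * ε ^ 2) * Complex.I_sq
        - (n + 1) ^ 2 * π * σ * hε + 2 * I * ε * (n + 1) * hx
    have hpos := hterm 1 (one_pow 2)
    have hneg := hterm (-1) neg_one_sq
    simp only [one_mul, neg_one_mul] at hpos hneg
    simp only [jacobiTheta₂_term]
    rw [← exp_nat_mul]
    push_cast
    rw [hpos, hneg, Complex.exp_add, Complex.exp_add, Complex.cos]
    ring

lemma halfTheta_ofReal {σ : ℝ} (hσ : 0 < σ) (x : ℝ) :
    halfTheta (x / π) (I * σ) = exp (-(π * σ / 4)) * theta₂ (exp (-(π * σ))) x := by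
  have hτ : 0 < (I * (σ : ℂ)).im := by simpa using hσ
  have hπ : (π : ℂ) ≠ 0 := Complex.ofReal_ne_zero.2 pi_ne_zero
  have h := jacobiTh_eq_halfTheta ((x - π / 2 : ℝ) : ℂ) hτ
  have hz : ((x - π / 2 : ℝ) : ℂ) / π + 1 / 2 = x / π := by
    push_cast
    field_simp
    ring
  rw [jacobiTh_ofReal, hz, show x - π / 2 = x + π / 2 - π by ring, theta₁_sub_pi, ← theta₂] at h
  refine mul_left_cancel₀ (neg_ne_zero.2 Complex.I_ne_zero) ?_
  rw [← h]
  push_cast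
  ring

lemma exp_neg_pi_mul_sq (σ : ℝ) : exp (-(π * σ)) ^ 2 = exp (-(π * (2 * σ))) := by
  rw [← exp_nat_mul]
  push_cast
  ring_nf

lemma jacobiTheta₂_two_mul_ofReal {σ : ℝ} (hσ : 0 < σ) (x : ℝ) :
    jacobiTheta₂ (2 * (x / π)) (2 * (I * σ)) = theta₃ (exp (-(π * σ)) ^ 2) (2 * x) := by
  rw [exp_neg_pi_mul_sq, ← jacobiTheta₂_ofReal (mul_pos two_pos hσ)]
  push_cast
  ring_nf

lemma halfTheta_two_mul_ofReal {σ : ℝ} (hσ : 0 < σ) (x : ℝ) :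
    halfTheta (2 * (x / π)) (2 * (I * σ)) =
      exp (-(π * σ / 4)) ^ 2 * theta₂ (exp (-(π * σ)) ^ 2) (2 * x) := by
  have hsq : exp (-(π * σ / 4)) ^ 2 = exp (-(π * (2 * σ) / 4)) := by
    rw [← exp_nat_mul]
    push_cast
    ring_nf
  rw [exp_neg_pi_mul_sq, ← Complex.ofReal_pow, hsq, ← halfTheta_ofReal (mul_pos two_pos hσ)]
  push_cast
  ring_nf

variable {p : ℝ} (hp : p ∈ Ico (0 : ℝ) 1)
include hp

lemma sq_mem_Ico : p ^ 2 ∈ Ico (0 : ℝ) 1 :=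
  ⟨sq_nonneg p, pow_lt_one₀ hp.1 hp.2 two_ne_zero⟩

theorem theta₂_add_mul_sub (x y : ℝ) :
    theta₂ p (x + y) * theta₂ p (x - y) =
      theta₂ (p ^ 2) (2 * x) * theta₃ (p ^ 2) (2 * y)
        + theta₃ (p ^ 2) (2 * x) * theta₂ (p ^ 2) (2 * y) := by
  rcases hp.1.eq_or_lt with rfl | hp0
  · rw [zero_pow two_ne_zero]
    simp only [theta₂_nome_zero, theta₃_nome_zero]
    rw [cos_add, cos_sub, cos_two_mul, cos_two_mul]
    linear_combination -4 * sin y ^ 2 * sin_sq_add_cos_sq x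
      - 4 * (1 - cos x ^ 2) * sin_sq_add_cos_sq y
  obtain ⟨σ, hσ, rfl⟩ := exists_eq_exp_neg_pi_mul ⟨hp0, hp.2⟩
  have h := halfTheta_add_mul_sub ((x : ℂ) / π) (y / π) (τ := I * σ) (by simpa using hσ)
  rw [← add_div, ← sub_div, ← Complex.ofReal_add, ← Complex.ofReal_sub, halfTheta_ofReal hσ,
    halfTheta_ofReal hσ, halfTheta_two_mul_ofReal hσ, halfTheta_two_mul_ofReal hσ,
    jacobiTheta₂_two_mul_ofReal hσ, jacobiTheta₂_two_mul_ofReal hσ] at h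
  norm_cast at h
  refine mul_left_cancel₀ (pow_ne_zero 2 (exp_ne_zero (-(π * σ / 4)))) ?_
  linear_combination h

theorem theta₃_add_mul_sub (x y : ℝ) :
    theta₃ p (x + y) * theta₃ p (x - y) =
      theta₃ (p ^ 2) (2 * x) * theta₃ (p ^ 2) (2 * y)
        + p * (theta₂ (p ^ 2) (2 * x) * theta₂ (p ^ 2) (2 * y)) := by
  rcases hp.1.eq_or_lt with rfl | hp0
  · rw [zero_pow two_ne_zero]
    simp only [theta₃_nome_zero]
    ring
  obtain ⟨σ, hσ, rfl⟩ := exists_eq_exp_neg_pi_mul ⟨hp0, hp.2⟩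
  have h := jacobiTheta₂_add_mul_sub ((x : ℂ) / π) (y / π) (τ := I * σ) (by simpa using hσ)
  rw [← add_div, ← sub_div, ← Complex.ofReal_add, ← Complex.ofReal_sub, jacobiTheta₂_ofReal hσ,
    jacobiTheta₂_ofReal hσ, halfTheta_two_mul_ofReal hσ, halfTheta_two_mul_ofReal hσ,
    jacobiTheta₂_two_mul_ofReal hσ, jacobiTheta₂_two_mul_ofReal hσ] at h
  norm_cast at h
  have hpow : exp (-(π * σ / 4)) ^ 4 = exp (-(π * σ)) := by
    rw [← exp_nat_mul]
    push_cast
    ring_nf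
  rw [h, ← hpow]
  ring

theorem theta₁_add_mul_sub (x y : ℝ) :
    theta₁ p (x + y) * theta₁ p (x - y) =
      theta₃ (p ^ 2) (2 * x) * theta₂ (p ^ 2) (2 * y)
        - theta₂ (p ^ 2) (2 * x) * theta₃ (p ^ 2) (2 * y) := by
  have h := theta₂_add_mul_sub hp (x + π / 2) y
  rw [add_right_comm, add_sub_right_comm, mul_add, mul_div_cancel₀ _ two_ne_zero,
    theta₂_add_pi_div_two, theta₂_add_pi_div_two, theta₂_add_pi, theta₃_add_pi] at h
  linear_combination h

theorem theta₄_add_mul_sub (x y : ℝ) :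
    theta₄ p (x + y) * theta₄ p (x - y) =
      theta₃ (p ^ 2) (2 * x) * theta₃ (p ^ 2) (2 * y)
        - p * (theta₂ (p ^ 2) (2 * x) * theta₂ (p ^ 2) (2 * y)) := by
  have h := theta₃_add_mul_sub hp (x + π / 2) y
  rw [add_right_comm, add_sub_right_comm, mul_add, mul_div_cancel₀ _ two_ne_zero,
    ← theta₄, ← theta₄, theta₂_add_pi, theta₃_add_pi] at h
  linear_combination h

lemma theta₁_sq (x : ℝ) : theta₁ p x ^ 2 =
    theta₃ (p ^ 2) (2 * x) * theta₂ (p ^ 2) 0 - theta₂ (p ^ 2) (2 * x) * theta₃ (p ^ 2) 0 := by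
  simpa only [add_zero, sub_zero, mul_zero, ← sq] using theta₁_add_mul_sub hp x 0

lemma theta₂_sq (x : ℝ) : theta₂ p x ^ 2 =
    theta₂ (p ^ 2) (2 * x) * theta₃ (p ^ 2) 0 + theta₃ (p ^ 2) (2 * x) * theta₂ (p ^ 2) 0 := by
  simpa only [add_zero, sub_zero, mul_zero, ← sq] using theta₂_add_mul_sub hp x 0

lemma theta₃_sq (x : ℝ) : theta₃ p x ^ 2 = theta₃ (p ^ 2) (2 * x) * theta₃ (p ^ 2) 0
    + p * (theta₂ (p ^ 2) (2 * x) * theta₂ (p ^ 2) 0) := by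
  simpa only [add_zero, sub_zero, mul_zero, ← sq] using theta₃_add_mul_sub hp x 0

lemma theta₄_sq (x : ℝ) : theta₄ p x ^ 2 = theta₃ (p ^ 2) (2 * x) * theta₃ (p ^ 2) 0
    - p * (theta₂ (p ^ 2) (2 * x) * theta₂ (p ^ 2) 0) := by
  simpa only [add_zero, sub_zero, mul_zero, ← sq] using theta₄_add_mul_sub hp x 0

theorem theta₁_mul_theta₂ (x : ℝ) :
    theta₁ p x * theta₂ p x = theta₁ (p ^ 2) (2 * x) * theta₄ (p ^ 2) 0 := by
  have h := theta₁_add_mul_sub hp (x + π / 4) (-(π / 4))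
  rw [show x + π / 4 + -(π / 4) = x by ring, show x + π / 4 - -(π / 4) = x + π / 2 by ring,
    show 2 * (x + π / 4) = 2 * x + π / 2 by ring, show 2 * -(π / 4) = -(π / 2) by ring,
    theta₂_neg, theta₃_neg, theta₂_pi_div_two, theta₂_add_pi_div_two, ← theta₂] at h
  rw [h, theta₄, zero_add]
  ring

theorem theta₃_mul_theta₄ (x : ℝ) :
    theta₃ p x * theta₄ p x = theta₄ (p ^ 2) (2 * x) * theta₄ (p ^ 2) 0 := by
  have h := theta₃_add_mul_sub hp (x + π / 4) (-(π / 4))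
  rw [show x + π / 4 + -(π / 4) = x by ring, show x + π / 4 - -(π / 4) = x + π / 2 by ring,
    show 2 * (x + π / 4) = 2 * x + π / 2 by ring, show 2 * -(π / 4) = -(π / 2) by ring,
    theta₂_neg, theta₃_neg, theta₂_pi_div_two, ← theta₄, ← theta₄] at h
  rw [h, ← zero_add (π / 2), ← theta₄]
  ring

end RealTheta

section Positivity

open Real

lemma abs_sin_nat_mul_le (n : ℕ) (x : ℝ) : |sin (n * x)| ≤ n * |sin x| := by
  induction n with
  | zero => simp
  | succ n ih =>
    rw [Nat.cast_succ, add_one_mul, sin_add]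
    calc |sin (n * x) * cos x + cos (n * x) * sin x|
        ≤ |sin (n * x)| * |cos x| + |cos (n * x)| * |sin x| := by
          rw [← abs_mul, ← abs_mul]
          exact abs_add_le _ _
      _ ≤ n * |sin x| * 1 + 1 * |sin x| := by
          gcongr <;> exact abs_cos_le_one _
      _ = (n + 1) * |sin x| := by ring

theorem nome_induction {P : ℝ → Prop} (hsmall : ∀ p, 0 ≤ p → p ≤ 1 / 4 → P p)
    (hstep : ∀ p ∈ Ico (0 : ℝ) 1, P (p ^ 2) → P p) {p : ℝ} (hp : p ∈ Ico (0 : ℝ) 1) : P p := by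
  obtain ⟨n, hn⟩ := exists_pow_lt_of_lt_one (by norm_num : (0 : ℝ) < 1 / 4) hp.2
  have hle : p ^ 2 ^ n ≤ 1 / 4 :=
    (pow_le_pow_of_le_one hp.1 hp.2.le Nat.lt_two_pow_self.le).trans hn.le
  clear hn
  induction n generalizing p with
  | zero => exact hsmall p hp.1 (by simpa using hle)
  | succ n ih =>
    refine hstep p hp (ih (sq_mem_Ico hp) ?_)
    rwa [← pow_mul, mul_comm, ← pow_succ]

lemma theta₃_pos_of_le {p : ℝ} (h0 : 0 ≤ p) (h1 : p ≤ 1 / 4) (x : ℝ) : 0 < theta₃ p x := by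
  have hterm (n : ℕ) : -(1 / 2 * (1 / 4) ^ n) ≤
      2 * (p ^ ((n + 1) ^ 2) * cos (2 * (n + 1) * x)) := by
    have hpow : p ^ ((n + 1) ^ 2) ≤ (1 / 4) ^ (n + 1) :=
      (pow_le_pow_of_le_one h0 (by linarith) (by nlinarith)).trans (pow_le_pow_left₀ h0 h1 _)
    have hcos := neg_one_le_cos (2 * (n + 1) * x)
    have hnonneg : 0 ≤ p ^ ((n + 1) ^ 2) := by positivity
    rw [pow_succ (1 / 4 : ℝ)] at hpow
    nlinarith
  have hgeom := ((hasSum_geometric_of_lt_one (by norm_num : (0 : ℝ) ≤ 1 / 4)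
    (by norm_num)).mul_left (1 / 2)).neg
  have hle := hasSum_le hterm hgeom (hasSum_theta₃ ⟨h0, by linarith⟩ x)
  norm_num at hle
  linarith

lemma theta₁_term_succ_ge {p : ℝ} (h0 : 0 ≤ p) (h1 : p ≤ 1 / 4) {x : ℝ} (hx : 0 < sin x)
    (n : ℕ) : -(2 * sin x * (1 / 4 * (1 / 4) ^ n)) ≤
      2 * ((-1) ^ (n + 1) * p ^ ((n + 1) * (n + 1 + 1)) * sin ((2 * (n + 1 : ℕ) + 1) * x)) := by
  have hpow : p ^ ((n + 1) * (n + 1 + 1)) ≤ (1 / 16) ^ (n + 1) :=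
    calc p ^ ((n + 1) * (n + 1 + 1)) ≤ p ^ (2 * (n + 1)) :=
          pow_le_pow_of_le_one h0 (by linarith) (by nlinarith)
      _ = (p ^ 2) ^ (n + 1) := by rw [pow_mul]
      _ ≤ (1 / 16) ^ (n + 1) := pow_le_pow_left₀ (sq_nonneg p) (by nlinarith) _
  have hodd : (2 * (n + 1 : ℕ) + 1 : ℝ) ≤ 4 ^ (n + 1) := by
    have hbernoulli := one_add_mul_le_pow (by norm_num : (-2 : ℝ) ≤ 3) (n + 1)
    norm_num at hbernoulli ⊢
    linarith
  have hsin : |sin ((2 * (n + 1 : ℕ) + 1) * x)| ≤ 4 ^ (n + 1) * sin x := by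
    have hmul := abs_sin_nat_mul_le (2 * (n + 1) + 1) x
    push_cast at hmul hodd ⊢
    rw [abs_of_pos hx] at hmul
    exact hmul.trans (mul_le_mul_of_nonneg_right hodd hx.le)
  have habs : |(-1) ^ (n + 1) * p ^ ((n + 1) * (n + 1 + 1)) * sin ((2 * (n + 1 : ℕ) + 1) * x)| ≤
      sin x * (1 / 4 * (1 / 4) ^ n) := by
    rw [abs_mul, abs_mul, abs_pow, abs_neg, abs_one, one_pow, one_mul, abs_of_nonneg
      (by positivity : 0 ≤ p ^ ((n + 1) * (n + 1 + 1)))]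
    calc p ^ ((n + 1) * (n + 1 + 1)) * |sin ((2 * (n + 1 : ℕ) + 1) * x)|
        ≤ (1 / 16) ^ (n + 1) * (4 ^ (n + 1) * sin x) :=
          mul_le_mul hpow hsin (abs_nonneg _) (by positivity)
      _ = sin x * (1 / 4 * (1 / 4) ^ n) := by
          rw [← mul_assoc, ← mul_pow, pow_succ]
          norm_num
          ring
  linarith [(abs_le.1 habs).1]

lemma theta₁_pos_of_le {p : ℝ} (h0 : 0 ≤ p) (h1 : p ≤ 1 / 4) {x : ℝ} (hx : x ∈ Ioo 0 π) :
    0 < theta₁ p x := by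
  have hsin := sin_pos_of_mem_Ioo hx
  have htail := (hasSum_nat_add_iff' 1).2 (hasSum_theta₁ ⟨h0, by linarith⟩ x)
  have hgeom := (((hasSum_geometric_of_lt_one (by norm_num : (0 : ℝ) ≤ 1 / 4)
    (by norm_num)).mul_left (1 / 4)).mul_left (2 * sin x)).neg
  have hle := hasSum_le (theta₁_term_succ_ge h0 h1 hsin) hgeom htail
  norm_num at hle
  linarith

lemma lt_of_forall_exists_lt {f : ℝ → ℝ} {a b : ℝ} (hf : ContinuousOn f (Icc a b))
    (hab : f a = f b) (h : ∀ w ∈ Ioo a b, ∃ w' ∈ Icc a b, f w' < f w) {x : ℝ}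
    (hx : x ∈ Ioo a b) : f a < f x := by
  obtain ⟨m, hm, hmin⟩ := isCompact_Icc.exists_isMinOn (nonempty_Icc.2 (hx.1.trans hx.2).le) hf
  have hfm : f m = f a := by
    rcases hm.1.eq_or_lt with rfl | ham
    · rfl
    rcases hm.2.eq_or_lt with rfl | hmb
    · exact hab.symm
    obtain ⟨w, hw, hlt⟩ := h m ⟨ham, hmb⟩
    exact absurd (hmin hw) hlt.not_ge
  obtain ⟨w, hw, hlt⟩ := h x hx
  exact hfm ▸ (hmin hw).trans_lt hlt

variable {p : ℝ} (hp : p ∈ Ico (0 : ℝ) 1)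
include hp

theorem theta₃_pos (x : ℝ) : 0 < theta₃ p x := by
  refine nome_induction (P := fun p => ∀ x, 0 < theta₃ p x) (fun p h0 h1 => theta₃_pos_of_le h0 h1)
    (fun p hp ih x => ?_) hp x
  have hne (x : ℝ) : theta₃ p x ≠ 0 := fun h => by
    have hmul := theta₃_mul_theta₄ hp x
    rw [h, zero_mul] at hmul
    exact (mul_pos (ih (2 * x + π / 2)) (ih (0 + π / 2))).ne hmul
  have h0 : 0 < theta₃ p 0 := by
    have h := HasSum.nonneg (fun n : ℕ => ?_) (hasSum_theta₃ hp 0)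
    · linarith
    · have := hp.1
      rw [mul_zero, cos_zero]
      positivity
  by_contra! hx
  obtain ⟨y, -, hy⟩ := isPreconnected_univ.intermediate_value (mem_univ x) (mem_univ 0)
    (continuous_theta₃ hp).continuousOn ⟨hx, h0.le⟩
  exact hne y hy

theorem theta₄_pos (x : ℝ) : 0 < theta₄ p x := theta₃_pos hp _

lemma theta₁_pi_div_two_pos : 0 < theta₁ p (π / 2) := by
  have hterm (n : ℕ) : 2 * ((-1) ^ n * p ^ (n * (n + 1)) * sin ((2 * n + 1) * (π / 2))) =
      2 * p ^ (n * (n + 1)) := by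
    rw [show (2 * (n : ℝ) + 1) * (π / 2) = n * π + π / 2 by ring, sin_add_pi_div_two,
      cos_nat_mul_pi, mul_right_comm, ← mul_pow, neg_one_mul, neg_neg, one_pow, one_mul]
  have h := hasSum_theta₁ hp (π / 2)
  simp only [hterm] at h
  have hle := le_hasSum h 0 fun n _ => mul_nonneg zero_le_two (pow_nonneg hp.1 _)
  norm_num at hle
  linarith

theorem theta₁_pos {x : ℝ} (hx : x ∈ Ioo 0 π) : 0 < theta₁ p x := by
  refine nome_induction (P := fun p => ∀ x ∈ Ioo 0 π, 0 < theta₁ p x)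
    (fun p h0 h1 x hx => theta₁_pos_of_le h0 h1 hx) (fun p hp ih x hx => ?_) hp x hx
  have hfirst (x : ℝ) (hx : x ∈ Ioc 0 (π / 2)) : 0 < theta₁ p x := by
    by_contra! hneg
    obtain ⟨y, hy, hy0⟩ := intermediate_value_Icc hx.2 (continuous_theta₁ hp).continuousOn
      ⟨hneg, (theta₁_pi_div_two_pos hp).le⟩
    rcases hy.2.eq_or_lt with rfl | hlt
    · exact (theta₁_pi_div_two_pos hp).ne' hy0
    · have h := theta₁_mul_theta₂ hp y
      rw [hy0, zero_mul] at h
      exact (mul_pos (ih (2 * y) ⟨by linarith [hx.1, hy.1], by linarith⟩)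
        (theta₄_pos (sq_mem_Ico hp) 0)).ne h
  rcases le_total x (π / 2) with h | h
  · exact hfirst x ⟨hx.1, h⟩
  · rw [← theta₁_pi_sub]
    exact hfirst _ ⟨by linarith [hx.2], by linarith⟩

lemma theta₁_nonneg {x : ℝ} (hx : x ∈ Icc 0 π) : 0 ≤ theta₁ p x := by
  rcases hx.1.eq_or_lt with rfl | h0
  · exact (theta₁_zero p).ge
  rcases hx.2.eq_or_lt with rfl | hπ
  · exact (theta₁_pi p).ge
  · exact (theta₁_pos hp ⟨h0, hπ⟩).le

theorem theta₂_pos {x : ℝ} (hx : x ∈ Ioo (-(π / 2)) (π / 2)) : 0 < theta₂ p x :=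
  theta₁_pos hp ⟨by linarith [hx.1], by linarith [hx.2]⟩

lemma theta₃_le_theta₃_zero (x : ℝ) : theta₃ p x ≤ theta₃ p 0 := by
  refine sub_le_sub_iff_right 1 |>.1 (hasSum_le (fun n : ℕ => ?_)
    (hasSum_theta₃ hp x) (hasSum_theta₃ hp 0))
  rw [mul_zero, cos_zero]
  exact mul_le_mul_of_nonneg_left (mul_le_mul_of_nonneg_left (cos_le_one _) (pow_nonneg hp.1 _))
    zero_le_two

theorem theta₁_add_mul_sub_lt_sq {x y : ℝ} (hy : theta₁ p y ≠ 0) :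
    theta₁ p (x + y) * theta₁ p (x - y) < theta₁ p x ^ 2 := by
  have key : theta₁ p (x + y) * theta₁ p (x - y) * theta₃ p 0 ^ 2
      = theta₁ p x ^ 2 * theta₃ p y ^ 2 - theta₃ p x ^ 2 * theta₁ p y ^ 2 := by
    rw [theta₁_add_mul_sub hp, theta₁_sq hp, theta₁_sq hp, theta₃_sq hp, theta₃_sq hp,
      theta₃_sq hp, mul_zero]
    ring
  have hx := theta₃_pos hp x
  have hsq : theta₃ p y ^ 2 ≤ theta₃ p 0 ^ 2 :=
    pow_le_pow_left₀ (theta₃_pos hp y).le (theta₃_le_theta₃_zero hp y) 2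
  refine lt_of_mul_lt_mul_right ?_ (sq_nonneg (theta₃ p 0))
  have hpos : 0 < theta₃ p x ^ 2 * theta₁ p y ^ 2 := by positivity
  nlinarith [mul_le_mul_of_nonneg_left hsq (sq_nonneg (theta₁ p x))]

theorem theta₁_lt_of_mem {x₀ x : ℝ} (h0 : 0 ≤ x₀) (hx : x ∈ Ioo x₀ (π - x₀)) :
    theta₁ p x₀ < theta₁ p x := by
  refine lt_of_forall_exists_lt (continuous_theta₁ hp).continuousOn (theta₁_pi_sub p x₀).symm
    (fun w hw => ?_) hx
  by_contra! hmin
  obtain ⟨d, hd0, hleft, hright⟩ : ∃ d, 0 < d ∧ d ≤ w - x₀ ∧ d ≤ π - x₀ - w :=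
    ⟨min (w - x₀) (π - x₀ - w), lt_min (by linarith [hw.1]) (by linarith [hw.2]),
      min_le_left _ _, min_le_right _ _⟩
  have hpos : 0 < theta₁ p w := theta₁_pos hp ⟨by linarith [hw.1], by linarith [hw.2]⟩
  have hadd := hmin (w + d) ⟨by linarith, by linarith⟩
  have hsub := hmin (w - d) ⟨by linarith, by linarith⟩
  have hlt := theta₁_add_mul_sub_lt_sq hp (x := w)
    (theta₁_pos hp (x := d) ⟨hd0, by linarith [hw.2]⟩).ne'
  nlinarith

theorem theta₁_strictMonoOn : StrictMonoOn (theta₁ p) (Icc 0 (π / 2)) := fun x hx y hy hxy =>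
  theta₁_lt_of_mem hp hx.1 ⟨hxy, by linarith [hx.2, hy.2]⟩

theorem theta₁_strictAntiOn : StrictAntiOn (theta₁ p) (Icc (π / 2) π) := fun x hx y hy hxy => by
  rw [← theta₁_pi_sub p x, ← theta₁_pi_sub p y]
  exact theta₁_strictMonoOn hp ⟨by linarith [hy.2], by linarith [hy.1]⟩
    ⟨by linarith [hx.2], by linarith [hx.1]⟩ (by linarith)

end Positivity

section DualNome

open Real

lemma continuousOn_of_strictMonoOn_of_eq {X α β : Type*} [TopologicalSpace X]
    [LinearOrder α] [TopologicalSpace α] [OrderTopology α] [DenselyOrdered α]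
    [LinearOrder β] [TopologicalSpace β] [OrderTopology β]
    {S : Set X} {l u : α} {y : β} {F : X → α → β} {φ : X → α}
    (hF : ∀ x ∈ S, StrictMonoOn (F x) (Ioo l u))
    (hcont : ∀ z, ContinuousOn (fun x => F x z) S)
    (hφ : ∀ x ∈ S, φ x ∈ Ioo l u) (heq : ∀ x ∈ S, F x (φ x) = y) : ContinuousOn φ S := by
  intro x₀ hx₀
  refine tendsto_order.2 ⟨fun b hb => ?_, fun b hb => ?_⟩
  · obtain ⟨z, hz, hzφ⟩ := exists_between (max_lt hb (hφ x₀ hx₀).1)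
    have hz' : z ∈ Ioo l u := ⟨(le_max_right _ _).trans_lt hz, hzφ.trans (hφ x₀ hx₀).2⟩
    have hlt : F x₀ z < y := heq x₀ hx₀ ▸ hF x₀ hx₀ hz' (hφ x₀ hx₀) hzφ
    filter_upwards [(hcont z x₀ hx₀).eventually_lt_const hlt, self_mem_nhdsWithin] with x hx hxS
    rw [← heq x hxS, (hF x hxS).lt_iff_lt hz' (hφ x hxS)] at hx
    exact ((le_max_left _ _).trans_lt hz).trans hx
  · obtain ⟨z, hφz, hz⟩ := exists_between (lt_min hb (hφ x₀ hx₀).2)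
    have hz' : z ∈ Ioo l u := ⟨(hφ x₀ hx₀).1.trans hφz, hz.trans_le (min_le_right _ _)⟩
    have hlt : y < F x₀ z := heq x₀ hx₀ ▸ hF x₀ hx₀ (hφ x₀ hx₀) hz' hφz
    filter_upwards [(hcont z x₀ hx₀).eventually_const_lt hlt, self_mem_nhdsWithin] with x hx hxS
    rw [← heq x hxS, (hF x hxS).lt_iff_lt (hφ x hxS) hz'] at hx
    exact hx.trans (hz.trans_le (min_le_left _ _))

lemma continuousOn_theta₁_comp {X : Type*} [TopologicalSpace X] {S : Set X} {f g : X → ℝ}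
    (hf : ContinuousOn f S) (hg : ContinuousOn g S) (hmem : MapsTo f S (Ico 0 1)) :
    ContinuousOn (fun x => theta₁ (f x) (g x)) S :=
  continuousOn_theta₁.comp (hf.prodMk hg) fun _ hx => ⟨hmem hx, mem_univ _⟩

lemma continuousOn_theta₄_comp {X : Type*} [TopologicalSpace X] {S : Set X} {f g : X → ℝ}
    (hf : ContinuousOn f S) (hg : ContinuousOn g S) (hmem : MapsTo f S (Ico 0 1)) :
    ContinuousOn (fun x => theta₄ (f x) (g x)) S :=
  continuousOn_theta₃.comp (hf.prodMk (hg.add_const _)) fun _ hx => ⟨hmem hx, mem_univ _⟩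

/-- The function of the angle `φ = γ/τ` obtained by eliminating `c` between the equations for
`a c³` and `c²`. -/
noncomputable def weightDefect (a p φ : ℝ) : ℝ :=
  theta₁ p (4 * φ) ^ 2 * theta₁ p φ ^ 3 - a ^ 2 * (theta₁ p (2 * φ) ^ 2 * theta₁ p (3 * φ) ^ 3)

/-- The angle `φ = γ/τ` of the theta parametrisation whose dual nome `e^{-iπ/τ}` is `p`. -/
noncomputable def thetaAngle (a p : ℝ) : ℝ :=
  Classical.epsilon fun φ => φ ∈ Ioo (π / 4) (π / 3) ∧ weightDefect a p φ = 0

/-- The prefactor of the dual theta parametrisation of nome `p`. -/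
noncomputable def thetaScale (a p : ℝ) : ℝ :=
  √(theta₁ p (3 * thetaAngle a p) / theta₁ p (thetaAngle a p))

/-- The value of both coordinates at the symmetric point of the kernel curve of dual nome `p`. -/
noncomputable def symmPoint (a p : ℝ) : ℝ :=
  thetaScale a p * theta₄ p 0 / theta₄ p (2 * thetaAngle a p)

/-- The value `S(x, x)` of the step polynomial `S` on the diagonal. -/
noncomputable def diagonalStep (a x : ℝ) : ℝ := 2 * x + 2 / x + a * x ^ 2

lemma diagonalStep_pos {a x : ℝ} (ha : 0 ≤ a) (hx : 0 < x) : 0 < diagonalStep a x := by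
  rw [diagonalStep]
  positivity

/-- The value `1/t` of the step polynomial on the kernel curve of dual nome `p`. -/
noncomputable def stepValue (a p : ℝ) : ℝ := diagonalStep a (symmPoint a p)

lemma continuousOn_weightDefect {X : Type*} [TopologicalSpace X] {S : Set X} {f g : X → ℝ} (a : ℝ)
    (hf : ContinuousOn f S) (hg : ContinuousOn g S) (hmem : MapsTo f S (Ico 0 1)) :
    ContinuousOn (fun x => weightDefect a (f x) (g x)) S := by
  have hmul (k : ℝ) : ContinuousOn (fun x => theta₁ (f x) (k * g x)) S :=
    continuousOn_theta₁_comp hf (hg.const_mul k) hmem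
  exact (((hmul 4).pow 2).mul ((continuousOn_theta₁_comp hf hg hmem).pow 3)).sub
    ((((hmul 2).pow 2).mul ((hmul 3).pow 3)).const_mul _)

section Angle

variable {p φ : ℝ} (hp : p ∈ Ico (0 : ℝ) 1)
include hp

lemma theta₁_signs_of_mem (hφ : φ ∈ Icc (π / 4) (π / 3)) :
    0 < theta₁ p φ ∧ 0 < theta₁ p (2 * φ) ∧ 0 ≤ theta₁ p (3 * φ) ∧ theta₁ p (4 * φ) ≤ 0 := by
  have hπ := pi_pos
  refine ⟨theta₁_pos hp ⟨by linarith [hφ.1], by linarith [hφ.2]⟩,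
    theta₁_pos hp ⟨by linarith [hφ.1], by linarith [hφ.2]⟩,
    theta₁_nonneg hp ⟨by linarith [hφ.1], by linarith [hφ.2]⟩, ?_⟩
  rw [← neg_nonneg, ← theta₁_sub_pi]
  exact theta₁_nonneg hp ⟨by linarith [hφ.1], by linarith [hφ.2]⟩

lemma weightDefect_strictMonoOn {a : ℝ} (ha : 0 < a) :
    StrictMonoOn (weightDefect a p) (Icc (π / 4) (π / 3)) := by
  intro φ hφ ψ hψ hlt
  have hπ := pi_pos
  obtain ⟨hφ1, -, -, hφ4⟩ := theta₁_signs_of_mem hp hφ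
  obtain ⟨-, hψ2, hψ3, -⟩ := theta₁_signs_of_mem hp hψ
  have h1 : theta₁ p φ < theta₁ p ψ :=
    theta₁_strictMonoOn hp ⟨by linarith [hφ.1], by linarith [hφ.2]⟩
      ⟨by linarith [hψ.1], by linarith [hψ.2]⟩ hlt
  have h2 : theta₁ p (2 * ψ) < theta₁ p (2 * φ) :=
    theta₁_strictAntiOn hp ⟨by linarith [hφ.1], by linarith [hφ.2]⟩
      ⟨by linarith [hψ.1], by linarith [hψ.2]⟩ (by linarith)
  have h3 : theta₁ p (3 * ψ) < theta₁ p (3 * φ) :=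
    theta₁_strictAntiOn hp ⟨by linarith [hφ.1], by linarith [hφ.2]⟩
      ⟨by linarith [hψ.1], by linarith [hψ.2]⟩ (by linarith)
  have h4 : -theta₁ p (4 * φ) < -theta₁ p (4 * ψ) := by
    rw [← theta₁_sub_pi, ← theta₁_sub_pi]
    exact theta₁_strictMonoOn hp ⟨by linarith [hφ.1], by linarith [hφ.2]⟩
      ⟨by linarith [hψ.1], by linarith [hψ.2]⟩ (by linarith)
  have hinc : theta₁ p (4 * φ) ^ 2 * theta₁ p φ ^ 3 < theta₁ p (4 * ψ) ^ 2 * theta₁ p ψ ^ 3 := by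
    rw [← neg_sq, ← neg_sq (theta₁ p (4 * ψ))]
    exact mul_lt_mul'' (pow_lt_pow_left₀ h4 (neg_nonneg.2 hφ4) two_ne_zero)
      (pow_lt_pow_left₀ h1 hφ1.le three_ne_zero) (by positivity) (by positivity)
  have hdec : theta₁ p (2 * ψ) ^ 2 * theta₁ p (3 * ψ) ^ 3 <
      theta₁ p (2 * φ) ^ 2 * theta₁ p (3 * φ) ^ 3 :=
    mul_lt_mul'' (pow_lt_pow_left₀ h2 hψ2.le two_ne_zero)
      (pow_lt_pow_left₀ h3 hψ3 three_ne_zero) (by positivity) (by positivity)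
  exact sub_lt_sub hinc (mul_lt_mul_of_pos_left hdec (pow_pos ha 2))

lemma exists_weightDefect_eq_zero {a : ℝ} (ha : 0 < a) :
    ∃ φ, φ ∈ Ioo (π / 4) (π / 3) ∧ weightDefect a p φ = 0 := by
  have hπ := pi_pos
  have hcont : ContinuousOn (weightDefect a p) (Icc (π / 4) (π / 3)) :=
    continuousOn_weightDefect a continuousOn_const continuousOn_id fun _ _ => hp
  have hneg : weightDefect a p (π / 4) < 0 := by
    rw [weightDefect, mul_div_cancel₀ _ four_ne_zero, theta₁_pi, zero_pow two_ne_zero,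
      zero_mul, zero_sub, neg_lt_zero]
    have h2 : 0 < theta₁ p (2 * (π / 4)) := theta₁_pos hp ⟨by linarith, by linarith⟩
    have h3 : 0 < theta₁ p (3 * (π / 4)) := theta₁_pos hp ⟨by linarith, by linarith⟩
    positivity
  have hpos : 0 < weightDefect a p (π / 3) := by
    have h4 : theta₁ p (4 * (π / 3)) = -theta₁ p (π / 3) := by
      rw [← theta₁_add_pi]
      ring_nf
    have h1 : 0 < theta₁ p (π / 3) := theta₁_pos hp ⟨by linarith, by linarith⟩
    rw [weightDefect, h4, neg_sq, mul_div_cancel₀ _ three_ne_zero, theta₁_pi,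
      zero_pow three_ne_zero, mul_zero, mul_zero, sub_zero]
    positivity
  obtain ⟨φ, hφ, h⟩ := intermediate_value_Ioo (by linarith) hcont ⟨hneg, hpos⟩
  exact ⟨φ, hφ, h⟩

end Angle

section StepValue

variable {a : ℝ} (ha : 0 < a)
include ha

lemma thetaAngle_spec {p : ℝ} (hp : p ∈ Ico (0 : ℝ) 1) :
    thetaAngle a p ∈ Ioo (π / 4) (π / 3) ∧ weightDefect a p (thetaAngle a p) = 0 :=
  Classical.epsilon_spec (exists_weightDefect_eq_zero hp ha)

lemma continuousOn_thetaAngle : ContinuousOn (thetaAngle a) (Ico 0 1) :=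
  continuousOn_of_strictMonoOn_of_eq (F := weightDefect a)
    (fun _ hp => (weightDefect_strictMonoOn hp ha).mono Ioo_subset_Icc_self)
    (fun _ => continuousOn_weightDefect a continuousOn_id continuousOn_const fun _ hp => hp)
    (fun _ hp => (thetaAngle_spec ha hp).1) (fun _ hp => (thetaAngle_spec ha hp).2)

section FixedNome

variable {p : ℝ} (hp : p ∈ Ico (0 : ℝ) 1)
include hp

lemma theta₁_thetaAngle_signs :
    0 < theta₁ p (thetaAngle a p) ∧ 0 < theta₁ p (2 * thetaAngle a p) ∧
      0 < theta₁ p (3 * thetaAngle a p) ∧ theta₁ p (4 * thetaAngle a p) < 0 := by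
  obtain ⟨h1, h2⟩ := (thetaAngle_spec ha hp).1
  refine ⟨theta₁_pos hp ⟨by linarith, by linarith⟩, theta₁_pos hp ⟨by linarith, by linarith⟩,
    theta₁_pos hp ⟨by linarith, by linarith⟩, ?_⟩
  rw [← neg_pos, ← theta₁_sub_pi]
  exact theta₁_pos hp ⟨by linarith, by linarith⟩

lemma thetaScale_pos : 0 < thetaScale a p := by
  obtain ⟨h1, -, h3, -⟩ := theta₁_thetaAngle_signs ha hp
  exact sqrt_pos.2 (div_pos h3 h1)

lemma thetaScale_sq :
    thetaScale a p ^ 2 * theta₁ p (thetaAngle a p) = theta₁ p (3 * thetaAngle a p) := by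
  obtain ⟨h1, -, h3, -⟩ := theta₁_thetaAngle_signs ha hp
  rw [thetaScale, sq_sqrt (div_pos h3 h1).le, div_mul_cancel₀ _ h1.ne']

lemma thetaScale_cube :
    a * thetaScale a p ^ 3 * theta₁ p (2 * thetaAngle a p) = -theta₁ p (4 * thetaAngle a p) := by
  obtain ⟨h1, h2, -, h4⟩ := theta₁_thetaAngle_signs ha hp
  have hdefect := (thetaAngle_spec ha hp).2
  have hscale := thetaScale_pos ha hp
  rw [weightDefect, ← thetaScale_sq ha hp] at hdefect
  refine (pow_left_inj₀ (by positivity) (neg_pos.2 h4).le two_ne_zero).1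
    (mul_right_cancel₀ (pow_pos h1 3).ne' ?_)
  linear_combination -hdefect

lemma eq_thetaAngle_and_thetaScale {φ c : ℝ} (hφ : φ ∈ Ioo (π / 4) (π / 3)) (hc : 0 < c)
    (hsq : c ^ 2 * theta₁ p φ = theta₁ p (3 * φ))
    (hcube : a * c ^ 3 * theta₁ p (2 * φ) = -theta₁ p (4 * φ)) :
    φ = thetaAngle a p ∧ c = thetaScale a p := by
  have hangle : φ = thetaAngle a p := by
    obtain ⟨hmem, h0⟩ := thetaAngle_spec ha hp
    refine (weightDefect_strictMonoOn hp ha).injOn (Ioo_subset_Icc_self hφ)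
      (Ioo_subset_Icc_self hmem) (Eq.trans ?_ h0.symm)
    rw [weightDefect, ← hsq, ← neg_sq, ← hcube]
    ring
  refine ⟨hangle, ?_⟩
  have h1 := (theta₁_thetaAngle_signs ha hp).1
  rw [thetaScale, ← hangle, ← hsq, mul_div_cancel_right₀ _ (hangle ▸ h1).ne', sqrt_sq hc.le]

lemma thetaScale_le_one : thetaScale a p ≤ 1 := by
  obtain ⟨h1, h2⟩ := (thetaAngle_spec ha hp).1
  rw [thetaScale, sqrt_le_one, div_le_one (theta₁_thetaAngle_signs ha hp).1,
    ← theta₁_pi_sub p (3 * _)]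
  exact (theta₁_strictMonoOn hp).monotoneOn ⟨by linarith, by linarith⟩ ⟨by linarith, by linarith⟩
    (by linarith)

lemma symmPoint_pos : 0 < symmPoint a p :=
  div_pos (mul_pos (thetaScale_pos ha hp) (theta₄_pos hp _)) (theta₄_pos hp _)

lemma stepValue_pos : 0 < stepValue a p := diagonalStep_pos ha.le (symmPoint_pos ha hp)

end FixedNome

lemma continuousOn_stepValue : ContinuousOn (stepValue a) (Ico 0 1) := by
  have hangle := continuousOn_thetaAngle ha
  have hid : MapsTo (fun p : ℝ => p) (Ico 0 1) (Ico 0 1) := fun _ hp => hp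
  have hscale : ContinuousOn (thetaScale a) (Ico 0 1) :=
    ((continuousOn_theta₁_comp continuousOn_id (hangle.const_mul 3) hid).div
      (continuousOn_theta₁_comp continuousOn_id hangle hid)
      fun p hp => (theta₁_thetaAngle_signs ha hp).1.ne').sqrt
  have hsymm : ContinuousOn (symmPoint a) (Ico 0 1) :=
    (hscale.mul (continuousOn_theta₄_comp continuousOn_id continuousOn_const hid)).div
      (continuousOn_theta₄_comp continuousOn_id (hangle.const_mul 2) hid)
      fun p hp => (theta₄_pos hp _).ne'
  exact ((hsymm.const_mul 2).add (continuousOn_const.div hsymm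
    fun p hp => (symmPoint_pos ha hp).ne')).add ((hsymm.pow 2).const_mul a)

lemma symmPoint_nome_zero : a * symmPoint a 0 ^ 3 + symmPoint a 0 ^ 2 = 1 := by
  have h0 : (0 : ℝ) ∈ Ico (0 : ℝ) 1 := ⟨le_rfl, one_pos⟩
  obtain ⟨h1, h2, -, -⟩ := theta₁_thetaAngle_signs ha h0
  have hsq := thetaScale_sq ha h0
  have hcube := thetaScale_cube ha h0
  rw [symmPoint, theta₄_nome_zero, theta₄_nome_zero, mul_one, div_one]
  simp only [theta₁_nome_zero] at h1 h2 hsq hcube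
  generalize thetaAngle a 0 = φ at *
  rw [show 4 * φ = 2 * (2 * φ) by ring, sin_two_mul (2 * φ), cos_two_mul, cos_sq'] at hcube
  rw [sin_three_mul] at hsq
  refine mul_right_cancel₀ (mul_pos h1 h2).ne' ?_
  linear_combination 2 * sin φ * hcube + 2 * sin (2 * φ) * hsq

end StepValue

end DualNome

section StepValueAtOne

open Real

variable {p : ℝ} (hp : p ∈ Ico (0 : ℝ) 1)
include hp

lemma theta₄_two_mul_mul_pow_le (x : ℝ) : theta₄ p (2 * x) * theta₄ p 0 ^ 3 ≤ theta₄ p x ^ 4 := by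
  have hadd := theta₄_add_mul_sub hp x x
  have hx := theta₄_sq hp x
  have h0 := theta₄_sq hp 0
  rw [sub_self, ← two_mul] at hadd
  rw [mul_zero] at h0
  have hdiff : theta₄ p x ^ 4 - theta₄ p (2 * x) * theta₄ p 0 ^ 3 =
      p * (theta₃ (p ^ 2) (2 * x) * theta₂ (p ^ 2) 0
        - theta₂ (p ^ 2) (2 * x) * theta₃ (p ^ 2) 0) ^ 2 :=
    calc _ = (theta₄ p x ^ 2) ^ 2 - theta₄ p (2 * x) * theta₄ p 0 * theta₄ p 0 ^ 2 := by ring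
      _ = _ := by
        rw [hadd, hx, h0]
        ring
  exact sub_nonneg.1 (hdiff ▸ mul_nonneg hp.1 (sq_nonneg _))

theorem theta₄_zero_le (x : ℝ) : theta₄ p 0 ≤ theta₄ p x := by
  have hcont : Continuous (theta₄ p) := (continuous_theta₃ hp).comp (by fun_prop)
  have hper : Function.Periodic (theta₄ p) π := theta₄_add_pi p
  obtain ⟨m, -, hm⟩ := isCompact_Icc.exists_isMinOn (nonempty_Icc.2 pi_pos.le) hcont.continuousOn
  have hmin (y : ℝ) : theta₄ p m ≤ theta₄ p y := by
    obtain ⟨z, hz, hyz⟩ := hper.exists_mem_Ico₀ pi_pos y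
    exact hyz ▸ hm ⟨hz.1, hz.2.le⟩
  have hcube : theta₄ p 0 ^ 3 ≤ theta₄ p m ^ 3 := by
    refine le_of_mul_le_mul_left ?_ (theta₄_pos hp m)
    calc theta₄ p m * theta₄ p 0 ^ 3 ≤ theta₄ p (2 * m) * theta₄ p 0 ^ 3 :=
          mul_le_mul_of_nonneg_right (hmin _) (pow_pos (theta₄_pos hp 0) 3).le
      _ ≤ theta₄ p m ^ 4 := theta₄_two_mul_mul_pow_le hp m
      _ = theta₄ p m * theta₄ p m ^ 3 := by ring
  exact ((pow_le_pow_iff_left₀ (theta₄_pos hp 0).le (theta₄_pos hp m).le three_ne_zero).1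
    hcube).trans (hmin x)

lemma theta₃_zero_mul_theta₄_zero_le (x : ℝ) :
    theta₃ p 0 * theta₄ p 0 ≤ theta₃ p x * theta₄ p x := by
  rw [theta₃_mul_theta₄ hp, theta₃_mul_theta₄ hp, mul_zero]
  exact mul_le_mul_of_nonneg_right (theta₄_zero_le (sq_mem_Ico hp) _)
    (theta₄_pos (sq_mem_Ico hp) _).le

/-- Abel summation, since `2 sin x cos 2(n+1)x` telescopes and `p ^ n²` decreases. -/
lemma sin_mul_theta₃_le_one (x : ℝ) : sin x * theta₃ p x ≤ 1 := by
  have hsum := (hasSum_theta₃ hp x).mul_left (sin x)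
  have hterm (n : ℕ) : sin x * (2 * (p ^ ((n + 1) ^ 2) * cos (2 * (n + 1) * x)))
      = p ^ ((n + 1) ^ 2) * (sin ((2 * n + 3) * x) - sin ((2 * n + 1) * x)) := by
    rw [show (2 * (n : ℝ) + 3) * x = 2 * (n + 1) * x + x by ring,
      show (2 * (n : ℝ) + 1) * x = 2 * (n + 1) * x - x by ring, sin_add, sin_sub]
    ring
  simp only [hterm] at hsum
  have habel (N : ℕ) : sin x + ∑ n ∈ Finset.range N,
      p ^ ((n + 1) ^ 2) * (sin ((2 * n + 3) * x) - sin ((2 * n + 1) * x))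
      ≤ 1 - p ^ (N ^ 2) + p ^ (N ^ 2) * sin ((2 * N + 1) * x) := by
    induction N with
    | zero => simp
    | succ N ih =>
      have hpow : p ^ ((N + 1) ^ 2) ≤ p ^ (N ^ 2) :=
        pow_le_pow_of_le_one hp.1 hp.2.le (Nat.pow_le_pow_left N.le_succ 2)
      have hsin := sin_le_one ((2 * N + 1) * x)
      rw [Finset.sum_range_succ, ← add_assoc,
        show (2 * ((N + 1 : ℕ) : ℝ) + 1) * x = (2 * N + 3) * x by push_cast; ring]
      nlinarith
  have hle (N : ℕ) : ∑ n ∈ Finset.range N,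
      p ^ ((n + 1) ^ 2) * (sin ((2 * n + 3) * x) - sin ((2 * n + 1) * x)) ≤ 1 - sin x := by
    have hmul := mul_le_mul_of_nonneg_left (sin_le_one ((2 * N + 1) * x))
      (pow_nonneg hp.1 (N ^ 2))
    linarith [habel N]
  linarith [le_of_tendsto' hsum.tendsto_sum_nat hle]

lemma theta₃_zero_le_stepValue {a : ℝ} (ha : 0 < a) : theta₃ p 0 ≤ stepValue a p := by
  obtain ⟨hlow, hup⟩ := (thetaAngle_spec ha hp).1
  have hsymm := symmPoint_pos ha hp
  have h4 := theta₄_pos hp (2 * thetaAngle a p)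
  have hsin : 1 / 2 ≤ sin (2 * thetaAngle a p) := by
    rw [← sin_pi_sub, ← sin_pi_div_six]
    exact sin_le_sin_of_le_of_le_pi_div_two (by linarith) (by linarith) (by linarith)
  have hbound : theta₃ p (2 * thetaAngle a p) ≤ 2 := by
    nlinarith [sin_mul_theta₃_le_one hp (2 * thetaAngle a p), theta₃_pos hp (2 * thetaAngle a p)]
  have hmul : theta₃ p 0 * symmPoint a p ≤ 2 := by
    rw [symmPoint, mul_div_assoc', div_le_iff₀ h4]
    calc theta₃ p 0 * (thetaScale a p * theta₄ p 0)
        = thetaScale a p * (theta₃ p 0 * theta₄ p 0) := by ring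
      _ ≤ 1 * (theta₃ p 0 * theta₄ p 0) := mul_le_mul_of_nonneg_right (thetaScale_le_one ha hp)
          (mul_pos (theta₃_pos hp 0) (theta₄_pos hp 0)).le
      _ ≤ theta₃ p (2 * thetaAngle a p) * theta₄ p (2 * thetaAngle a p) := by
          rw [one_mul]
          exact theta₃_zero_mul_theta₄_zero_le hp _
      _ ≤ 2 * theta₄ p (2 * thetaAngle a p) := mul_le_mul_of_nonneg_right hbound h4.le
  have hrest : 0 < 2 * symmPoint a p + a * symmPoint a p ^ 2 := by positivity
  rw [stepValue, diagonalStep]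
  linarith [(le_div_iff₀ hsymm).2 hmul]

omit hp

lemma tendsto_theta₃_zero_atTop : Tendsto (fun p => theta₃ p 0) (𝓝[<] 1) atTop := by
  refine tendsto_atTop.2 fun b => ?_
  obtain ⟨N, hN⟩ := exists_nat_gt b
  have hcont : Tendsto (fun p : ℝ => ∑ n ∈ Finset.range N, 2 * p ^ ((n + 1) ^ 2)) (𝓝[<] 1)
      (𝓝 (∑ n ∈ Finset.range N, 2 * (1 : ℝ) ^ ((n + 1) ^ 2))) :=
    tendsto_nhdsWithin_of_tendsto_nhds (Continuous.tendsto (by fun_prop) _)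
  have hlt : b - 1 < ∑ n ∈ Finset.range N, 2 * (1 : ℝ) ^ ((n + 1) ^ 2) := by
    simp only [one_pow, mul_one, Finset.sum_const, Finset.card_range, nsmul_eq_mul]
    linarith [(Nat.cast_nonneg N : (0 : ℝ) ≤ N)]
  filter_upwards [hcont.eventually_const_lt hlt, Ioo_mem_nhdsLT (zero_lt_one : (0 : ℝ) < 1)]
    with p hp hmem
  have hle := sum_le_hasSum (Finset.range N) (fun n _ => ?_)
    (hasSum_theta₃ (Ioo_subset_Ico_self hmem) 0)
  · simp only [mul_zero, cos_zero, mul_one] at hle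
    linarith
  · have := hmem.1
    rw [mul_zero, cos_zero]
    positivity

lemma tendsto_stepValue_atTop {a : ℝ} (ha : 0 < a) : Tendsto (stepValue a) (𝓝[<] 1) atTop := by
  refine tendsto_atTop_mono' _ ?_ tendsto_theta₃_zero_atTop
  filter_upwards [Ioo_mem_nhdsLT (zero_lt_one : (0 : ℝ) < 1)] with p hp
  exact theta₃_zero_le_stepValue (Ioo_subset_Ico_self hp) ha

end StepValueAtOne

section Embedding

open Real

variable {F : ℂ → ℂ} {r : ℝ → ℝ} {K : ℂ} (hK : K ≠ 0) (hF : Differentiable ℂ F)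
  (hFr : ∀ x : ℝ, F x = K * r x)
include hK hF hFr

lemma differentiable_of_ofReal_eq : Differentiable ℝ r := fun x => by
  have hre : r = fun x : ℝ => (F x / K).re := by
    funext y
    rw [hFr, mul_div_cancel_left₀ _ hK, Complex.ofReal_re]
  rw [hre]
  exact ((hF x).hasDerivAt.div_const K).real_of_complex.differentiableAt

lemma deriv_ofReal_eq (x : ℝ) : deriv F x = K * deriv r x := by
  have hreal := ((differentiable_of_ofReal_eq hK hF hFr x).hasDerivAt.ofReal_comp).const_mul K
  simp only [← hFr] at hreal
  exact (hF x).hasDerivAt.comp_ofReal.unique hreal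

lemma solvesThetaEquations_ofReal_iff {a c φ v : ℝ} :
    SolvesThetaEquations F a c φ v ↔ SolvesThetaEquations r a c φ v := by
  have hmul (k : ℝ) : F (k * φ) = K * r (k * φ) := by
    rw [← Complex.ofReal_mul]
    exact hFr _
  have hderiv := deriv_ofReal_eq hK hF hFr
  have hderiv₂ := hderiv (2 * φ)
  have hderiv₀ := hderiv 0
  have h2 := hmul 2
  have h3 := hmul 3
  have h4 := hmul 4
  push_cast at h2 h3 h4 hderiv₂ hderiv₀
  constructor
  · rintro ⟨hcube, hsq, hstep⟩
    rw [h2, h4] at hcube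
    rw [h3, hFr] at hsq
    rw [h2, hFr, hderiv, hderiv₂, hderiv₀] at hstep
    constructor <;> rw [← Complex.ofReal_inj] <;> push_cast
    · exact mul_left_cancel₀ hK (by linear_combination hcube)
    · exact mul_left_cancel₀ hK (by linear_combination hsq)
    · exact mul_left_cancel₀ (pow_ne_zero 2 hK) (by linear_combination hstep)
  · rintro ⟨hcube, hsq, hstep⟩
    rw [← Complex.ofReal_inj] at hcube hsq hstep
    push_cast at hcube hsq hstep
    constructor
    · rw [h2, h4]
      linear_combination K * hcube
    · rw [h3, hFr]
      linear_combination K * hsq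
    · rw [h2, hFr, hderiv, hderiv₂, hderiv₀]
      linear_combination K ^ 2 * hstep

end Embedding

section RealPairs

open Real
open Complex (I)

lemma I_mul_exp_ne_zero (σ : ℝ) : I * ((exp (-(π * σ / 4)) : ℝ) : ℂ) ≠ 0 :=
  mul_ne_zero Complex.I_ne_zero (Complex.ofReal_ne_zero.2 (exp_ne_zero _))

lemma solvesThetaEquations_jacobiTh_iff {σ : ℝ} (hσ : 0 < σ) {a c φ v : ℝ} :
    SolvesThetaEquations (fun z => jacobiTh z (I * σ)) a c φ v ↔
      SolvesThetaEquations (theta₁ (exp (-(π * σ)))) a c φ v :=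
  solvesThetaEquations_ofReal_iff (I_mul_exp_ne_zero σ)
    (differentiable_jacobiTh (by simpa using hσ)) (jacobiTh_ofReal σ)

variable {p : ℝ} (hp : p ∈ Ioo (0 : ℝ) 1)
include hp

lemma differentiable_theta₁ : Differentiable ℝ (theta₁ p) := by
  obtain ⟨σ, hσ, rfl⟩ := exists_eq_exp_neg_pi_mul hp
  exact differentiable_of_ofReal_eq (I_mul_exp_ne_zero σ)
    (differentiable_jacobiTh (by simpa using hσ)) (jacobiTh_ofReal σ)

lemma differentiable_theta₃ : Differentiable ℝ (theta₃ p) := by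
  obtain ⟨σ, hσ, rfl⟩ := exists_eq_exp_neg_pi_mul hp
  have hτ : 0 < (I * (σ : ℂ)).im := by simpa using hσ
  exact differentiable_of_ofReal_eq (F := fun z => jacobiTheta₂ (z / π) (I * σ)) one_ne_zero
    (fun z => DifferentiableAt.comp (g := fun w => jacobiTheta₂ w (I * σ)) z
      (differentiableAt_jacobiTheta₂_fst (z / π) hτ) (differentiableAt_id.div_const _))
    (fun x => (jacobiTheta₂_ofReal hσ x).trans (one_mul _).symm)

lemma isThreeTermPair_theta₁ : IsThreeTermPair (theta₁ p) (theta₁ p) where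
  map_zero := theta₁_zero p
  map_neg := theta₁_neg p
  differentiable_left := differentiable_theta₁ hp
  differentiable_right := differentiable_theta₁ hp
  three_term x y z w := by
    simp only [theta₁_add_mul_sub (Ioo_subset_Ico_self hp)]
    ring

lemma isThreeTermPair_theta₃ : IsThreeTermPair (theta₁ p) (theta₃ p) where
  map_zero := theta₁_zero p
  map_neg := theta₁_neg p
  differentiable_left := differentiable_theta₁ hp
  differentiable_right := differentiable_theta₃ hp
  three_term x y z w := by
    simp only [theta₁_add_mul_sub (Ioo_subset_Ico_self hp),
      theta₃_add_mul_sub (Ioo_subset_Ico_self hp)]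
    ring

lemma isThreeTermPair_theta₂ : IsThreeTermPair (theta₁ p) (theta₂ p) :=
  (isThreeTermPair_theta₁ hp).comp_add_const (π / 2)

lemma isThreeTermPair_theta₄ : IsThreeTermPair (theta₁ p) (theta₄ p) :=
  (isThreeTermPair_theta₃ hp).comp_add_const (π / 2)

lemma deriv_theta₁_zero_ne_zero : deriv (theta₁ p) 0 ≠ 0 := by
  have hpos := theta₁_pi_div_two_pos (Ioo_subset_Ico_self hp)
  obtain ⟨σ, hσ, rfl⟩ := exists_eq_exp_neg_pi_mul hp
  have hτ : 0 < (I * (σ : ℂ)).im := by simpa using hσ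
  have hderiv := deriv_ofReal_eq (I_mul_exp_ne_zero σ) (differentiable_jacobiTh hτ)
    (jacobiTh_ofReal σ) 0
  have hm : jacobiTh ((π / 2 : ℝ) : ℂ) (I * σ) ≠ 0 := by
    rw [jacobiTh_ofReal]
    exact mul_ne_zero (I_mul_exp_ne_zero σ) (Complex.ofReal_ne_zero.2 hpos.ne')
  have hne := (isThreeTermPair_jacobiTh hτ).deriv_zero_ne_zero hm
  rw [← Complex.ofReal_zero, hderiv] at hne
  exact Complex.ofReal_ne_zero.1 (right_ne_zero_of_mul hne)

end RealPairs

section Branch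

variable {𝕜 : Type*} [NontriviallyNormedField 𝕜] [CharZero 𝕜] {f g : 𝕜 → 𝕜} {a c φ v ε : 𝕜}

lemma ratioX_neg_div_two (hε : ε ≠ 0) (hg : ∀ x, g (-x) = ε * g x) :
    ratioX g c φ (-(φ / 2)) = c * (g (φ / 2) / g (3 * φ / 2)) ^ 2 := by
  rw [ratioX, show -(φ / 2) + φ = φ / 2 by ring, show -(φ / 2) - φ = -(3 * φ / 2) by ring,
    show -(φ / 2) + 2 * φ = 3 * φ / 2 by ring, hg, hg, mul_assoc ε, mul_assoc ε, mul_left_comm c,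
    mul_div_mul_left _ _ hε, mul_div_assoc, mul_div_mul_comm, sq]

lemma ratioY_neg_div_two (hε : ε ≠ 0) (hg : ∀ x, g (-x) = ε * g x) (h1 : g (φ / 2) ≠ 0) :
    ratioY g c φ (-(φ / 2)) = c * (ε * (g (3 * φ / 2) / g (5 * φ / 2))) := by
  rw [ratioY, show -(φ / 2) + φ = φ / 2 by ring, show -(φ / 2) - φ = -(3 * φ / 2) by ring,
    show -(φ / 2) - 2 * φ = -(5 * φ / 2) by ring, hg, hg, hg, mul_left_comm c,
    mul_left_comm (g _) ε, ← mul_assoc ε (g (φ / 2)) (g (5 * φ / 2)),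
    mul_div_mul_left _ _ (mul_ne_zero hε h1)]
  ring

/-- At `u = -φ/2` the terms `1/Y` and `Y + a X Y` of the step polynomial coincide. -/
theorem IsThreeTermPair.ratio_branch (h : IsThreeTermPair f g)
    (hs : SolvesThetaEquations f a c φ v) (hc : c ≠ 0) (hd : deriv f 0 ≠ 0) (hφ : f φ ≠ 0)
    (hφ2 : f (2 * φ) ≠ 0) (hε : ε ^ 2 = 1) (hg : ∀ x, g (-x) = ε * g x)
    (h1 : g (φ / 2) ≠ 0) (h3 : g (3 * φ / 2) ≠ 0) (h5 : g (5 * φ / 2) ≠ 0) :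
    v = c * (g (φ / 2) / g (3 * φ / 2)) ^ 2 + 1 / (c * (g (φ / 2) / g (3 * φ / 2)) ^ 2)
        + 2 / (c * (ε * (g (3 * φ / 2) / g (5 * φ / 2)))) ∧
      (1 + a * (c * (g (φ / 2) / g (3 * φ / 2)) ^ 2)) *
        (c * (ε * (g (3 * φ / 2) / g (5 * φ / 2)))) ^ 2 = 1 := by
  have hε0 : ε ≠ 0 := fun h0 => by simp [h0] at hε
  have hadd : -(φ / 2) + φ = φ / 2 := by ring
  have hsub : -(φ / 2) - φ = -(3 * φ / 2) := by ring
  have hadd₂ : -(φ / 2) + 2 * φ = 3 * φ / 2 := by ring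
  have hsub₂ : -(φ / 2) - 2 * φ = -(5 * φ / 2) := by ring
  have hadd₃ : -(φ / 2) + 3 * φ = 5 * φ / 2 := by ring
  have hneg {x : 𝕜} (hx : g x ≠ 0) : g (-x) ≠ 0 := hg x ▸ mul_ne_zero hε0 hx
  have hstep := h.step_ratio (u := -(φ / 2)) hs hc hd hφ hφ2 (hneg h1) (by rwa [hadd])
    (hsub ▸ hneg h3) (by rwa [hadd₂]) (hsub₂ ▸ hneg h5)
  have hprod := h.one_add_mul_ratioX (u := -(φ / 2)) hs hc hφ hφ2 (hsub ▸ hneg h3) (by rwa [hadd₂])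
  rw [ratioX_neg_div_two hε0 hg, ratioY_neg_div_two hε0 hg h1] at hstep
  rw [ratioX_neg_div_two hε0 hg, hsub, hadd₂, hsub₂, hadd₃, hg, hg, mul_assoc ε, mul_assoc ε,
    mul_left_comm _ ε, mul_div_mul_left _ _ hε0] at hprod
  have hY : c * (ε * (g (3 * φ / 2) / g (5 * φ / 2))) ≠ 0 := by positivity
  have hbranch : (1 + a * (c * (g (φ / 2) / g (3 * φ / 2)) ^ 2)) *
      (c * (ε * (g (3 * φ / 2) / g (5 * φ / 2)))) ^ 2 = 1 := by
    rw [hprod, mul_pow c, mul_pow ε, hε, div_mul_eq_mul_div, div_eq_one_iff_eq (by positivity),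
      one_mul, div_pow]
    generalize g (3 * φ / 2) = g3 at *
    field_simp
  refine ⟨?_, hbranch⟩
  generalize c * (ε * (g (3 * φ / 2) / g (5 * φ / 2))) = Y at *
  generalize c * (g (φ / 2) / g (3 * φ / 2)) ^ 2 = X at *
  have hterm : Y + a * (X * Y) = 1 / Y := by
    field_simp
    linear_combination hbranch
  linear_combination hterm - hstep

end Branch

section BranchPoints

variable {a v s e : ℝ}

/-- `e` is the first coordinate of a branch point of `X` on the curve where the step polynomial
equals `v`, namely a positive one for which the second coordinate has the sign of `s`. -/
structure IsBranch (a v s e : ℝ) : Prop where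
  pos : 0 < e
  sheet : 0 < s * (v - e - 1 / e)
  sq_eq : (v - e - 1 / e) ^ 2 = 4 * (1 + a * e)

/-- The polynomial whose roots are the first coordinates of the branch points of `X`. -/
noncomputable def branchPolynomial (a v : ℝ) : Polynomial ℝ :=
  open Polynomial in (C v * X - X ^ 2 - 1) ^ 2 - 4 * (1 + C a * X) * X ^ 2

lemma natDegree_branchPolynomial (a v : ℝ) : (branchPolynomial a v).natDegree = 4 := by
  have hexpand : branchPolynomial a v = open Polynomial in
      X ^ 4 - C (2 * v + 4 * a) * X ^ 3 + C (v ^ 2 - 2) * X ^ 2 - C (2 * v) * X + C 1 := by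
    simp only [branchPolynomial, map_add, map_sub, map_mul, map_pow, map_one, map_ofNat]
    ring
  rw [hexpand]
  compute_degree!

lemma isBranch_of_eq {Y : ℝ} (he : 0 < e) (hY : 0 < s * Y) (hv : v = e + 1 / e + 2 / Y)
    (hYe : (1 + a * e) * Y ^ 2 = 1) : IsBranch a v s e := by
  have hY0 : Y ≠ 0 := right_ne_zero_of_mul hY.ne'
  have hsub : v - e - 1 / e = 2 / Y := by linear_combination hv
  refine ⟨he, ?_, ?_⟩
  · rw [hsub, show s * (2 / Y) = 2 * (s * Y) / Y ^ 2 by field_simp]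
    positivity
  · rw [hsub, div_pow, div_eq_iff (by positivity)]
    linear_combination -4 * hYe

namespace IsBranch

lemma eval_eq_zero (h : IsBranch a v s e) : (branchPolynomial a v).eval e = 0 := by
  have hmul : (v - e - 1 / e) * e = v * e - e ^ 2 - 1 := by
    have := h.pos.ne'
    field_simp
  simp only [branchPolynomial, Polynomial.eval_sub, Polynomial.eval_add, Polynomial.eval_mul,
    Polynomial.eval_pow, Polynomial.eval_X, Polynomial.eval_C, Polynomial.eval_one,
    Polynomial.eval_ofNat]
  rw [← hmul, mul_pow, h.sq_eq, sub_self]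

lemma ne {e' : ℝ} (h : IsBranch a v (-1) e) (h' : IsBranch a v 1 e') : e ≠ e' := by
  rintro rfl
  linarith [h.sheet, h'.sheet]

lemma eq_or_eq_or {e₁ e₂ e₃ e₄ : ℝ} (h₁ : IsBranch a v (-1) e₁) (h₂ : IsBranch a v (-1) e₂)
    (h₃ : IsBranch a v 1 e₃) (h₄ : IsBranch a v 1 e₄) (h₁₂ : e₁ ≠ e₂) (h₃₄ : e₃ ≠ e₄)
    (h : IsBranch a v s e) : (e = e₁ ∨ e = e₂) ∨ e = e₃ ∨ e = e₄ := by
  have hne : branchPolynomial a v ≠ 0 := fun h0 => by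
    simpa [h0] using natDegree_branchPolynomial a v
  have hcard : ({e₁, e₂, e₃, e₄} : Finset ℝ).card = 4 := by
    rw [Finset.card_insert_of_notMem (by simp [h₁₂, h₁.ne h₃, h₁.ne h₄]),
      Finset.card_insert_of_notMem (by simp [h₂.ne h₃, h₂.ne h₄]), Finset.card_pair h₃₄]
  have hroots := Polynomial.roots_eq_of_natDegree_le_card_of_ne_zero (p := branchPolynomial a v)
    (S := {e₁, e₂, e₃, e₄}) (by
      simp only [Finset.mem_insert, Finset.mem_singleton, forall_eq_or_imp, forall_eq]
      exact ⟨h₁.eval_eq_zero, h₂.eval_eq_zero, h₃.eval_eq_zero, h₄.eval_eq_zero⟩)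
    (by rw [natDegree_branchPolynomial, hcard]) hne
  have hmem : e ∈ (branchPolynomial a v).roots := (Polynomial.mem_roots hne).2 h.eval_eq_zero
  rw [hroots, Finset.mem_val] at hmem
  simpa only [Finset.mem_insert, Finset.mem_singleton, or_assoc] using hmem

end IsBranch

section PairInvariant

variable {𝕜 : Type*} [Field 𝕜]

/-- An invariant of the two unordered pairs `{e₁, e₂}` and `{e₃, e₄}` of points of the projective
line, built from their cross-ratios. -/
def pairInvariant (e₁ e₂ e₃ e₄ : 𝕜) : 𝕜 :=
  (e₁ - e₂) ^ 2 * (e₃ - e₄) ^ 2 / ((e₁ - e₃) * (e₁ - e₄) * (e₂ - e₃) * (e₂ - e₄))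

lemma pairInvariant_swap_left (e₁ e₂ e₃ e₄ : 𝕜) :
    pairInvariant e₂ e₁ e₃ e₄ = pairInvariant e₁ e₂ e₃ e₄ := by
  rw [pairInvariant, pairInvariant]
  ring

lemma pairInvariant_swap_right (e₁ e₂ e₃ e₄ : 𝕜) :
    pairInvariant e₁ e₂ e₄ e₃ = pairInvariant e₁ e₂ e₃ e₄ := by
  rw [pairInvariant, pairInvariant]
  ring

lemma ne_and_ne_of_pairInvariant_ne_zero {e₁ e₂ e₃ e₄ : 𝕜} (h : pairInvariant e₁ e₂ e₃ e₄ ≠ 0) :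
    e₁ ≠ e₂ ∧ e₃ ≠ e₄ := by
  constructor <;> rintro rfl <;> simp [pairInvariant] at h

lemma moebius_sub_moebius {A B A' B' x y : 𝕜} (hx : A' * x + B' ≠ 0) (hy : A' * y + B' ≠ 0) :
    (A * x + B) / (A' * x + B') - (A * y + B) / (A' * y + B') =
      (A * B' - B * A') * (x - y) / ((A' * x + B') * (A' * y + B')) := by
  rw [div_sub_div _ _ hx hy]
  ring

theorem pairInvariant_moebius {A B A' B' x₁ x₂ x₃ x₄ : 𝕜} (hdet : A * B' - B * A' ≠ 0)
    (h₁ : A' * x₁ + B' ≠ 0) (h₂ : A' * x₂ + B' ≠ 0) (h₃ : A' * x₃ + B' ≠ 0)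
    (h₄ : A' * x₄ + B' ≠ 0) :
    pairInvariant ((A * x₁ + B) / (A' * x₁ + B')) ((A * x₂ + B) / (A' * x₂ + B'))
      ((A * x₃ + B) / (A' * x₃ + B')) ((A * x₄ + B) / (A' * x₄ + B')) =
      pairInvariant x₁ x₂ x₃ x₄ := by
  rw [pairInvariant, pairInvariant, moebius_sub_moebius h₁ h₂, moebius_sub_moebius h₃ h₄,
    moebius_sub_moebius h₁ h₃, moebius_sub_moebius h₁ h₄, moebius_sub_moebius h₂ h₃,
    moebius_sub_moebius h₂ h₄]
  generalize A * B' - B * A' = D at *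
  generalize A' * x₁ + B' = d₁ at *
  generalize A' * x₂ + B' = d₂ at *
  generalize A' * x₃ + B' = d₃ at *
  generalize A' * x₄ + B' = d₄ at *
  field_simp

lemma pairInvariant_neg_neg_inv {w k : 𝕜} (hw : w ≠ 0) (hk : k ≠ 0) :
    pairInvariant (-w) w (-(1 / k)) (1 / k) = (4 * (k * w) / (1 - (k * w) ^ 2)) ^ 2 := by
  rw [pairInvariant, show (-w - -(1 / k)) * (-w - 1 / k) * (w - -(1 / k)) * (w - 1 / k)
    = (1 - (k * w) ^ 2) ^ 2 / k ^ 4 by field_simp; ring]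
  field_simp
  ring

end PairInvariant

theorem IsBranch.pairInvariant_eq {e₁ e₂ e₃ e₄ f₁ f₂ f₃ f₄ : ℝ}
    (h₁ : IsBranch a v (-1) e₁) (h₂ : IsBranch a v (-1) e₂)
    (h₃ : IsBranch a v 1 e₃) (h₄ : IsBranch a v 1 e₄) (h : pairInvariant e₁ e₂ e₃ e₄ ≠ 0)
    (k₁ : IsBranch a v (-1) f₁) (k₂ : IsBranch a v (-1) f₂)
    (k₃ : IsBranch a v 1 f₃) (k₄ : IsBranch a v 1 f₄) (k : pairInvariant f₁ f₂ f₃ f₄ ≠ 0) :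
    pairInvariant f₁ f₂ f₃ f₄ = pairInvariant e₁ e₂ e₃ e₄ := by
  obtain ⟨h₁₂, h₃₄⟩ := ne_and_ne_of_pairInvariant_ne_zero h
  obtain ⟨k₁₂, k₃₄⟩ := ne_and_ne_of_pairInvariant_ne_zero k
  have hlower {f : ℝ} (k : IsBranch a v (-1) f) : f = e₁ ∨ f = e₂ :=
    (h₁.eq_or_eq_or h₂ h₃ h₄ h₁₂ h₃₄ k).resolve_right
      (by rintro (rfl | rfl); exacts [k.ne h₃ rfl, k.ne h₄ rfl])
  have hupper {f : ℝ} (k : IsBranch a v 1 f) : f = e₃ ∨ f = e₄ :=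
    (h₁.eq_or_eq_or h₂ h₃ h₄ h₁₂ h₃₄ k).resolve_left
      (by rintro (rfl | rfl); exacts [h₁.ne k rfl, h₂.ne k rfl])
  rcases hlower k₁ with rfl | rfl <;> rcases hlower k₂ with rfl | rfl <;>
    rcases hupper k₃ with rfl | rfl <;> rcases hupper k₄ with rfl | rfl <;>
    first
    | exact absurd rfl k₁₂
    | exact absurd rfl k₃₄
    | simp only [pairInvariant_swap_left, pairInvariant_swap_right]

end BranchPoints

section ThetaBranches

open Real

section CurvePoints

variable {f g : ℝ → ℝ} {a c φ v ε s : ℝ}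

lemma IsThreeTermPair.value_eq_of_even (h : IsThreeTermPair f g)
    (hs : SolvesThetaEquations f a c φ v) (hc : c ≠ 0) (hd : deriv f 0 ≠ 0) (hφ : f φ ≠ 0)
    (hφ2 : f (2 * φ) ≠ 0) (hg : ∀ x, g (-x) = g x) (h0 : g 0 ≠ 0) (h1 : g φ ≠ 0)
    (h2 : g (2 * φ) ≠ 0) :
    v = 2 * (c * g 0 / g (2 * φ)) + 2 / (c * g 0 / g (2 * φ))
      + a * (c * g 0 / g (2 * φ)) ^ 2 := by
  have hstep := h.step_ratio (u := 0) hs hc hd hφ hφ2 h0 (by simpa) (by simpa [hg]) (by simpa)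
    (by simpa [hg])
  have hX : ratioX g c φ 0 = c * g 0 / g (2 * φ) := by
    rw [ratioX, zero_add, zero_add, zero_sub, hg]
    field_simp
  have hY : ratioY g c φ 0 = c * g 0 / g (2 * φ) := by
    rw [ratioY, zero_add, zero_sub, zero_sub, hg, hg]
    field_simp
  rw [hX, hY] at hstep
  linear_combination -hstep

lemma IsThreeTermPair.isBranch (h : IsThreeTermPair f g) (hs : SolvesThetaEquations f a c φ v)
    (hc : 0 < c) (hd : deriv f 0 ≠ 0) (hφ : f φ ≠ 0) (hφ2 : f (2 * φ) ≠ 0) (hε : ε ^ 2 = 1)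
    (hg : ∀ x, g (-x) = ε * g x) (h1 : g (φ / 2) ≠ 0)
    (hsheet : 0 < s * (ε * (g (3 * φ / 2) / g (5 * φ / 2)))) :
    IsBranch a v s (c * (g (φ / 2) / g (3 * φ / 2)) ^ 2) := by
  obtain ⟨h3, h5⟩ := div_ne_zero_iff.1 (right_ne_zero_of_mul (right_ne_zero_of_mul hsheet.ne'))
  obtain ⟨hv, hcurve⟩ := h.ratio_branch hs hc.ne' hd hφ hφ2 hε hg h1 h3 h5
  refine isBranch_of_eq (by positivity) ?_ hv hcurve
  rw [mul_left_comm]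
  exact mul_pos hc hsheet

end CurvePoints

section RealSolutions

variable {a c φ v p : ℝ} (hp : p ∈ Ioo (0 : ℝ) 1) (hs : SolvesThetaEquations (theta₁ p) a c φ v)
  (hφ : φ ∈ Ioo 0 (π / 2))
include hp hs hφ

lemma SolvesThetaEquations.value_eq (hc : c ≠ 0) :
    v = 2 * (c * theta₄ p 0 / theta₄ p (2 * φ)) + 2 / (c * theta₄ p 0 / theta₄ p (2 * φ))
      + a * (c * theta₄ p 0 / theta₄ p (2 * φ)) ^ 2 := by
  have hp' := Ioo_subset_Ico_self hp
  exact (isThreeTermPair_theta₄ hp).value_eq_of_even hs hc (deriv_theta₁_zero_ne_zero hp)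
    (theta₁_pos hp' ⟨hφ.1, by linarith [hφ.2, pi_pos]⟩).ne'
    (theta₁_pos hp' ⟨by linarith [hφ.1], by linarith [hφ.2]⟩).ne' (theta₄_neg p)
    (theta₄_pos hp' _).ne' (theta₄_pos hp' _).ne' (theta₄_pos hp' _).ne'

lemma SolvesThetaEquations.scale_ne_zero : c ≠ 0 := by
  rintro rfl
  have hp' := Ioo_subset_Ico_self hp
  have hcube := hs.cube
  have hsq := hs.sq
  rw [zero_pow three_ne_zero, mul_zero, zero_mul, zero_eq_neg] at hcube
  rw [zero_pow two_ne_zero, zero_mul] at hsq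
  have hshift {x : ℝ} (h0 : theta₁ p x = 0) (hx : x - π ∈ Ioo 0 π) : False :=
    (theta₁_pos hp' hx).ne' (by rw [theta₁_sub_pi, h0, neg_zero])
  rcases lt_trichotomy (3 * φ) π with hlt | heq | hgt
  · exact (theta₁_pos hp' ⟨by linarith [hφ.1], hlt⟩).ne hsq
  · exact hshift hcube ⟨by linarith [pi_pos], by linarith [hφ.2]⟩
  · exact hshift hsq.symm ⟨by linarith, by linarith [hφ.2]⟩

lemma SolvesThetaEquations.scale_pos (hv : 0 < v) : 0 < c := by
  have hp' := Ioo_subset_Ico_self hp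
  have hc := hs.scale_ne_zero hp hφ
  have hpos (x : ℝ) : 0 < theta₄ p x := theta₄_pos hp' x
  obtain ⟨hbranch, -⟩ := (isThreeTermPair_theta₄ hp).ratio_branch (ε := 1) hs hc
    (deriv_theta₁_zero_ne_zero hp) (theta₁_pos hp' ⟨hφ.1, by linarith [hφ.2, pi_pos]⟩).ne'
    (theta₁_pos hp' ⟨by linarith [hφ.1], by linarith [hφ.2]⟩).ne' (one_pow 2)
    (fun x => by rw [theta₄_neg, one_mul]) (hpos _).ne' (hpos _).ne' (hpos _).ne'
  by_contra! hneg
  have hX : c * (theta₄ p (φ / 2) / theta₄ p (3 * φ / 2)) ^ 2 ≤ 0 :=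
    mul_nonpos_of_nonpos_of_nonneg hneg (sq_nonneg _)
  have hY : c * (1 * (theta₄ p (3 * φ / 2) / theta₄ p (5 * φ / 2))) ≤ 0 :=
    mul_nonpos_of_nonpos_of_nonneg hneg (by rw [one_mul]; exact (div_pos (hpos _) (hpos _)).le)
  exact hv.not_ge (hbranch.trans_le (add_nonpos (add_nonpos hX
    (div_nonpos_of_nonneg_of_nonpos zero_le_one hX))
    (div_nonpos_of_nonneg_of_nonpos zero_le_two hY)))

lemma SolvesThetaEquations.angle_mem (ha : 0 < a) (hv : 0 < v) : φ ∈ Ioo (π / 4) (π / 3) := by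
  have hp' := Ioo_subset_Ico_self hp
  have hc := hs.scale_pos hp hφ hv
  have h1 := theta₁_pos hp' (x := φ) ⟨hφ.1, by linarith [hφ.2, pi_pos]⟩
  have h2 := theta₁_pos hp' (x := 2 * φ) ⟨by linarith [hφ.1], by linarith [hφ.2]⟩
  have h3 : 0 < theta₁ p (3 * φ) := hs.sq ▸ by positivity
  have h4 : theta₁ p (4 * φ) < 0 := neg_pos.1 (hs.cube ▸ by positivity)
  constructor
  · by_contra! hle
    exact h4.not_ge (theta₁_nonneg hp' ⟨by linarith [hφ.1], by linarith⟩)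
  · by_contra! hle
    have h := theta₁_nonneg hp' (x := 3 * φ - π) ⟨by linarith, by linarith [hφ.2, pi_pos]⟩
    rw [theta₁_sub_pi] at h
    linarith

end RealSolutions

/-- The first coordinate of the branch point of `X` attached to the theta function `θ`, which
stands for one of `theta₁`, `theta₂`, `theta₃`, `theta₄`. -/
noncomputable def thetaBranch (θ : ℝ → ℝ → ℝ) (a p : ℝ) : ℝ :=
  thetaScale a p * (θ p (thetaAngle a p / 2) / θ p (3 * thetaAngle a p / 2)) ^ 2

/-- The Legendre modulus `ϑ₂(0)²/ϑ₃(0)²` for the nome `p²`. -/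
noncomputable def nomeModulus (p : ℝ) : ℝ := p * theta₂ (p ^ 2) 0 ^ 2 / theta₃ (p ^ 2) 0 ^ 2

lemma theta₃_mul_theta₂_three_mul_sub {p : ℝ} (hp : p ∈ Ico (0 : ℝ) 1) (φ : ℝ) :
    theta₃ (p ^ 2) φ * theta₂ (p ^ 2) (3 * φ) - theta₂ (p ^ 2) φ * theta₃ (p ^ 2) (3 * φ) =
      -(theta₁ p (2 * φ) * theta₁ p φ) := by
  have h := theta₁_add_mul_sub hp (φ / 2) (3 * φ / 2)
  rw [show φ / 2 + 3 * φ / 2 = 2 * φ by ring, show φ / 2 - 3 * φ / 2 = -φ by ring, theta₁_neg,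
    mul_div_cancel₀ _ two_ne_zero, mul_div_cancel₀ _ two_ne_zero] at h
  rw [← h, mul_neg]

lemma thetaBranch_eq_moebius {θ : ℝ → ℝ → ℝ} {a p K z : ℝ}
    (hθ : ∀ x, θ p x ^ 2 = K * (theta₃ (p ^ 2) (2 * x) * z + theta₂ (p ^ 2) (2 * x)))
    (h3 : θ p (3 * thetaAngle a p / 2) ≠ 0) :
    theta₃ (p ^ 2) (3 * thetaAngle a p) * z + theta₂ (p ^ 2) (3 * thetaAngle a p) ≠ 0 ∧
      thetaBranch θ a p =
        (thetaScale a p * theta₃ (p ^ 2) (thetaAngle a p) * z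
          + thetaScale a p * theta₂ (p ^ 2) (thetaAngle a p)) /
        (theta₃ (p ^ 2) (3 * thetaAngle a p) * z + theta₂ (p ^ 2) (3 * thetaAngle a p)) := by
  have hden := hθ (3 * thetaAngle a p / 2)
  rw [mul_div_cancel₀ _ two_ne_zero] at hden
  have hK := hden ▸ pow_ne_zero 2 h3
  refine ⟨right_ne_zero_of_mul hK, ?_⟩
  rw [thetaBranch, div_pow, hden, hθ, mul_div_cancel₀ _ two_ne_zero,
    mul_div_mul_left _ _ (left_ne_zero_of_mul hK)]
  ring

section CanonicalSolution

variable {a p : ℝ} (ha : 0 < a) (hp : p ∈ Ioo (0 : ℝ) 1)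

include hp in
lemma nomeModulus_mem : nomeModulus p ∈ Ioo (0 : ℝ) 1 := by
  have hp' := Ioo_subset_Ico_self hp
  have h2 : 0 < theta₂ (p ^ 2) 0 := theta₂_pos (sq_mem_Ico hp') ⟨by linarith [pi_pos],
    by linarith [pi_pos]⟩
  have h3 := theta₃_pos (sq_mem_Ico hp') 0
  have hp0 := hp.1
  have h4 : 0 < theta₄ p 0 ^ 2 := pow_pos (theta₄_pos hp' 0) 2
  rw [theta₄_sq hp', mul_zero] at h4
  refine ⟨by rw [nomeModulus]; positivity, ?_⟩
  rw [nomeModulus, div_lt_one (by positivity)]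
  linarith

include ha hp

lemma solvesThetaEquations_stepValue :
    SolvesThetaEquations (theta₁ p) a (thetaScale a p) (thetaAngle a p) (stepValue a p) := by
  have hp' := Ioo_subset_Ico_self hp
  have hc := thetaScale_pos ha hp'
  obtain ⟨h1, -, -, -⟩ := theta₁_thetaAngle_signs ha hp'
  obtain ⟨hlt, hgt⟩ := (thetaAngle_spec ha hp').1
  have hd := deriv_theta₁_zero_ne_zero hp
  have hsolves : SolvesThetaEquations (theta₁ p) a (thetaScale a p) (thetaAngle a p)
      ((4 * deriv (theta₁ p) (thetaAngle a p) * theta₁ p (2 * thetaAngle a p)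
        - 2 * deriv (theta₁ p) (2 * thetaAngle a p) * theta₁ p (thetaAngle a p))
        / (thetaScale a p * (deriv (theta₁ p) 0 * theta₁ p (thetaAngle a p)))) :=
    ⟨thetaScale_cube ha hp', thetaScale_sq ha hp', by field_simp⟩
  rwa [hsolves.value_eq hp ⟨by linarith [pi_pos], by linarith [pi_pos]⟩ hc.ne'] at hsolves

lemma isBranch_thetaBranch {θ : ℝ → ℝ → ℝ} {ε s : ℝ} (h : IsThreeTermPair (theta₁ p) (θ p))
    (hε : ε ^ 2 = 1) (hθ : ∀ x, θ p (-x) = ε * θ p x) (h1 : θ p (thetaAngle a p / 2) ≠ 0)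
    (hsheet : 0 < s * (ε * (θ p (3 * thetaAngle a p / 2) / θ p (5 * thetaAngle a p / 2)))) :
    IsBranch a (stepValue a p) s (thetaBranch θ a p) :=
  have hsigns := theta₁_thetaAngle_signs ha (Ioo_subset_Ico_self hp)
  h.isBranch (solvesThetaEquations_stepValue ha hp) (thetaScale_pos ha (Ioo_subset_Ico_self hp))
    (deriv_theta₁_zero_ne_zero hp) hsigns.1.ne' hsigns.2.1.ne' hε hθ h1 hsheet

lemma isBranch_thetaBranch_theta₁ : IsBranch a (stepValue a p) (-1) (thetaBranch theta₁ a p) := by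
  obtain ⟨hlt, hgt⟩ := (thetaAngle_spec ha (Ioo_subset_Ico_self hp)).1
  have hpos {x : ℝ} (h0 : 0 < x) (hπ : x < π) : 0 < theta₁ p x :=
    theta₁_pos (Ioo_subset_Ico_self hp) ⟨h0, hπ⟩
  refine isBranch_thetaBranch ha hp (isThreeTermPair_theta₁ hp) (ε := -1) (by norm_num)
    (fun x => by rw [theta₁_neg, neg_one_mul]) (hpos (by linarith [pi_pos]) (by linarith)).ne' ?_
  rw [neg_one_mul, neg_one_mul, neg_neg]
  exact div_pos (hpos (by linarith [pi_pos]) (by linarith))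
    (hpos (by linarith [pi_pos]) (by linarith))

lemma isBranch_thetaBranch_theta₂ : IsBranch a (stepValue a p) (-1) (thetaBranch theta₂ a p) := by
  obtain ⟨hlt, hgt⟩ := (thetaAngle_spec ha (Ioo_subset_Ico_self hp)).1
  have hpos {x : ℝ} (h0 : -(π / 2) < x) (hπ : x < π / 2) : 0 < theta₂ p x :=
    theta₂_pos (Ioo_subset_Ico_self hp) ⟨h0, hπ⟩
  have h5 : theta₂ p (5 * thetaAngle a p / 2) < 0 := by
    rw [← neg_pos, ← theta₂_neg, ← theta₂_add_pi]
    exact hpos (by linarith) (by linarith)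
  refine isBranch_thetaBranch ha hp (isThreeTermPair_theta₂ hp) (ε := 1) (by norm_num)
    (fun x => by rw [theta₂_neg, one_mul])
    (hpos (by linarith [pi_pos]) (by linarith [pi_pos])).ne' ?_
  rw [one_mul, neg_one_mul, neg_pos]
  exact div_neg_of_pos_of_neg (hpos (by linarith [pi_pos]) (by linarith)) h5

lemma isBranch_thetaBranch_theta₃ : IsBranch a (stepValue a p) 1 (thetaBranch theta₃ a p) := by
  have hpos (x : ℝ) : 0 < theta₃ p x := theta₃_pos (Ioo_subset_Ico_self hp) x
  refine isBranch_thetaBranch ha hp (isThreeTermPair_theta₃ hp) (ε := 1) (by norm_num)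
    (fun x => by rw [theta₃_neg, one_mul]) (hpos _).ne' ?_
  rw [one_mul, one_mul]
  exact div_pos (hpos _) (hpos _)

lemma isBranch_thetaBranch_theta₄ : IsBranch a (stepValue a p) 1 (thetaBranch theta₄ a p) := by
  have hpos (x : ℝ) : 0 < theta₄ p x := theta₄_pos (Ioo_subset_Ico_self hp) x
  refine isBranch_thetaBranch ha hp (isThreeTermPair_theta₄ hp) (ε := 1) (by norm_num)
    (fun x => by rw [theta₄_neg, one_mul]) (hpos _).ne' ?_
  rw [one_mul, one_mul]
  exact div_pos (hpos _) (hpos _)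

/-- The squares of the four theta functions are values of one linear function, hence the branch
points are the images of four explicit points under one Möbius transformation. -/
theorem pairInvariant_thetaBranch :
    pairInvariant (thetaBranch theta₁ a p) (thetaBranch theta₂ a p) (thetaBranch theta₄ a p)
      (thetaBranch theta₃ a p) = (4 * nomeModulus p / (1 - nomeModulus p ^ 2)) ^ 2 := by
  have hp' := Ioo_subset_Ico_self hp
  have hp0 := hp.1
  obtain ⟨hφ1, hφ2, -, -⟩ := theta₁_thetaAngle_signs ha hp'
  obtain ⟨hlt, hgt⟩ := (thetaAngle_spec ha hp').1
  have hc := thetaScale_pos ha hp'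
  have hα := theta₃_pos (sq_mem_Ico hp') 0
  have hβ : 0 < theta₂ (p ^ 2) 0 := theta₂_pos (sq_mem_Ico hp') ⟨by linarith [pi_pos],
    by linarith [pi_pos]⟩
  have hdet : thetaScale a p * theta₃ (p ^ 2) (thetaAngle a p)
      * theta₂ (p ^ 2) (3 * thetaAngle a p) - thetaScale a p * theta₂ (p ^ 2) (thetaAngle a p)
        * theta₃ (p ^ 2) (3 * thetaAngle a p) ≠ 0 := by
    rw [mul_assoc, mul_assoc, ← mul_sub, theta₃_mul_theta₂_three_mul_sub hp']
    exact mul_ne_zero hc.ne' (neg_ne_zero.2 (mul_pos hφ2 hφ1).ne')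
  set α := theta₃ (p ^ 2) 0
  set β := theta₂ (p ^ 2) 0
  obtain ⟨hd₁, h₁⟩ := thetaBranch_eq_moebius (θ := theta₁) (a := a) (K := -α) (z := -(β / α))
    (fun x => by rw [theta₁_sq hp']; field_simp; ring)
    (theta₁_pos hp' ⟨by linarith [pi_pos], by linarith⟩).ne'
  obtain ⟨hd₂, h₂⟩ := thetaBranch_eq_moebius (θ := theta₂) (a := a) (K := α) (z := β / α)
    (fun x => by rw [theta₂_sq hp']; field_simp; ring)
    (theta₂_pos hp' ⟨by linarith [pi_pos], by linarith⟩).ne'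
  obtain ⟨hd₃, h₃⟩ := thetaBranch_eq_moebius (θ := theta₃) (a := a) (K := p * β)
    (z := 1 / (p * β / α)) (fun x => by rw [theta₃_sq hp']; field_simp; ring)
    (theta₃_pos hp' _).ne'
  obtain ⟨hd₄, h₄⟩ := thetaBranch_eq_moebius (θ := theta₄) (a := a) (K := -(p * β))
    (z := -(1 / (p * β / α))) (fun x => by rw [theta₄_sq hp']; field_simp; ring)
    (theta₄_pos hp' _).ne'
  rw [h₁, h₂, h₃, h₄, pairInvariant_moebius hdet hd₁ hd₂ hd₄ hd₃,
    pairInvariant_neg_neg_inv (by positivity) (by positivity), nomeModulus,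
    show p * β / α * (β / α) = p * β ^ 2 / α ^ 2 by ring]

end CanonicalSolution

end ThetaBranches

section NomeUniqueness

/-- Landen's transformation. -/
lemma nomeModulus_sq {p : ℝ} (hp : p ∈ Ioo (0 : ℝ) 1) :
    nomeModulus p ^ 2 * (1 + nomeModulus (p ^ 2)) ^ 2 = 4 * nomeModulus (p ^ 2) := by
  have hq := sq_mem_Ico (Ioo_subset_Ico_self hp)
  have h2 := theta₂_sq hq 0
  have h3 := theta₃_sq hq 0
  have hA := theta₃_pos (sq_mem_Ico hq) 0
  have hα := pow_pos (theta₃_pos hq 0) 2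
  rw [mul_zero] at h2 h3
  rw [h3] at hα
  rw [nomeModulus, nomeModulus, h2, h3]
  generalize theta₃ ((p ^ 2) ^ 2) 0 = A at *
  generalize theta₂ ((p ^ 2) ^ 2) 0 = B at *
  field_simp
  ring

lemma tendsto_nomeModulus_div :
    Tendsto (fun p => nomeModulus p / p) (𝓝[>] 0) (𝓝 4) := by
  have h0 : (0 : ℝ) ∈ Ico (0 : ℝ) 1 := ⟨le_rfl, one_pos⟩
  have hsq : Tendsto (fun p : ℝ => p ^ 2) (𝓝[>] 0) (𝓝[Ico 0 1] 0) := by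
    refine tendsto_nhdsWithin_iff.2 ⟨?_, ?_⟩
    · exact tendsto_nhdsWithin_of_tendsto_nhds
        (by simpa using (continuous_pow (M := ℝ) 2).tendsto 0)
    · filter_upwards [Ioo_mem_nhdsGT one_pos] with p hp
      exact sq_mem_Ico (Ioo_subset_Ico_self hp)
  have h2 : Tendsto (fun p => theta₂ (p ^ 2) 0) (𝓝[>] 0) (𝓝 (theta₂ 0 0)) :=
    ((continuousOn_theta₁_comp continuousOn_id continuousOn_const fun _ hp => hp) 0 h0).tendsto.comp
      hsq
  have h3 : Tendsto (fun p => theta₃ (p ^ 2) 0) (𝓝[>] 0) (𝓝 (theta₃ 0 0)) :=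
    (continuousOn_theta₃.comp (continuousOn_id.prodMk continuousOn_const)
      (fun _ hp => ⟨hp, mem_univ _⟩) 0 h0).tendsto.comp hsq
  have hlim := (h2.pow 2).div (h3.pow 2) (by norm_num [theta₃_nome_zero])
  rw [theta₂_nome_zero, theta₃_nome_zero, Real.cos_zero, mul_one, one_pow, div_one,
    show (2 : ℝ) ^ 2 = 4 by norm_num] at hlim
  refine hlim.congr' ?_
  filter_upwards [self_mem_nhdsWithin] with p hp
  rw [nomeModulus, mul_div_assoc, mul_div_cancel_left₀ _ (mem_Ioi.1 hp).ne']
  rfl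

lemma sq_mem_Ioo {p : ℝ} (hp : p ∈ Ioo (0 : ℝ) 1) : p ^ 2 ∈ Ioo (0 : ℝ) 1 :=
  ⟨pow_pos hp.1 2, pow_lt_one₀ hp.1.le hp.2 two_ne_zero⟩

lemma nomeModulus_sq_eq_of_eq {p r : ℝ} (hp : p ∈ Ioo (0 : ℝ) 1) (hr : r ∈ Ioo (0 : ℝ) 1)
    (h : nomeModulus p = nomeModulus r) : nomeModulus (p ^ 2) = nomeModulus (r ^ 2) := by
  have hx := nomeModulus_mem (sq_mem_Ioo hp)
  have hy := nomeModulus_mem (sq_mem_Ioo hr)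
  have hlt : nomeModulus (p ^ 2) * nomeModulus (r ^ 2) < 1 :=
    mul_lt_one_of_nonneg_of_lt_one_left hx.1.le hx.2 hy.2.le
  have hfactor : (nomeModulus (p ^ 2) - nomeModulus (r ^ 2)) *
      (nomeModulus r ^ 2 * (1 - nomeModulus (p ^ 2) * nomeModulus (r ^ 2))) = 0 := by
    have hpL := nomeModulus_sq hp
    rw [h] at hpL
    linear_combination nomeModulus (p ^ 2) * nomeModulus_sq hr - nomeModulus (r ^ 2) * hpL
  exact sub_eq_zero.1 ((mul_eq_zero.1 hfactor).resolve_right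
    (mul_pos (pow_pos (nomeModulus_mem hr).1 2) (sub_pos.2 hlt)).ne')

lemma pow_two_pow_mem_Ioo {p : ℝ} (hp : p ∈ Ioo (0 : ℝ) 1) (n : ℕ) : p ^ 2 ^ n ∈ Ioo (0 : ℝ) 1 :=
  ⟨pow_pos hp.1 _, pow_lt_one₀ hp.1.le hp.2 (by positivity)⟩

lemma nomeModulus_pow_two_pow_eq_of_eq {p r : ℝ} (hp : p ∈ Ioo (0 : ℝ) 1)
    (hr : r ∈ Ioo (0 : ℝ) 1) (h : nomeModulus p = nomeModulus r) (n : ℕ) :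
    nomeModulus (p ^ 2 ^ n) = nomeModulus (r ^ 2 ^ n) := by
  induction n with
  | zero => simpa only [pow_zero, pow_one] using h
  | succ n ih =>
    rw [pow_succ, pow_mul, pow_mul]
    exact nomeModulus_sq_eq_of_eq (pow_two_pow_mem_Ioo hp n) (pow_two_pow_mem_Ioo hr n) ih

lemma tendsto_pow_two_pow {p : ℝ} (hp : p ∈ Ioo (0 : ℝ) 1) :
    Tendsto (fun n : ℕ => p ^ 2 ^ n) atTop (𝓝[>] 0) :=
  tendsto_nhdsWithin_iff.2 ⟨(tendsto_pow_atTop_nhds_zero_of_lt_one hp.1.le hp.2).comp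
    (tendsto_pow_atTop_atTop_of_one_lt one_lt_two),
    Eventually.of_forall fun n => (pow_two_pow_mem_Ioo hp n).1⟩

theorem nomeModulus_injOn : InjOn nomeModulus (Ioo 0 1) := by
  intro p hp r hr h
  wlog hpr : p < r generalizing p r
  · exact (not_lt.1 hpr).eq_or_lt.elim Eq.symm fun hlt => (this hr hp h.symm hlt).symm
  have hratio : p / r ∈ Ioo (0 : ℝ) 1 := ⟨div_pos hp.1 hr.1, (div_lt_one hr.1).2 hpr⟩
  have hlim := (tendsto_nomeModulus_div.comp (tendsto_pow_two_pow hp)).mul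
    (tendsto_nhds_of_tendsto_nhdsWithin (tendsto_pow_two_pow hratio))
  have hterm (n : ℕ) : nomeModulus (p ^ 2 ^ n) / p ^ 2 ^ n * (p / r) ^ 2 ^ n =
      nomeModulus (r ^ 2 ^ n) / r ^ 2 ^ n := by
    rw [nomeModulus_pow_two_pow_eq_of_eq hp hr h, div_pow,
      div_mul_div_cancel₀ (pow_two_pow_mem_Ioo hp n).1.ne']
  have h40 := tendsto_nhds_unique (tendsto_nomeModulus_div.comp (tendsto_pow_two_pow hr))
    (hlim.congr hterm)
  norm_num at h40

theorem stepValue_injOn {a : ℝ} (ha : 0 < a) : InjOn (stepValue a) (Ioo 0 1) := by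
  intro p hp r hr h
  have hden {p : ℝ} (hp : p ∈ Ioo (0 : ℝ) 1) : 0 < 1 - nomeModulus p ^ 2 :=
    sub_pos.2 (pow_lt_one₀ (nomeModulus_mem hp).1.le (nomeModulus_mem hp).2 two_ne_zero)
  have hpos {p : ℝ} (hp : p ∈ Ioo (0 : ℝ) 1) : 0 < 4 * nomeModulus p / (1 - nomeModulus p ^ 2) :=
    div_pos (mul_pos four_pos (nomeModulus_mem hp).1) (hden hp)
  have hne {p : ℝ} (hp : p ∈ Ioo (0 : ℝ) 1) := pairInvariant_thetaBranch ha hp ▸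
    pow_ne_zero 2 (hpos hp).ne'
  have hinv := (h ▸ isBranch_thetaBranch_theta₁ ha hp).pairInvariant_eq
    (h ▸ isBranch_thetaBranch_theta₂ ha hp) (h ▸ isBranch_thetaBranch_theta₄ ha hp)
    (h ▸ isBranch_thetaBranch_theta₃ ha hp) (hne hp) (isBranch_thetaBranch_theta₁ ha hr)
    (isBranch_thetaBranch_theta₂ ha hr) (isBranch_thetaBranch_theta₄ ha hr)
    (isBranch_thetaBranch_theta₃ ha hr) (hne hr)
  rw [pairInvariant_thetaBranch ha hp, pairInvariant_thetaBranch ha hr,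
    pow_left_inj₀ (hpos hr).le (hpos hp).le two_ne_zero,
    div_eq_div_iff (hden hr).ne' (hden hp).ne'] at hinv
  have hfactor : (nomeModulus p - nomeModulus r) * (1 + nomeModulus p * nomeModulus r) = 0 := by
    linear_combination -hinv / 4
  have hp0 := (nomeModulus_mem hp).1
  have hr0 := (nomeModulus_mem hr).1
  exact nomeModulus_injOn hp hr (sub_eq_zero.1 ((mul_eq_zero.1 hfactor).resolve_right
    (by positivity)))

end NomeUniqueness

section Walks

variable {a x : ℝ}

/-- The transfer operator `f ↦ (step polynomial) · f` of the walk, conjugated by `x ^ (i + j)`: it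
acts on functions on `ℤ²` as though the steps had weights `x`, `x⁻¹` and `a x²`. -/
noncomputable def tiltedStep (a x : ℝ) (f : ℤ → ℤ → ℝ) (i j : ℤ) : ℝ :=
  x * f (i - 1) j + x⁻¹ * f (i + 1) j + x * f i (j - 1) + x⁻¹ * f i (j + 1)
    + a * x ^ 2 * f (i - 1) (j - 1)

/-- The weighted number of quadrant walks from the origin to `(i, j)`, tilted by `x ^ (i + j)`. -/
noncomputable def tiltedWalks (a x : ℝ) (n : ℕ) (i j : ℤ) : ℝ :=
  quadrantWalks a n i j * x ^ (i + j)

lemma quadrantWalks_succ (a : ℝ) (n : ℕ) {i j : ℤ} (hi : 0 ≤ i) (hj : 0 ≤ j) :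
    quadrantWalks a (n + 1) i j = quadrantWalks a n (i - 1) j + quadrantWalks a n (i + 1) j
      + quadrantWalks a n i (j - 1) + quadrantWalks a n i (j + 1)
      + a * quadrantWalks a n (i - 1) (j - 1) := by
  rw [quadrantWalks, if_pos ⟨hi, hj⟩]

lemma tiltedWalks_succ (hx : x ≠ 0) (n : ℕ) {i j : ℤ} (hi : 0 ≤ i) (hj : 0 ≤ j) :
    tiltedWalks a x (n + 1) i j = tiltedStep a x (tiltedWalks a x n) i j := by
  simp only [tiltedStep, tiltedWalks, quadrantWalks_succ a n hi hj, zpow_add₀ hx, zpow_sub₀ hx,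
    zpow_one]
  field_simp

lemma tiltedStep_const (a x v : ℝ) (i j : ℤ) :
    tiltedStep a x (fun _ _ => v) i j = v * diagonalStep a x := by
  rw [tiltedStep, diagonalStep, div_eq_mul_inv]
  ring

lemma tiltedStep_const_mul (a x v : ℝ) (f : ℤ → ℤ → ℝ) (i j : ℤ) :
    tiltedStep a x (fun i j => v * f i j) i j = v * tiltedStep a x f i j := by
  rw [tiltedStep, tiltedStep]
  ring

lemma tiltedStep_mono (ha : 0 ≤ a) (hx : 0 ≤ x) {f g : ℤ → ℤ → ℝ} (h : ∀ i j, f i j ≤ g i j)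
    (i j : ℤ) : tiltedStep a x f i j ≤ tiltedStep a x g i j := by
  unfold tiltedStep
  gcongr <;> apply h

section Counting

variable (ha : 0 ≤ a)
include ha

lemma quadrantWalks_nonneg (n : ℕ) (i j : ℤ) : 0 ≤ quadrantWalks a n i j := by
  induction n generalizing i j with
  | zero =>
    rw [quadrantWalks]
    split_ifs <;> norm_num
  | succ n ih =>
    rw [quadrantWalks]
    split_ifs
    · linarith [ih (i - 1) j, ih (i + 1) j, ih i (j - 1), ih i (j + 1),
        mul_nonneg ha (ih (i - 1) (j - 1))]
    · exact le_rfl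

lemma tiltedWalks_nonneg (hx : 0 ≤ x) (n : ℕ) (i j : ℤ) : 0 ≤ tiltedWalks a x n i j :=
  mul_nonneg (quadrantWalks_nonneg ha n i j) (zpow_nonneg hx _)

lemma tiltedWalks_le_pow (hx : 0 < x) (n : ℕ) (i j : ℤ) :
    tiltedWalks a x n i j ≤ diagonalStep a x ^ n := by
  induction n generalizing i j with
  | zero =>
    rw [tiltedWalks, quadrantWalks]
    split_ifs with h
    · simp [h.1, h.2]
    · simp
  | succ n ih =>
    by_cases h : 0 ≤ i ∧ 0 ≤ j
    · rw [tiltedWalks_succ hx.ne' n h.1 h.2, pow_succ, ← tiltedStep_const a x _ i j]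
      exact tiltedStep_mono ha hx.le ih i j
    · rw [tiltedWalks, quadrantWalks, if_neg h, zero_mul]
      exact pow_nonneg (diagonalStep_pos ha hx).le _

lemma quadrantWalks_zero_zero_le_pow (hx : 0 < x) (n : ℕ) :
    quadrantWalks a n 0 0 ≤ diagonalStep a x ^ n := by
  simpa [tiltedWalks] using tiltedWalks_le_pow ha hx n 0 0

lemma quadrantWalks_le_quadrantWalks_succ {i j k l : ℤ} (n : ℕ) (hi : 0 ≤ i) (hj : 0 ≤ j)
    (h : k = i ∧ |l - j| = 1 ∨ |k - i| = 1 ∧ l = j) :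
    quadrantWalks a n k l ≤ quadrantWalks a (n + 1) i j := by
  have hq (k l : ℤ) := quadrantWalks_nonneg ha n k l
  have hNE := mul_nonneg ha (hq (i - 1) (j - 1))
  rw [quadrantWalks_succ a n hi hj]
  have hW := hq (i - 1) j
  have hE := hq (i + 1) j
  have hS := hq i (j - 1)
  have hN := hq i (j + 1)
  rcases h with ⟨rfl, h⟩ | ⟨h, rfl⟩ <;> rcases (abs_eq zero_le_one).1 h with h | h
  · rw [eq_add_of_sub_eq' h]
    linarith
  · rw [eq_add_of_sub_eq' h, ← sub_eq_add_neg]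
    linarith
  · rw [eq_add_of_sub_eq' h]
    linarith
  · rw [eq_add_of_sub_eq' h, ← sub_eq_add_neg]
    linarith

lemma quadrantWalks_le_quadrantWalks_zero_zero (n i j : ℕ) :
    quadrantWalks a n i j ≤ quadrantWalks a (n + i + j) 0 0 := by
  induction i generalizing n with
  | zero =>
    induction j generalizing n with
    | zero => simp
    | succ j ih =>
      refine (quadrantWalks_le_quadrantWalks_succ ha n (Int.natCast_nonneg 0)
        (Int.natCast_nonneg j) (.inl ⟨rfl, by simp⟩)).trans ((ih (n + 1)).trans_eq ?_)
      congr 1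
      ring
  | succ i ih =>
    refine (quadrantWalks_le_quadrantWalks_succ ha n (Int.natCast_nonneg i)
      (Int.natCast_nonneg j) (.inr ⟨by simp, rfl⟩)).trans ((ih (n + 1)).trans_eq ?_)
    congr 1
    ring

lemma one_le_quadrantWalks (i j : ℕ) : 1 ≤ quadrantWalks a (i + j) i j := by
  induction i with
  | zero =>
    induction j with
    | zero => simp [quadrantWalks]
    | succ j ih =>
      exact ih.trans (quadrantWalks_le_quadrantWalks_succ ha _ (Int.natCast_nonneg _)
        (Int.natCast_nonneg _) (.inl ⟨rfl, by simp⟩))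
  | succ i ih =>
    rw [Nat.add_right_comm]
    exact ih.trans (quadrantWalks_le_quadrantWalks_succ ha _ (Int.natCast_nonneg _)
      (Int.natCast_nonneg _) (.inr ⟨by simp, rfl⟩))

end Counting

/-- A concave function on the plane that is positive exactly on the open disc of radius `R` centred
at `(R, R)`, which touches the boundary of the quadrant. -/
def paraboloid (R s t : ℝ) : ℝ := R ^ 2 - (s - R) ^ 2 - (t - R) ^ 2

/-- The positive part of `paraboloid R`, on the lattice. For `x` minimising the step polynomial on
the diagonal the tilted walk has no drift, so that for large `R` this function is almost a
subsolution of the eigenvalue equation of the tilted step operator. -/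
def discBump (R : ℝ) (i j : ℤ) : ℝ := max (paraboloid R i j) 0

lemma discBump_nonneg (R : ℝ) (i j : ℤ) : 0 ≤ discBump R i j := le_max_right _ _

lemma paraboloid_le_discBump (R : ℝ) (i j : ℤ) : paraboloid R i j ≤ discBump R i j :=
  le_max_left _ _

lemma paraboloid_pos_of_discBump_pos {R : ℝ} {i j : ℤ} (h : 0 < discBump R i j) :
    0 < paraboloid R i j := (lt_max_iff.1 h).resolve_right (lt_irrefl _)

lemma discBump_of_pos {R : ℝ} {i j : ℤ} (h : 0 < discBump R i j) :
    discBump R i j = paraboloid R i j :=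
  max_eq_left (paraboloid_pos_of_discBump_pos h).le

lemma discBump_le_sq (R : ℝ) (i j : ℤ) : discBump R i j ≤ R ^ 2 := by
  refine max_le ?_ (sq_nonneg R)
  rw [paraboloid]
  linarith [sq_nonneg ((i : ℝ) - R), sq_nonneg ((j : ℝ) - R)]

lemma mem_Icc_of_discBump_pos {R : ℕ} {i j : ℤ} (h : 0 < discBump R i j) :
    i ∈ Icc 0 (2 * R : ℤ) ∧ j ∈ Icc 0 (2 * R : ℤ) := by
  have hpos := paraboloid_pos_of_discBump_pos h
  rw [paraboloid] at hpos
  have hR : (0 : ℝ) ≤ R := by positivity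
  have hi := abs_lt.1 (abs_lt_of_sq_lt_sq (by linarith [sq_nonneg ((j : ℝ) - R)] :
    ((i : ℝ) - R) ^ 2 < (R : ℝ) ^ 2) hR)
  have hj := abs_lt.1 (abs_lt_of_sq_lt_sq (by linarith [sq_nonneg ((i : ℝ) - R)] :
    ((j : ℝ) - R) ^ 2 < (R : ℝ) ^ 2) hR)
  refine ⟨⟨?_, ?_⟩, ?_, ?_⟩ <;> rify <;> linarith

lemma inv_eq_of_critical (hx : x ≠ 0) (h : a * x ^ 3 + x ^ 2 = 1) : x⁻¹ = x + a * x ^ 2 := by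
  rw [inv_eq_one_div, div_eq_iff hx]
  linarith

lemma le_one_of_critical (ha : 0 ≤ a) (hx : 0 ≤ x) (h : a * x ^ 3 + x ^ 2 = 1) : x ≤ 1 := by
  nlinarith [mul_nonneg ha (pow_nonneg hx 3)]

lemma tiltedStep_paraboloid (hx : x ≠ 0) (h : a * x ^ 3 + x ^ 2 = 1) (R : ℝ) (i j : ℤ) :
    tiltedStep a x (fun i j => paraboloid R i j) i j
      = diagonalStep a x * paraboloid R i j - (2 * x + 2 / x + 2 * a * x ^ 2) := by
  simp only [tiltedStep, diagonalStep, paraboloid, div_eq_mul_inv, inv_eq_of_critical hx h]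
  push_cast
  ring

lemma le_tiltedStep_discBump_of_large (ha : 0 ≤ a) (hx : 0 < x) (h : a * x ^ 3 + x ^ 2 = 1)
    {l R : ℝ} {i j : ℤ} (hG : 2 * x + 2 / x + 2 * a * x ^ 2
      ≤ (diagonalStep a x - l) * paraboloid R i j) :
    l * paraboloid R i j ≤ tiltedStep a x (discBump R) i j := by
  have hstep := tiltedStep_mono ha hx.le (paraboloid_le_discBump R) i j
  rw [tiltedStep_paraboloid hx.ne' h] at hstep
  linarith

/-- Near the rim of the disc, a lattice step towards its centre raises the paraboloid by about
`R`. -/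
lemma exists_neighbour_paraboloid_ge {R s t : ℝ} (hR : 2 < R) (hpos : 0 < paraboloid R s t)
    (hlt : paraboloid R s t < R) :
    R - 1 ≤ paraboloid R (s - 1) t ∨ R - 1 ≤ paraboloid R (s + 1) t ∨
      R - 1 ≤ paraboloid R s (t - 1) ∨ R - 1 ≤ paraboloid R s (t + 1) := by
  by_contra! hcon
  obtain ⟨hW, hE, hS, hN⟩ := hcon
  simp only [paraboloid] at hW hE hS hN hpos hlt
  nlinarith [sq_nonneg (s - R), sq_nonneg (t - R)]

lemma le_tiltedStep_discBump_of_small (ha : 0 ≤ a) (hx : 0 < x) (hx1 : x ≤ 1) {R : ℝ} (hR : 2 < R)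
    {i j : ℤ} (hpos : 0 < paraboloid R i j) (hlt : paraboloid R i j < R) :
    x * (R - 1) ≤ tiltedStep a x (discBump R) i j := by
  have hn (i j : ℤ) := discBump_nonneg R i j
  have hF (i j : ℤ) := paraboloid_le_discBump R i j
  have hxx : x ≤ x⁻¹ := hx1.trans ((one_le_inv₀ hx).2 hx1)
  have hNE := mul_nonneg (mul_nonneg ha (sq_nonneg x)) (hn (i - 1) (j - 1))
  have hW := mul_nonneg hx.le (hn (i - 1) j)
  have hE := mul_nonneg (inv_pos.2 hx).le (hn (i + 1) j)
  have hS := mul_nonneg hx.le (hn i (j - 1))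
  have hN := mul_nonneg (inv_pos.2 hx).le (hn i (j + 1))
  have hup {y : ℝ} (hy : R - 1 ≤ y) : x * (R - 1) ≤ x * y := by gcongr
  have hdown {y : ℝ} (hy : R - 1 ≤ y) : x * (R - 1) ≤ x⁻¹ * y :=
    mul_le_mul hxx hy (by linarith) (inv_pos.2 hx).le
  rw [tiltedStep]
  rcases exists_neighbour_paraboloid_ge hR hpos hlt with h | h | h | h
  · linarith [hup (h.trans (by exact_mod_cast hF (i - 1) j))]
  · linarith [hdown (h.trans (by exact_mod_cast hF (i + 1) j))]
  · linarith [hup (h.trans (by exact_mod_cast hF i (j - 1)))]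
  · linarith [hdown (h.trans (by exact_mod_cast hF i (j + 1)))]

lemma exists_mul_discBump_le_tiltedStep (ha : 0 ≤ a) (hx : 0 < x) (h : a * x ^ 3 + x ^ 2 = 1)
    {l : ℝ} (hl0 : 0 < l) (hl : l < diagonalStep a x) :
    ∃ R : ℕ, 0 < R ∧ ∀ i j, 0 < discBump R i j →
      l * discBump R i j ≤ tiltedStep a x (discBump R) i j := by
  have hx1 := le_one_of_critical ha hx.le h
  set B := (2 * x + 2 / x + 2 * a * x ^ 2) / (diagonalStep a x - l) with hB
  have hB0 : 0 < B := div_pos (by positivity) (by linarith)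
  have hlB : 0 < l * B / x := by positivity
  obtain ⟨R, hR⟩ := exists_nat_gt (B + l * B / x + 2)
  have hR0 : (0 : ℝ) < R := by linarith
  refine ⟨R, by exact_mod_cast hR0, fun i j hij => ?_⟩
  rw [discBump_of_pos hij]
  rcases le_or_gt B (paraboloid R i j) with hbig | hsmall
  · rw [hB, div_le_iff₀' (by linarith)] at hbig
    exact le_tiltedStep_discBump_of_large ha hx h hbig
  · calc l * paraboloid R i j ≤ l * B := by gcongr
      _ ≤ x * (R - 1) := by rw [← div_le_iff₀' hx]; linarith
      _ ≤ _ := le_tiltedStep_discBump_of_small ha hx hx1 (by linarith)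
        (paraboloid_pos_of_discBump_pos hij) (by linarith)

lemma mul_pow_mul_le_of_le_tiltedStep (ha : 0 ≤ a) (hx : 0 ≤ x) {l ε : ℝ} (hl : 0 ≤ l)
    (hε : 0 ≤ ε) {f : ℤ → ℤ → ℝ} (hf : ∀ i j, 0 < f i j → 0 ≤ i ∧ 0 ≤ j)
    (hstep : ∀ i j, 0 < f i j → l * f i j ≤ tiltedStep a x f i j) {U : ℕ → ℤ → ℤ → ℝ}
    (hU : ∀ n i j, 0 ≤ U n i j)
    (hsucc : ∀ n i j, 0 ≤ i → 0 ≤ j → U (n + 1) i j = tiltedStep a x (U n) i j)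
    (hinit : ∀ i j, 0 < f i j → ε * f i j ≤ U 0 i j) (n : ℕ) (i j : ℤ) :
    ε * l ^ n * f i j ≤ U n i j := by
  have hnonpos (n i j) (h : f i j ≤ 0) : ε * l ^ n * f i j ≤ U n i j :=
    (mul_nonpos_of_nonneg_of_nonpos (by positivity) h).trans (hU n i j)
  induction n generalizing i j with
  | zero =>
    rcases le_or_gt (f i j) 0 with h | h
    · exact hnonpos 0 i j h
    · simpa using hinit i j h
  | succ n ih =>
    rcases le_or_gt (f i j) 0 with h | h
    · exact hnonpos _ i j h
    · calc ε * l ^ (n + 1) * f i j = ε * l ^ n * (l * f i j) := by ring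
        _ ≤ ε * l ^ n * tiltedStep a x f i j := by gcongr; exact hstep i j h
        _ = tiltedStep a x (fun i j => ε * l ^ n * f i j) i j := (tiltedStep_const_mul ..).symm
        _ ≤ tiltedStep a x (U n) i j := tiltedStep_mono ha hx ih i j
        _ = U (n + 1) i j := (hsucc n i j (hf i j h).1 (hf i j h).2).symm

/-- The number of tilted walks to `(i, j)` with length in the window `[n, n + M)`. Summing over a
window makes the count positive on a large part of the quadrant simultaneously. -/
noncomputable def windowWalks (a x : ℝ) (M n : ℕ) (i j : ℤ) : ℝ :=
  ∑ k ∈ Finset.range M, tiltedWalks a x (n + k) i j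

lemma windowWalks_nonneg (ha : 0 ≤ a) (hx : 0 ≤ x) (M n : ℕ) (i j : ℤ) :
    0 ≤ windowWalks a x M n i j :=
  Finset.sum_nonneg fun _ _ => tiltedWalks_nonneg ha hx _ i j

lemma windowWalks_succ (hx : x ≠ 0) (M n : ℕ) {i j : ℤ} (hi : 0 ≤ i) (hj : 0 ≤ j) :
    windowWalks a x M (n + 1) i j = tiltedStep a x (windowWalks a x M n) i j := by
  simp only [windowWalks, tiltedStep, Finset.mul_sum, ← Finset.sum_add_distrib]
  refine Finset.sum_congr rfl fun k _ => ?_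
  rw [Nat.add_right_comm, tiltedWalks_succ hx _ hi hj, tiltedStep]

lemma pow_le_windowWalks_zero (ha : 0 ≤ a) (hx : 0 ≤ x) {M i j : ℕ} (h : i + j < M) :
    x ^ (i + j) ≤ windowWalks a x M 0 i j := by
  have hone : x ^ (i + j) ≤ tiltedWalks a x (0 + (i + j)) i j := by
    rw [tiltedWalks, zero_add, ← Nat.cast_add, zpow_natCast]
    exact le_mul_of_one_le_left (by positivity) (one_le_quadrantWalks ha i j)
  exact hone.trans (Finset.single_le_sum (f := fun k => tiltedWalks a x (0 + k) i j)
    (fun k _ => tiltedWalks_nonneg ha hx _ _ _) (Finset.mem_range.2 h))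

lemma windowWalks_le_sum (ha : 0 ≤ a) (hx : 0 ≤ x) (hx1 : x ≤ 1) (M n i j : ℕ) :
    windowWalks a x M n i j ≤ ∑ k ∈ Finset.range (i + j + M), quadrantWalks a (n + k) 0 0 := by
  have htilt (k : ℕ) : tiltedWalks a x (n + k) i j ≤ quadrantWalks a (n + (i + j + k)) 0 0 := by
    rw [tiltedWalks, ← Nat.cast_add, zpow_natCast]
    refine (mul_le_of_le_one_right (quadrantWalks_nonneg ha _ _ _) (pow_le_one₀ hx hx1)).trans
      ((quadrantWalks_le_quadrantWalks_zero_zero ha (n + k) i j).trans_eq ?_)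
    congr 1
    ring
  rw [Finset.sum_range_add]
  exact (Finset.sum_le_sum fun k _ => htilt k).trans
    (le_add_of_nonneg_left (Finset.sum_nonneg fun k _ => quadrantWalks_nonneg ha _ _ _))

theorem exists_mul_pow_le_sum_quadrantWalks (ha : 0 ≤ a) (hx : 0 < x) (h : a * x ^ 3 + x ^ 2 = 1)
    {l : ℝ} (hl0 : 0 < l) (hl : l < diagonalStep a x) :
    ∃ δ > 0, ∃ M : ℕ, ∀ n : ℕ,
      δ * l ^ n ≤ ∑ k ∈ Finset.range M, quadrantWalks a (n + k) 0 0 := by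
  have hx1 := le_one_of_critical ha hx.le h
  obtain ⟨R, hR, hstep⟩ := exists_mul_discBump_le_tiltedStep ha hx h hl0 hl
  set M := 4 * R + 1
  have hinit (i j : ℤ) (hij : 0 < discBump R i j) :
      x ^ (4 * R) / R ^ 2 * discBump R i j ≤ windowWalks a x M 0 i j := by
    obtain ⟨⟨hi, hi'⟩, hj, hj'⟩ := mem_Icc_of_discBump_pos hij
    lift i to ℕ using hi
    lift j to ℕ using hj
    calc x ^ (4 * R) / R ^ 2 * discBump R i j ≤ x ^ (4 * R) / R ^ 2 * (R : ℝ) ^ 2 := by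
          gcongr
          exact discBump_le_sq R i j
      _ = x ^ (4 * R) := div_mul_cancel₀ _ (by positivity)
      _ ≤ x ^ (i + j) := pow_le_pow_of_le_one hx.le hx1 (by omega)
      _ ≤ _ := pow_le_windowWalks_zero ha hx.le (by omega)
  have hbump : discBump R R R = (R : ℝ) ^ 2 := by simp [discBump, paraboloid]
  refine ⟨x ^ (4 * R) / R ^ 2 * R ^ 2, by positivity, R + R + M, fun n => ?_⟩
  calc x ^ (4 * R) / (R : ℝ) ^ 2 * R ^ 2 * l ^ n
      = x ^ (4 * R) / R ^ 2 * l ^ n * discBump R R R := by rw [hbump]; ring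
    _ ≤ windowWalks a x M n R R :=
      mul_pow_mul_le_of_le_tiltedStep ha hx.le hl0.le (by positivity)
        (fun i j hij => ⟨(mem_Icc_of_discBump_pos hij).1.1, (mem_Icc_of_discBump_pos hij).2.1⟩)
        hstep (windowWalks_nonneg ha hx.le M) (fun n i j => windowWalks_succ hx.ne' M n) hinit n R R
    _ ≤ _ := windowWalks_le_sum ha hx.le hx1 M n R R

end Walks

section Pringsheim

variable {c : ℕ → ℝ} {b y r u v : ℝ}

/-- The coefficient of `z ^ k` in the expansion of `∑ c n (b + z) ^ n` in powers of `z`. -/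
noncomputable def taylorCoeff (c : ℕ → ℝ) (b : ℝ) (k : ℕ) : ℝ :=
  ∑' n, c n * (b ^ (n - k) * n.choose k)

lemma hasSum_mul_choose_mul_pow (c b z : ℝ) (n : ℕ) :
    HasSum (fun k => c * (b ^ (n - k) * n.choose k) * z ^ k) (c * (b + z) ^ n) := by
  have hbinom : c * (b + z) ^ n
      = ∑ k ∈ Finset.range (n + 1), c * (b ^ (n - k) * n.choose k) * z ^ k := by
    rw [add_comm, add_pow, Finset.mul_sum]
    exact Finset.sum_congr rfl fun k _ => by ring
  rw [hbinom]
  refine hasSum_sum_of_ne_finset_zero fun k hk => ?_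
  rw [Finset.mem_range, not_lt] at hk
  simp [Nat.choose_eq_zero_of_lt hk]

lemma summable_prod_mul_choose_mul_pow (hc : ∀ n, 0 ≤ c n) (hb : 0 ≤ b)
    (h : Summable fun n => c n * (b + |y|) ^ n) :
    Summable fun x : ℕ × ℕ => c x.1 * (b ^ (x.1 - x.2) * x.1.choose x.2) * y ^ x.2 := by
  have hnonneg (n k : ℕ) : 0 ≤ c n * (b ^ (n - k) * n.choose k) :=
    mul_nonneg (hc n) (by positivity)
  have habs : Summable fun x : ℕ × ℕ =>
      c x.1 * (b ^ (x.1 - x.2) * x.1.choose x.2) * |y| ^ x.2 := by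
    rw [summable_prod_of_nonneg fun x => mul_nonneg (hnonneg x.1 x.2) (by positivity)]
    refine ⟨fun n => (hasSum_mul_choose_mul_pow (c n) b |y| n).summable, ?_⟩
    simpa only [(hasSum_mul_choose_mul_pow _ b |y| _).tsum_eq] using h
  refine Summable.of_norm (habs.congr fun x => ?_)
  rw [norm_mul, norm_pow, Real.norm_eq_abs, Real.norm_eq_abs, abs_of_nonneg (hnonneg x.1 x.2)]

lemma hasSum_taylorCoeff (hc : ∀ n, 0 ≤ c n) (hb : 0 ≤ b)
    (h : Summable fun n => c n * (b + |y|) ^ n) :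
    HasSum (fun k => y ^ k * taylorCoeff c b k) (∑' n, c n * (b + y) ^ n) := by
  have hprod := summable_prod_mul_choose_mul_pow hc hb h
  have hrows := hprod.hasSum.prod_fiberwise fun n => hasSum_mul_choose_mul_pow (c n) b y n
  have hcols := ((Equiv.prodComm ℕ ℕ).hasSum_iff.2 hprod.hasSum).prod_fiberwise fun k =>
    (((Equiv.prodComm ℕ ℕ).summable_iff.2 hprod).prod_factor k).hasSum
  rw [hrows.tsum_eq]
  convert hcols using 2 with k
  rw [taylorCoeff, ← tsum_mul_left]
  exact tsum_congr fun n => mul_comm _ _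

lemma summable_mul_choose (hc : ∀ n, 0 ≤ c n) (hb : 0 ≤ b) (hy : y ≠ 0)
    (h : Summable fun n => c n * (b + |y|) ^ n) (k : ℕ) :
    Summable fun n => c n * (b ^ (n - k) * n.choose k) :=
  (summable_mul_right_iff (pow_ne_zero k hy)).1
    (((Equiv.prodComm ℕ ℕ).summable_iff.2
      (summable_prod_mul_choose_mul_pow hc hb h)).prod_factor k)

lemma taylorCoeff_nonneg (hc : ∀ n, 0 ≤ c n) (hb : 0 ≤ b) (k : ℕ) : 0 ≤ taylorCoeff c b k :=
  tsum_nonneg fun n => mul_nonneg (hc n) (by positivity)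

lemma hasFPowerSeriesAt_taylorCoeff (hc : ∀ n, 0 ≤ c n) (hb : b ∈ Ioo 0 r)
    (hs : ∀ t ∈ Ioo 0 r, Summable fun n => c n * t ^ n) {g : ℝ → ℝ}
    (hg : ∀ t ∈ Ioo 0 r, g t = ∑' n, c n * t ^ n) :
    HasFPowerSeriesAt g (FormalMultilinearSeries.ofScalars ℝ (taylorCoeff c b)) b := by
  rw [hasFPowerSeriesAt_iff]
  filter_upwards [Metric.ball_mem_nhds (0 : ℝ) (lt_min (sub_pos.2 hb.2) hb.1)] with z hz
  rw [mem_ball_zero_iff, Real.norm_eq_abs, lt_min_iff] at hz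
  have hneg := neg_abs_le z
  have hpos := le_abs_self z
  rw [hg (b + z) ⟨by linarith, by linarith⟩]
  simp only [FormalMultilinearSeries.coeff_ofScalars, smul_eq_mul]
  exact hasSum_taylorCoeff hc hb.1.le (hs _ ⟨by linarith [hb.1, abs_nonneg z], by linarith⟩)

lemma sum_range_mul_pow_le_of_hasSum_taylorCoeff (hc : ∀ n, 0 ≤ c n) (hb : 0 ≤ b) (hbu : b ≤ u)
    (hs : ∀ k, Summable fun n => c n * (b ^ (n - k) * n.choose k)) {S : ℝ}
    (h : HasSum (fun k => (u - b) ^ k * taylorCoeff c b k) S) (N : ℕ) :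
    ∑ n ∈ Finset.range N, c n * u ^ n ≤ S := by
  have hbinom (n : ℕ) (hn : n ∈ Finset.range N) : c n * u ^ n
      = ∑ k ∈ Finset.range N, (u - b) ^ k * (c n * (b ^ (n - k) * n.choose k)) := by
    have hsum := hasSum_mul_choose_mul_pow (c n) b (u - b) n
    rw [add_sub_cancel] at hsum
    refine hsum.unique ?_
    simp only [mul_comm ((u - b) ^ _)]
    refine hasSum_sum_of_ne_finset_zero fun k hk => ?_
    rw [Nat.choose_eq_zero_of_lt (by simp at hn hk; lia)]
    simp
  calc ∑ n ∈ Finset.range N, c n * u ^ n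
      = ∑ k ∈ Finset.range N, (u - b) ^ k *
          ∑ n ∈ Finset.range N, c n * (b ^ (n - k) * n.choose k) := by
        rw [Finset.sum_congr rfl hbinom, Finset.sum_comm]
        simp only [Finset.mul_sum]
    _ ≤ ∑ k ∈ Finset.range N, (u - b) ^ k * taylorCoeff c b k := by
        gcongr with k
        exact (hs k).sum_le_tsum _ fun n _ => mul_nonneg (hc n) (by positivity)
    _ ≤ S := sum_le_hasSum _ (fun k _ =>
        mul_nonneg (pow_nonneg (sub_nonneg.2 hbu) k) (taylorCoeff_nonneg hc hb k)) h

lemma exists_hasFPowerSeriesOnBall_of_analyticAt {g : ℝ → ℝ} (hg : AnalyticAt ℝ g r)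
    (hr : 0 < r) :
    ∃ b ∈ Ioo 0 r, ∃ u > r, ∃ (p : FormalMultilinearSeries ℝ ℝ ℝ) (ρ : ENNReal),
      HasFPowerSeriesOnBall g p b ρ ∧ u - b ∈ Metric.eball 0 ρ := by
  obtain ⟨p, ρ, hp⟩ := hg
  obtain ⟨ε, hε0, hερ⟩ := ENNReal.lt_iff_exists_nnreal_btwn.1 hp.r_pos
  replace hp := hp.mono hε0 hερ.le
  have hε : (0 : ℝ) < ε := by exact_mod_cast hε0
  obtain ⟨d, hd0, hd⟩ := exists_between (lt_min (by positivity : 0 < (ε : ℝ) / 3) hr)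
  obtain ⟨hdε, hdr⟩ := lt_min_iff.1 hd
  have hnorm : (‖-d‖₊ : ℝ) = d := by rw [coe_nnnorm, norm_neg, Real.norm_of_nonneg hd0.le]
  have hsmall : ‖-d‖₊ < ε := by
    rw [← NNReal.coe_lt_coe, hnorm]
    linarith
  refine ⟨r + -d, ⟨by linarith, by linarith⟩, r + d, by linarith, _, _,
    hp.changeOrigin (by exact_mod_cast hsmall), ?_⟩
  rw [Metric.mem_eball, edist_zero_right, lt_tsub_iff_right, enorm_eq_nnnorm]
  have hsum : ‖r + d - (r + -d)‖₊ + ‖-d‖₊ < ε := by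
    rw [← NNReal.coe_lt_coe, NNReal.coe_add, hnorm, coe_nnnorm,
      Real.norm_of_nonneg (by linarith)]
    linarith
  exact_mod_cast hsum

/-- Pringsheim's theorem. Recentring shortly before `r` gives again nonnegative coefficients, and a
double series of nonnegative terms may be rearranged. -/
theorem exists_summable_of_analyticAt (hc : ∀ n, 0 ≤ c n) (hr : 0 < r)
    (hs : ∀ t ∈ Ioo 0 r, Summable fun n => c n * t ^ n) {g : ℝ → ℝ} (hg : AnalyticAt ℝ g r)
    (hgf : ∀ t ∈ Ioo 0 r, g t = ∑' n, c n * t ^ n) : ∃ u > r, Summable fun n => c n * u ^ n := by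
  obtain ⟨b, hb, u, hu, p, ρ, hp, hmem⟩ := exists_hasFPowerSeriesOnBall_of_analyticAt hg hr
  rw [hp.hasFPowerSeriesAt.eq_formalMultilinearSeries
    (hasFPowerSeriesAt_taylorCoeff hc hb hs hgf)] at hp
  have hsum := hp.hasSum hmem
  simp only [FormalMultilinearSeries.apply_eq_pow_smul_coeff,
    FormalMultilinearSeries.coeff_ofScalars, smul_eq_mul] at hsum
  obtain ⟨y, hy0, hy⟩ := exists_between (sub_pos.2 hb.2)
  have hchoose := summable_mul_choose hc hb.1.le hy0.ne'
    (hs (b + |y|) ⟨by linarith [hb.1, abs_nonneg y], by rw [abs_of_pos hy0]; linarith⟩)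
  have hu0 : 0 < u := hr.trans hu
  exact ⟨u, hu, summable_of_sum_range_le (fun n => mul_nonneg (hc n) (by positivity))
    (sum_range_mul_pow_le_of_hasSum_taylorCoeff hc hb.1.le (hb.2.trans hu).le hchoose hsum)⟩

lemma summable_mul_pow_of_le_pow (hc : ∀ n, |c n| ≤ v ^ n) (hv : 0 < v) {t : ℝ}
    (ht : |t| < v⁻¹) : Summable fun n => c n * t ^ n := by
  rw [← one_div, lt_div_iff₀ hv] at ht
  refine Summable.of_norm_bounded (summable_geometric_of_lt_one (by positivity) ht) fun n => ?_
  rw [norm_mul, norm_pow, Real.norm_eq_abs, Real.norm_eq_abs, mul_pow, mul_comm]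
  exact mul_le_mul_of_nonneg_left (hc n) (by positivity)

lemma analyticOnNhd_tsum_mul_pow (hc : ∀ n, |c n| ≤ v ^ n) (hv : 0 < v) :
    AnalyticOnNhd ℝ (fun t => ∑' n, c n * t ^ n) (Metric.ball 0 v⁻¹) := by
  have hradius : ENNReal.ofReal v⁻¹ ≤ (FormalMultilinearSeries.ofScalars ℝ c).radius := by
    refine FormalMultilinearSeries.le_radius_of_bound _ 1 fun n => ?_
    rw [FormalMultilinearSeries.ofScalars_norm, Real.coe_toNNReal _ (by positivity), inv_pow,
      mul_inv_le_iff₀ (by positivity), one_mul]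
    exact hc n
  have hpos : 0 < ENNReal.ofReal v⁻¹ := by positivity
  have han := (((FormalMultilinearSeries.ofScalars ℝ c).hasFPowerSeriesOnBall
    (hpos.trans_le hradius)).mono hpos hradius).analyticOnNhd
  rw [Metric.eball_ofReal] at han
  exact han.congr Metric.isOpen_ball fun t _ => tsum_congr fun n => by simp [mul_comm]

end Pringsheim

section CriticalPoint

variable {a x : ℝ} (ha : 0 ≤ a) (hx : 0 < x)
include ha hx

lemma abs_quadrantWalks_le_pow (n : ℕ) : |quadrantWalks a n 0 0| ≤ diagonalStep a x ^ n := by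
  rw [abs_of_nonneg (quadrantWalks_nonneg ha n 0 0)]
  exact quadrantWalks_zero_zero_le_pow ha hx n

lemma analyticOnNhd_excursionSeries :
    AnalyticOnNhd ℝ (excursionSeries a) (Ico 0 (diagonalStep a x)⁻¹) :=
  (analyticOnNhd_tsum_mul_pow (abs_quadrantWalks_le_pow ha hx) (diagonalStep_pos ha hx)).mono
    fun t ht => by rw [mem_ball_zero_iff, Real.norm_of_nonneg ht.1]; exact ht.2

variable (h : a * x ^ 3 + x ^ 2 = 1)
include h

lemma not_summable_quadrantWalks_mul_pow {u : ℝ} (hu : (diagonalStep a x)⁻¹ < u) :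
    ¬ Summable fun n => quadrantWalks a n 0 0 * u ^ n := by
  intro hsum
  have hv := diagonalStep_pos ha hx
  have hu0 : 0 < u := (inv_pos.2 hv).trans hu
  obtain ⟨l, hul, hlv⟩ := exists_between (inv_lt_of_inv_lt₀ hv hu)
  have hl0 : 0 < l := (inv_pos.2 hu0).trans hul
  obtain ⟨δ, hδ, M, hM⟩ := exists_mul_pow_le_sum_quadrantWalks ha hx h hl0 hlv
  have hwindow : Summable fun n => ∑ k ∈ Finset.range M, quadrantWalks a (n + k) 0 0 * u ^ n :=
    summable_sum fun k _ => (((summable_nat_add_iff k).2 hsum).div_const (u ^ k)).congr fun n => by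
      rw [pow_add, ← mul_assoc, mul_div_cancel_right₀ _ (pow_ne_zero k hu0.ne')]
  have hgeom : Summable fun n => δ * (l * u) ^ n := by
    refine hwindow.of_nonneg_of_le (fun n => by positivity) fun n => ?_
    rw [← Finset.sum_mul, mul_pow, ← mul_assoc]
    exact mul_le_mul_of_nonneg_right (hM n) (by positivity)
  have hlt := summable_geometric_iff_norm_lt_one.1 ((summable_mul_left_iff hδ.ne').1 hgeom)
  rw [Real.norm_of_nonneg (by positivity)] at hlt
  exact hlt.not_gt ((inv_lt_iff_one_lt_mul₀ hu0).1 hul)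

lemma not_exists_analyticOnNhd_excursionSeries {s : ℝ} (hs : (diagonalStep a x)⁻¹ < s) :
    ¬ ∃ g : ℝ → ℝ, AnalyticOnNhd ℝ g (Icc 0 s) ∧ g =ᶠ[𝓝 0] excursionSeries a := by
  rintro ⟨g, hg, hgf⟩
  have hr : 0 < (diagonalStep a x)⁻¹ := inv_pos.2 (diagonalStep_pos ha hx)
  have heq : EqOn g (excursionSeries a) (Ico 0 (diagonalStep a x)⁻¹) :=
    (hg.mono fun t ht => ⟨ht.1, ht.2.le.trans hs.le⟩).eqOn_of_preconnected_of_eventuallyEq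
      (analyticOnNhd_excursionSeries ha hx) isPreconnected_Ico ⟨le_rfl, hr⟩ hgf
  obtain ⟨u, hu, hsum⟩ := exists_summable_of_analyticAt
    (fun n => quadrantWalks_nonneg ha n 0 0) hr
    (fun t ht => summable_mul_pow_of_le_pow (abs_quadrantWalks_le_pow ha hx)
      (diagonalStep_pos ha hx) (by rw [abs_of_pos ht.1]; exact ht.2))
    (hg _ ⟨hr.le, hs.le⟩) fun t ht => heq ⟨ht.1.le, ht.2⟩
  exact not_summable_quadrantWalks_mul_pow ha hx h hu hsum

theorem criticalPoint_eq_inv_diagonalStep : criticalPoint a = (diagonalStep a x)⁻¹ := by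
  have hr : 0 < (diagonalStep a x)⁻¹ := inv_pos.2 (diagonalStep_pos ha hx)
  have hmem {s : ℝ} (hs : (diagonalStep a x)⁻¹ < s) :=
    And.intro (hr.trans hs) (not_exists_analyticOnNhd_excursionSeries ha hx h hs)
  refine csInf_eq_of_forall_ge_of_forall_gt_exists_lt ⟨_, hmem (lt_add_one _)⟩ ?_ fun w hw => ?_
  · rintro s ⟨-, hno⟩
    by_contra! hlt
    exact hno ⟨excursionSeries a, (analyticOnNhd_excursionSeries ha hx).mono
      fun t ht => ⟨ht.1, ht.2.trans_lt hlt⟩, EventuallyEq.rfl⟩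
  · obtain ⟨s, hs, hsw⟩ := exists_between hw
    exact ⟨s, hmem hs, hsw⟩

end CriticalPoint

section Duality

open Real
open Complex (I)

lemma exp_mul_natCast_mul_sq (κ φ : ℂ) (n : ℕ) :
    Complex.exp (κ * (n * φ) ^ 2) = Complex.exp (κ * φ ^ 2) ^ n ^ 2 := by
  rw [← Complex.exp_nat_mul]
  congr 1
  push_cast
  ring

section ExpSq

variable {f h : ℂ → ℂ} {K κ μ : ℂ} (hh : Differentiable ℂ h)
  (hf : ∀ z, f z = K * Complex.exp (κ * z ^ 2) * h (μ * z))
include hh hf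

lemma deriv_of_eq_exp_sq_mul (z : ℂ) :
    deriv f z = K * Complex.exp (κ * z ^ 2) * (2 * κ * z * h (μ * z) + μ * deriv h (μ * z)) := by
  have hexp := (((hasDerivAt_pow 2 z).const_mul κ).cexp.const_mul K).mul
    ((hh (μ * z)).hasDerivAt.comp z (hasDerivAt_const_mul μ))
  rw [funext hf]
  refine hexp.deriv.trans ?_
  simp only [Function.comp_apply]
  push_cast
  ring

/-- The contributions of the exponential factor to the derivatives cancel in the step equation. -/
lemma solvesThetaEquations_iff_of_eq_exp_sq_mul (hK : K ≠ 0) (hμ : μ ≠ 0) {a c φ v : ℂ} :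
    SolvesThetaEquations f a c φ v ↔
      SolvesThetaEquations h a (c * Complex.exp (-(4 * (κ * φ ^ 2)))) (μ * φ) v := by
  have hE : Complex.exp (κ * φ ^ 2) ≠ 0 := Complex.exp_ne_zero _
  have hmul (n : ℕ) : f (n * φ) = K * Complex.exp (κ * φ ^ 2) ^ n ^ 2 * h (n * (μ * φ)) := by
    rw [hf, exp_mul_natCast_mul_sq, mul_left_comm]
  have hderiv (n : ℕ) : deriv f (n * φ) = K * Complex.exp (κ * φ ^ 2) ^ n ^ 2 *
      (2 * κ * (n * φ) * h (n * (μ * φ)) + μ * deriv h (n * (μ * φ))) := by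
    rw [deriv_of_eq_exp_sq_mul hh hf, exp_mul_natCast_mul_sq, mul_left_comm μ]
  obtain ⟨d, rfl⟩ : ∃ d, c = d * Complex.exp (κ * φ ^ 2) ^ 4 :=
    ⟨_, (div_mul_cancel₀ c (pow_ne_zero 4 hE)).symm⟩
  have hd : d * Complex.exp (κ * φ ^ 2) ^ 4 * Complex.exp (-(4 * (κ * φ ^ 2))) = d := by
    rw [← Complex.exp_nat_mul, mul_assoc, ← Complex.exp_add, Nat.cast_ofNat, add_neg_cancel,
      Complex.exp_zero, mul_one]
  rw [hd]
  generalize Complex.exp (κ * φ ^ 2) = E at *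
  have h1 := hmul 1
  have h2 := hmul 2
  have h3 := hmul 3
  have h4 := hmul 4
  have hderiv₀ := hderiv 0
  have hderiv₁ := hderiv 1
  have hderiv₂ := hderiv 2
  push_cast at h1 h2 h3 h4 hderiv₀ hderiv₁ hderiv₂
  simp only [zero_mul, one_mul] at h1 hderiv₀ hderiv₁
  constructor <;> rintro ⟨hcube, hsq, hstep⟩
  · rw [h2, h4] at hcube
    rw [h1, h3] at hsq
    rw [h1, h2, hderiv₀, hderiv₁, hderiv₂] at hstep
    constructor
    · exact mul_left_cancel₀ (mul_ne_zero hK (pow_ne_zero 16 hE)) (by linear_combination hcube)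
    · exact mul_left_cancel₀ (mul_ne_zero hK (pow_ne_zero 9 hE)) (by linear_combination hsq)
    · exact mul_left_cancel₀ (mul_ne_zero (mul_ne_zero (pow_ne_zero 2 hK) hμ) (pow_ne_zero 5 hE))
        (by linear_combination hstep)
  · constructor
    · rw [h2, h4]
      linear_combination K * E ^ 16 * hcube
    · rw [h1, h3]
      linear_combination K * E ^ 9 * hsq
    · rw [h1, h2, hderiv₀, hderiv₁, hderiv₂]
      linear_combination K ^ 2 * μ * E ^ 5 * hstep

end ExpSq

section ModularInversion

variable {τ : ℂ} (hτ : 0 < τ.im)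
include hτ

lemma I_div_neg_I_mul_cpow_ne_zero : I / (-I * τ) ^ (1 / 2 : ℂ) ≠ 0 := by
  refine div_ne_zero Complex.I_ne_zero ?_
  rw [Ne, Complex.cpow_eq_zero_iff]
  exact fun h => mul_ne_zero (neg_ne_zero.2 Complex.I_ne_zero) (ne_zero_of_im_pos hτ) h.1

lemma jacobiTh_ne_zero_iff_dual (z : ℂ) :
    jacobiTh z τ ≠ 0 ↔ jacobiTh (z / τ) (-1 / τ) ≠ 0 := by
  rw [jacobiTh_functional_equation z hτ, mul_ne_zero_iff_left
    (mul_ne_zero (I_div_neg_I_mul_cpow_ne_zero hτ) (Complex.exp_ne_zero _))]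

theorem solvesThetaEquations_jacobiTh_iff_dual {a c γ v : ℂ} :
    SolvesThetaEquations (fun z => jacobiTh z τ) a c γ v ↔
      SolvesThetaEquations (fun z => jacobiTh z (-1 / τ)) a
        (c * Complex.exp (4 * I * γ ^ 2 / (π * τ))) (γ / τ) v := by
  have hf (z : ℂ) : jacobiTh z τ = I / (-I * τ) ^ (1 / 2 : ℂ)
      * Complex.exp (-I / (π * τ) * z ^ 2) * jacobiTh (τ⁻¹ * z) (-1 / τ) := by
    rw [jacobiTh_functional_equation z hτ, inv_mul_eq_div,
      show -I / (π * τ) * z ^ 2 = -(I * z ^ 2 / (π * τ)) by ring]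
  rw [solvesThetaEquations_iff_of_eq_exp_sq_mul (differentiable_jacobiTh (im_neg_one_div_pos hτ))
    hf (I_div_neg_I_mul_cpow_ne_zero hτ) (inv_ne_zero (ne_zero_of_im_pos hτ)), inv_mul_eq_div]
  congr! 3
  ring

end ModularInversion

section ImaginaryPeriod

variable {s : ℝ} (hs : 0 < s)
include hs

lemma im_I_mul_ofReal_pos : 0 < (I * (s : ℂ)).im := by simpa using hs

lemma neg_one_div_I_mul_ofReal : -1 / (I * (s : ℂ)) = I * (s⁻¹ : ℝ) := by
  have hs0 : (s : ℂ) ≠ 0 := Complex.ofReal_ne_zero.2 hs.ne'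
  push_cast
  field_simp
  rw [Complex.I_sq]

lemma I_mul_mul_div_I_mul (φ : ℂ) : I * s * φ / (I * s) = φ :=
  mul_div_cancel_left₀ _ (mul_ne_zero Complex.I_ne_zero (Complex.ofReal_ne_zero.2 hs.ne'))

lemma jacobiTh_I_mul_ne_zero {φ : ℝ} (hφ : φ ∈ Ioo 0 π) :
    jacobiTh (I * s * φ) (I * s) ≠ 0 := by
  rw [jacobiTh_ne_zero_iff_dual (im_I_mul_ofReal_pos hs), I_mul_mul_div_I_mul hs,
    neg_one_div_I_mul_ofReal hs, jacobiTh_ofReal]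
  exact mul_ne_zero (I_mul_exp_ne_zero _) (Complex.ofReal_ne_zero.2 (theta₁_pos
    (Ioo_subset_Ico_self (exp_neg_pi_mul_mem (inv_pos.2 hs))) hφ).ne')

lemma solvesThetaEquations_jacobiTh_I_mul_iff {a c : ℂ} {φ v : ℝ} :
    SolvesThetaEquations (fun z => jacobiTh z (I * s)) a c (I * s * φ) v ↔
      SolvesThetaEquations (fun z => jacobiTh z (I * (s⁻¹ : ℝ))) a
        (c * (exp (-(4 * s * φ ^ 2 / π)) : ℝ)) φ v := by
  have hs0 : (s : ℂ) ≠ 0 := Complex.ofReal_ne_zero.2 hs.ne'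
  have hexp : 4 * I * (I * s * φ) ^ 2 / (π * (I * s)) = -(4 * s * φ ^ 2 / π) := by
    field_simp
    linear_combination φ ^ 2 * Complex.I_sq
  rw [solvesThetaEquations_jacobiTh_iff_dual (im_I_mul_ofReal_pos hs),
    neg_one_div_I_mul_ofReal hs, hexp, I_mul_mul_div_I_mul hs]
  push_cast
  rfl

end ImaginaryPeriod

lemma exists_ofReal_eq_of_sq_of_cube {d : ℂ} {x y : ℝ} (hx : d ^ 2 = x) (hy : d ^ 3 = y) :
    ∃ r : ℝ, d = r := by
  refine ⟨y / x, ?_⟩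
  rw [Complex.ofReal_div, ← hx, ← hy]
  rcases eq_or_ne d 0 with rfl | hd
  · simp
  · field_simp

end Duality

section Parametrisation

open Real
open Complex (I)

lemma solvesThetaEquations_jacobiTh_iff_of_ne_zero {a t : ℝ} {c γ τ : ℂ} (hτ : 0 < τ.im)
    (h1 : jacobiTh γ τ ≠ 0) (h2 : jacobiTh (2 * γ) τ ≠ 0) :
    SolvesThetaEquations (fun z => jacobiTh z τ) a c γ (t : ℂ)⁻¹ ↔
      (a : ℂ) * c ^ 3 = -(jacobiTh (4 * γ) τ / jacobiTh (2 * γ) τ) ∧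
      c ^ 2 = jacobiTh (3 * γ) τ / jacobiTh γ τ ∧
      c / (t : ℂ) =
        4 * (jacobiThDeriv γ τ * jacobiTh (2 * γ) τ / (jacobiThDeriv 0 τ * jacobiTh γ τ))
          - 2 * (jacobiThDeriv (2 * γ) τ / jacobiThDeriv 0 τ) := by
  have hd : jacobiThDeriv 0 τ ≠ 0 := (isThreeTermPair_jacobiTh hτ).deriv_zero_ne_zero h1
  have hstep : 4 * (jacobiThDeriv γ τ * jacobiTh (2 * γ) τ / (jacobiThDeriv 0 τ * jacobiTh γ τ))
      - 2 * (jacobiThDeriv (2 * γ) τ / jacobiThDeriv 0 τ) =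
      (4 * jacobiThDeriv γ τ * jacobiTh (2 * γ) τ - 2 * jacobiThDeriv (2 * γ) τ * jacobiTh γ τ)
        / (jacobiThDeriv 0 τ * jacobiTh γ τ) := by
    field_simp
  rw [hstep, ← neg_div, eq_div_iff h2, eq_div_iff h1, eq_div_iff (mul_ne_zero hd h1),
    div_eq_mul_inv]
  exact ⟨fun h => ⟨h.cube, h.sq, h.step⟩, fun h => ⟨h.1, h.2.1, h.2.2⟩⟩

lemma walkKernel_eq_zero_of_step_eq {a t : ℝ} {x y : ℂ} (hx : x ≠ 0) (hy : y ≠ 0) (ht : t ≠ 0)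
    (h : x + y + 1 / x + 1 / y + a * (x * y) = (t : ℂ)⁻¹) : walkKernel a t x y = 0 := by
  have ht' : (t : ℂ) ≠ 0 := Complex.ofReal_ne_zero.2 ht
  have hpoly : x ^ 2 * y + x * y ^ 2 + y + x + a * x ^ 2 * y ^ 2 = x * y * (t : ℂ)⁻¹ := by
    rw [← h]
    field_simp
  rw [walkKernel, hpoly]
  field_simp
  ring

lemma walkKernel_thetaX_thetaY {a t : ℝ} {c γ τ z : ℂ} (hτ : 0 < τ.im) (ht : t ≠ 0) (hc : c ≠ 0)
    (h1 : jacobiTh γ τ ≠ 0) (h2 : jacobiTh (2 * γ) τ ≠ 0)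
    (hs : SolvesThetaEquations (fun z => jacobiTh z τ) a c γ (t : ℂ)⁻¹)
    (hX : jacobiTh (z - γ) τ * jacobiTh (z + 2 * γ) τ ≠ 0)
    (hY : jacobiTh (z + γ) τ * jacobiTh (z - 2 * γ) τ ≠ 0) :
    walkKernel a t (thetaX c γ τ z) (thetaY c γ τ z) = 0 := by
  rcases eq_or_ne (jacobiTh z τ) 0 with hz | hz
  · simp [walkKernel, thetaX, thetaY, hz]
  obtain ⟨hm, hpp⟩ := mul_ne_zero_iff.1 hX
  obtain ⟨hp, hmm⟩ := mul_ne_zero_iff.1 hY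
  have h := isThreeTermPair_jacobiTh hτ
  exact walkKernel_eq_zero_of_step_eq (div_ne_zero (mul_ne_zero hc (mul_ne_zero hz hp)) hX)
    (div_ne_zero (mul_ne_zero hc (mul_ne_zero hz hm)) hY) ht
    (h.step_ratio hs hc (h.deriv_zero_ne_zero h1) h1 h2 hz hp hm hpp hmm)

end Parametrisation

section IntervalInverse

section LinearOrder

variable {α β : Type*} [LinearOrder α] [DenselyOrdered α] [TopologicalSpace α] [OrderTopology α]
  [LinearOrder β] [TopologicalSpace β] [OrderTopology β] {T : α → β} {a b x : α} {c d : β}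

lemma lt_apply_of_strictMonoOn_Ioo (hT : StrictMonoOn T (Ioo a b))
    (hleft : Tendsto T (𝓝[>] a) (𝓝 c)) (hx : x ∈ Ioo a b) : c < T x := by
  have := nhdsGT_neBot_of_exists_gt ⟨x, hx.1⟩
  obtain ⟨y, hay, hyx⟩ := exists_between hx.1
  have hy : y ∈ Ioo a b := ⟨hay, hyx.trans hx.2⟩
  refine (le_of_tendsto hleft ?_).trans_lt (hT hy hx hyx)
  filter_upwards [Ioo_mem_nhdsGT hay] with z hz
  exact (hT ⟨hz.1, hz.2.trans hy.2⟩ hy hz.2).le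

lemma apply_lt_of_strictMonoOn_Ioo (hT : StrictMonoOn T (Ioo a b))
    (hright : Tendsto T (𝓝[<] b) (𝓝 d)) (hx : x ∈ Ioo a b) : T x < d := by
  have := nhdsLT_neBot_of_exists_lt ⟨x, hx.2⟩
  obtain ⟨y, hxy, hyb⟩ := exists_between hx.2
  have hy : y ∈ Ioo a b := ⟨hx.1.trans hxy, hyb⟩
  refine (hT hx hy hxy).trans_le (ge_of_tendsto hright ?_)
  filter_upwards [Ioo_mem_nhdsLT hyb] with z hz
  exact (hT hy ⟨hy.1.trans hz.1, hz.2⟩ hz.1).le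

end LinearOrder

variable {α β : Type*} [ConditionallyCompleteLinearOrder α] [DenselyOrdered α] [TopologicalSpace α]
  [OrderTopology α] [LinearOrder β] [TopologicalSpace β] [OrderTopology β]
  {T : α → β} {a b : α} {c d : β}

lemma strictMonoOn_Ioo_of_injOn [DenselyOrdered β] (hab : a < b) (hcd : c < d)
    (hcont : ContinuousOn T (Ioo a b)) (hinj : InjOn T (Ioo a b))
    (hleft : Tendsto T (𝓝[>] a) (𝓝 c)) (hright : Tendsto T (𝓝[<] b) (𝓝 d)) :
    StrictMonoOn T (Ioo a b) := by
  refine (hcont.strictMonoOn_of_injOn_Ioo hab hinj).resolve_right fun hanti => ?_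
  have := nhdsGT_neBot_of_exists_gt ⟨b, hab⟩
  obtain ⟨m, hcm, hmd⟩ := exists_between hcd
  obtain ⟨x, hxm, hx⟩ := ((hleft.eventually_lt_const hcm).and (Ioo_mem_nhdsGT hab)).exists
  have := nhdsLT_neBot_of_exists_lt ⟨x, hx.2⟩
  obtain ⟨y, hmy, hy⟩ := ((hright.eventually_const_lt hmd).and (Ioo_mem_nhdsLT hx.2)).exists
  exact (hxm.trans hmy).not_gt (hanti hx ⟨hx.1.trans hy.1, hy.2⟩ hy.1)

lemma image_Ioo_eq_of_tendsto (hab : a < b) (hT : StrictMonoOn T (Ioo a b))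
    (hcont : ContinuousOn T (Ioo a b))
    (hleft : Tendsto T (𝓝[>] a) (𝓝 c)) (hright : Tendsto T (𝓝[<] b) (𝓝 d)) :
    T '' Ioo a b = Ioo c d := by
  have := nhdsGT_neBot_of_exists_gt ⟨b, hab⟩
  have := nhdsLT_neBot_of_exists_lt ⟨a, hab⟩
  refine Subset.antisymm ?_ (isPreconnected_Ioo.intermediate_value_Ioo
    (le_principal_iff.2 (Ioo_mem_nhdsGT hab)) (le_principal_iff.2 (Ioo_mem_nhdsLT hab))
    hcont hleft hright)
  rintro _ ⟨x, hx, rfl⟩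
  exact ⟨lt_apply_of_strictMonoOn_Ioo hT hleft hx, apply_lt_of_strictMonoOn_Ioo hT hright hx⟩

theorem exists_continuousOn_inverse_Ioo [DenselyOrdered β] (hab : a < b) (hcd : c < d)
    (hcont : ContinuousOn T (Ioo a b)) (hinj : InjOn T (Ioo a b))
    (hleft : Tendsto T (𝓝[>] a) (𝓝 c)) (hright : Tendsto T (𝓝[<] b) (𝓝 d)) :
    ∃ q : β → α, (∀ t ∈ Ioo c d, q t ∈ Ioo a b ∧ T (q t) = t) ∧ ContinuousOn q (Ioo c d) ∧
      Tendsto q (𝓝[>] c) (𝓝 a) ∧ Tendsto q (𝓝[<] d) (𝓝 b) := by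
  have hT := strictMonoOn_Ioo_of_injOn hab hcd hcont hinj hleft hright
  have himage := image_Ioo_eq_of_tendsto hab hT hcont hleft hright
  let e : Ioo a b ≃o Ioo c d := (hT.orderIso T (Ioo a b)).trans (OrderIso.setCongr _ _ himage)
  obtain ⟨q, hq⟩ : ∃ q : β → α, ∀ t : Ioo c d, q t = e.symm t :=
    ⟨_, Subtype.val_injective.extend_apply (fun t => (e.symm t : α)) fun _ => a⟩
  have hTq (t : Ioo c d) : T (q t) = t := by
    rw [hq]
    exact congrArg Subtype.val (e.apply_symm_apply t)
  refine ⟨q, fun t ht => ⟨hq ⟨t, ht⟩ ▸ (e.symm ⟨t, ht⟩).2, hTq ⟨t, ht⟩⟩, ?_, ?_, ?_⟩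
  · rw [continuousOn_iff_continuous_domRestrict,
      show (Ioo c d).domRestrict q = fun t => (e.symm t : α) from funext hq]
    exact continuous_subtype_val.comp e.symm.continuous
  · rw [← tendsto_comp_coe_Ioo_atBot hcd]
    simp only [hq]
    exact ((tendsto_Ioo_atBot (.of_dense _)).1 e.symm.tendsto_atBot).mono_right nhdsWithin_le_nhds
  · rw [← tendsto_comp_coe_Ioo_atTop hcd]
    simp only [hq]
    exact ((tendsto_Ioo_atTop (.of_dense _)).1 e.symm.tendsto_atTop).mono_right nhdsWithin_le_nhds

end IntervalInverse

section ParametrisationOfNome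

open Real
open Complex (I)

lemma SolvesThetaEquations.exists_scale_eq_ofReal {F : ℂ → ℂ} {f : ℝ → ℝ} {K d v : ℂ} {a φ : ℝ}
    (hK : K ≠ 0) (hF : ∀ x : ℝ, F x = K * f x) (ha : a ≠ 0) (h1 : f φ ≠ 0) (h2 : f (2 * φ) ≠ 0)
    (h : SolvesThetaEquations F a d φ v) : ∃ r : ℝ, d = r := by
  have hmul (n : ℕ) : F (n * φ) = K * f (n * φ) := by
    rw [← Complex.ofReal_natCast, ← Complex.ofReal_mul, hF]
  have hF2 := hmul 2
  have hF3 := hmul 3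
  have hF4 := hmul 4
  push_cast at hF2 hF3 hF4
  refine exists_ofReal_eq_of_sq_of_cube (x := f (3 * φ) / f φ)
    (y := -f (4 * φ) / (a * f (2 * φ))) ?_ ?_
  · rw [Complex.ofReal_div, eq_div_iff (Complex.ofReal_ne_zero.2 h1)]
    have hsq := h.sq
    rw [hF, hF3] at hsq
    exact mul_left_cancel₀ hK (by linear_combination hsq)
  · rw [Complex.ofReal_div, eq_div_iff (Complex.ofReal_ne_zero.2 (mul_ne_zero ha h2)),
      Complex.ofReal_mul, Complex.ofReal_neg]
    have hcube := h.cube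
    rw [hF2, hF4] at hcube
    exact mul_left_cancel₀ hK (by linear_combination hcube)

lemma SolvesThetaEquations.value_eq_stepValue {a c φ v p : ℝ} (ha : 0 < a) (hv : 0 < v)
    (hp : p ∈ Ioo (0 : ℝ) 1) (hφ : φ ∈ Ioo 0 (π / 2))
    (h : SolvesThetaEquations (theta₁ p) a c φ v) : v = stepValue a p := by
  have hc := h.scale_pos hp hφ hv
  obtain ⟨rfl, rfl⟩ := eq_thetaAngle_and_thetaScale ha (Ioo_subset_Ico_self hp)
    (h.angle_mem hp hφ ha hv) hc h.sq h.cube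
  exact h.value_eq hp hφ hc.ne'

lemma jacobiTh_I_mul_ne_zero_and_two_mul {s φ : ℝ} (hs : 0 < s) (hφ : φ ∈ Ioo 0 (π / 2)) :
    jacobiTh (I * s * φ) (I * s) ≠ 0 ∧ jacobiTh (2 * (I * s * φ)) (I * s) ≠ 0 := by
  refine ⟨jacobiTh_I_mul_ne_zero hs ⟨hφ.1, by linarith [hφ.2, pi_pos]⟩, ?_⟩
  have h := jacobiTh_I_mul_ne_zero hs (φ := 2 * φ) ⟨by linarith [hφ.1], by linarith [hφ.2]⟩
  rwa [Complex.ofReal_mul, Complex.ofReal_ofNat, mul_left_comm] at h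

lemma IsThetaParametrisation.exists_eq_I_mul {a t : ℝ} {c γ τ : ℂ}
    (h : IsThetaParametrisation a t c γ τ) :
    ∃ s φ : ℝ, 0 < s ∧ φ ∈ Ioo 0 (π / 2) ∧ τ = I * s ∧ γ = I * s * φ := by
  have hγ : 0 < γ.im := by simpa using h.gamma_pos
  have hlt : 2 * γ.im < π * τ.im := by simpa using h.gamma_lt
  have hτ : 0 < τ.im := pos_of_mul_pos_right (by linarith) pi_pos.le
  refine ⟨τ.im, γ.im / τ.im, hτ, ⟨div_pos hγ hτ, ?_⟩, ?_, ?_⟩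
  · rw [div_lt_iff₀ hτ]
    linarith
  · apply Complex.ext <;> simp [h.tau_re]
  · rw [mul_assoc, ← Complex.ofReal_mul, mul_div_cancel₀ _ hτ.ne']
    apply Complex.ext <;> simp [h.gamma_re]

theorem IsThetaParametrisation.exists_stepValue_eq {a t : ℝ} (ha : 0 < a) (ht : 0 < t) {c γ τ : ℂ}
    (h : IsThetaParametrisation a t c γ τ) :
    ∃ s : ℝ, 0 < s ∧ τ = I * s ∧ stepValue a (exp (-(π * s⁻¹))) = t⁻¹ := by
  obtain ⟨s, φ, hs, hφ, rfl, rfl⟩ := h.exists_eq_I_mul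
  obtain ⟨h1, h2⟩ := jacobiTh_I_mul_ne_zero_and_two_mul hs hφ
  have hsolves := (solvesThetaEquations_jacobiTh_iff_of_ne_zero (im_I_mul_ofReal_pos hs) h1 h2).2
    ⟨h.eq_c3, h.eq_c2, h.eq_t⟩
  rw [← Complex.ofReal_inv, solvesThetaEquations_jacobiTh_I_mul_iff hs] at hsolves
  have hp := exp_neg_pi_mul_mem (inv_pos.2 hs)
  have hp' := Ioo_subset_Ico_self hp
  obtain ⟨d, hd⟩ := hsolves.exists_scale_eq_ofReal (I_mul_exp_ne_zero _) (jacobiTh_ofReal _)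
    ha.ne' (theta₁_pos hp' ⟨hφ.1, by linarith [hφ.2, pi_pos]⟩).ne'
    (theta₁_pos hp' ⟨by linarith [hφ.1], by linarith [hφ.2]⟩).ne'
  rw [hd, solvesThetaEquations_jacobiTh_iff (inv_pos.2 hs)] at hsolves
  exact ⟨s, hs, rfl, (hsolves.value_eq_stepValue ha (inv_pos.2 ht) hp hφ).symm⟩

theorem exists_isThetaParametrisation {a s : ℝ} (ha : 0 < a) (hs : 0 < s) :
    ∃ c γ, IsThetaParametrisation a (stepValue a (exp (-(π * s⁻¹))))⁻¹ c γ (I * s) := by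
  have hp := exp_neg_pi_mul_mem (inv_pos.2 hs)
  have hp' := Ioo_subset_Ico_self hp
  obtain ⟨hgt, hlt⟩ := (thetaAngle_spec ha hp').1
  have hreal := (solvesThetaEquations_jacobiTh_iff (inv_pos.2 hs)).2
    (solvesThetaEquations_stepValue ha hp)
  have hd := thetaScale_pos ha hp'
  have hv := stepValue_pos ha hp'
  generalize thetaAngle a (exp (-(π * s⁻¹))) = φ at *
  generalize thetaScale a (exp (-(π * s⁻¹))) = d at *
  generalize stepValue a (exp (-(π * s⁻¹))) = v at *
  have hφ : φ ∈ Ioo 0 (π / 2) := ⟨by linarith [pi_pos], by linarith [pi_pos]⟩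
  have hE : ((exp (-(4 * s * φ ^ 2 / π)) : ℝ) : ℂ) ≠ 0 := Complex.ofReal_ne_zero.2 (exp_ne_zero _)
  obtain ⟨c, hc⟩ : ∃ c : ℂ, d = c * (exp (-(4 * s * φ ^ 2 / π)) : ℝ) :=
    ⟨_, (div_mul_cancel₀ _ hE).symm⟩
  have hc0 : c ≠ 0 := left_ne_zero_of_mul (hc ▸ Complex.ofReal_ne_zero.2 hd.ne')
  have hτ := im_I_mul_ofReal_pos hs
  obtain ⟨h1, h2⟩ := jacobiTh_I_mul_ne_zero_and_two_mul hs hφ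
  rw [hc, ← solvesThetaEquations_jacobiTh_I_mul_iff hs,
    show (v : ℂ) = ((v⁻¹ : ℝ) : ℂ)⁻¹ by rw [Complex.ofReal_inv, inv_inv]] at hreal
  obtain ⟨hcube, hsq, hstep⟩ := (solvesThetaEquations_jacobiTh_iff_of_ne_zero hτ h1 h2).1 hreal
  have hγτ : 2 * (s * φ) < π * s := by nlinarith [hφ.2]
  exact ⟨c, I * s * φ, by simp, by simp, by simpa using mul_pos hs hφ.1, by simpa using hγτ,
    hcube, hsq, hstep, fun _ => walkKernel_thetaX_thetaY hτ (inv_ne_zero hv.ne') hc0 h1 h2 hreal⟩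

end ParametrisationOfNome

section NomeOfTime

open Real
open Complex (I)

/-- The involution of the unit interval that exchanges the nome of a theta function with the nome
of its image under `τ ↦ -1/τ`. -/
noncomputable def dualNome (q : ℝ) : ℝ := exp (π ^ 2 / log q)

lemma dualNome_mem {q : ℝ} (hq : q ∈ Ioo (0 : ℝ) 1) : dualNome q ∈ Ioo (0 : ℝ) 1 :=
  ⟨exp_pos _, exp_lt_one_iff.2 (div_neg_of_pos_of_neg (by positivity) (log_neg hq.1 hq.2))⟩

lemma dualNome_dualNome {q : ℝ} (hq : q ∈ Ioo (0 : ℝ) 1) : dualNome (dualNome q) = q := by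
  rw [dualNome, dualNome, log_exp, div_div_cancel₀ (by positivity), exp_log hq.1]

lemma dualNome_injOn : InjOn dualNome (Ioo 0 1) :=
  LeftInvOn.injOn fun _ => dualNome_dualNome

lemma dualNome_exp_neg_pi_mul {s : ℝ} : dualNome (exp (-(π * s))) = exp (-(π * s⁻¹)) := by
  rw [dualNome, log_exp, div_neg, pow_two, mul_div_mul_left _ _ pi_ne_zero, div_eq_mul_inv]

lemma continuousOn_dualNome : ContinuousOn dualNome (Ioo 0 1) := fun _ hq =>
  (continuousAt_const.div (continuousAt_log hq.1.ne')
    (log_neg hq.1 hq.2).ne).rexp.continuousWithinAt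

lemma tendsto_dualNome_zero : Tendsto dualNome (𝓝[>] 0) (𝓝[<] 1) := by
  refine tendsto_nhdsWithin_iff.2 ⟨?_, ?_⟩
  · rw [← exp_zero]
    exact (tendsto_log_nhdsGT_zero.const_div_atBot (π ^ 2)).rexp
  · filter_upwards [Ioo_mem_nhdsGT one_pos] with q hq
    exact (dualNome_mem hq).2

lemma tendsto_dualNome_one : Tendsto dualNome (𝓝[<] 1) (𝓝[>] 0) := by
  refine tendsto_nhdsWithin_iff.2 ⟨?_, Eventually.of_forall fun _ => exp_pos _⟩
  have hlog : Tendsto log (𝓝[<] 1) (𝓝[<] 0) := by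
    refine tendsto_nhdsWithin_iff.2 ⟨?_, ?_⟩
    · simpa only [log_one] using (continuousAt_log one_ne_zero).tendsto.mono_left nhdsWithin_le_nhds
    · filter_upwards [Ioo_mem_nhdsLT one_pos] with q hq
      exact log_neg hq.1 hq.2
  exact tendsto_exp_atBot.comp
    ((tendsto_inv_nhdsLT_zero.comp hlog).const_mul_atBot (pow_pos pi_pos 2))

/-- The value of `t` at which the theta parametrisation of the walk has nome `q`. -/
noncomputable def nomeTime (a q : ℝ) : ℝ := (stepValue a (dualNome q))⁻¹

variable {a : ℝ} (ha : 0 < a)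
include ha

lemma nomeTime_injOn : InjOn (nomeTime a) (Ioo 0 1) :=
  inv_injective.comp_injOn ((stepValue_injOn ha).comp dualNome_injOn fun _ => dualNome_mem)

lemma continuousOn_nomeTime : ContinuousOn (nomeTime a) (Ioo 0 1) :=
  ((continuousOn_stepValue ha).comp continuousOn_dualNome fun _ hq =>
    Ioo_subset_Ico_self (dualNome_mem hq)).inv₀ fun _ hq =>
      (stepValue_pos ha (Ioo_subset_Ico_self (dualNome_mem hq))).ne'

lemma tendsto_nomeTime_zero : Tendsto (nomeTime a) (𝓝[>] 0) (𝓝 0) :=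
  ((tendsto_stepValue_atTop ha).comp tendsto_dualNome_zero).inv_tendsto_atTop

lemma criticalPoint_eq_inv_stepValue_zero : criticalPoint a = (stepValue a 0)⁻¹ :=
  criticalPoint_eq_inv_diagonalStep ha.le (symmPoint_pos ha ⟨le_rfl, one_pos⟩)
    (symmPoint_nome_zero ha)

lemma criticalPoint_pos : 0 < criticalPoint a := by
  rw [criticalPoint_eq_inv_stepValue_zero ha]
  exact inv_pos.2 (stepValue_pos ha ⟨le_rfl, one_pos⟩)

lemma tendsto_nomeTime_one : Tendsto (nomeTime a) (𝓝[<] 1) (𝓝 (criticalPoint a)) := by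
  have h0 : (0 : ℝ) ∈ Ico (0 : ℝ) 1 := ⟨le_rfl, one_pos⟩
  have hright : Tendsto (stepValue a) (𝓝[>] 0) (𝓝 (stepValue a 0)) :=
    ((continuousOn_stepValue ha) 0 h0).mono_of_mem_nhdsWithin
      (mem_of_superset (Ioo_mem_nhdsGT one_pos) Ioo_subset_Ico_self)
  rw [criticalPoint_eq_inv_stepValue_zero ha]
  exact (hright.comp tendsto_dualNome_one).inv₀ (stepValue_pos ha h0).ne'

lemma exists_isThetaParametrisation_nomeTime {q : ℝ} (hq : q ∈ Ioo (0 : ℝ) 1) :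
    ∃ c γ τ, IsThetaParametrisation a (nomeTime a q) c γ τ := by
  obtain ⟨s, hs, rfl⟩ := exists_eq_exp_neg_pi_mul hq
  rw [nomeTime, dualNome_exp_neg_pi_mul]
  obtain ⟨c, γ, h⟩ := exists_isThetaParametrisation ha hs
  exact ⟨c, γ, _, h⟩

lemma IsThetaParametrisation.exp_eq {t : ℝ} (ht : 0 < t) {c γ τ : ℂ}
    (h : IsThetaParametrisation a t c γ τ) {q : ℝ} (hq : q ∈ Ioo (0 : ℝ) 1)
    (hqt : nomeTime a q = t) : Complex.exp (I * π * τ) = q := by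
  obtain ⟨s, hs, rfl, hst⟩ := h.exists_stepValue_eq ha ht
  have hs' : nomeTime a (exp (-(π * s))) = t := by
    rw [nomeTime, dualNome_exp_neg_pi_mul, hst, inv_inv]
  rw [nomeTime_injOn ha hq (exp_neg_pi_mul_mem hs) (hqt.trans hs'.symm), Complex.ofReal_exp]
  congr 1
  push_cast
  linear_combination π * s * Complex.I_sq

end NomeOfTime

theorem mainTheorem7 (a : ℝ) (ha : 0 < a) :
    0 < criticalPoint a ∧
    ∃ q : ℝ → ℝ,
      (∀ t ∈ Ioo 0 (criticalPoint a),
        (∃ c γ τ : ℂ, IsThetaParametrisation a t c γ τ) ∧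
        ∀ c γ τ : ℂ, IsThetaParametrisation a t c γ τ →
          Complex.exp (Complex.I * Real.pi * τ) = (q t : ℂ)) ∧
      (∀ t ∈ Ioo 0 (criticalPoint a), 0 < q t ∧ q t < 1) ∧
      ContinuousOn q (Ioo 0 (criticalPoint a)) ∧
      Tendsto q (𝓝[>] 0) (𝓝 0) ∧
      Tendsto q (𝓝[<] (criticalPoint a)) (𝓝 1) := by
  obtain ⟨q, hq, hcont, hzero, hone⟩ := exists_continuousOn_inverse_Ioo zero_lt_one
    (criticalPoint_pos ha) (continuousOn_nomeTime ha) (nomeTime_injOn ha)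
    (tendsto_nomeTime_zero ha) (tendsto_nomeTime_one ha)
  refine ⟨criticalPoint_pos ha, q, fun t ht => ⟨?_, fun c γ τ h => ?_⟩, fun t ht => (hq t ht).1,
    hcont, hzero, hone⟩
  · obtain ⟨hmem, htime⟩ := hq t ht
    exact htime ▸ exists_isThetaParametrisation_nomeTime ha hmem
  · exact h.exp_eq ha ht.1 (hq t ht).1 (hq t ht).2
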